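/- There are a streaming algorithm and a constant $C$ such that the following holds for every undirected simple graph $G$ with $n\ge 1$ vertices and $m$ edges, for every integer $k\ge 1$, and for every order in which the edges of $G$ may be shown (the order, and the order of the two ends of an edge, may change from pass to pass). The algorithm is one fixed program for a random-access machine; it is given $n$ and $k$, it reads the edges of $G$ only as a stream, one after the other, in one or several passes, and its memory consists of words of at most $C\log_2(n+k)$ bits. It stops with the parent function of a depth-first search (DFS) forest of $G$ in its memory, i.e. of a rooted forest that consists of one rooted spanning tree of each connected component of $G$ and in which, for every edge of $G$, one end is an ancestor of the other; in particular, it computes a DFS tree of $G$ if $G$ is connected. The algorithm makes at most $\lceil n/k\rceil$ passes, it uses at most $C\,nk$ words of memory, and in each pass it executes at most $C\,(m+n)\,\alpha(m+n,n)$ steps; if $G$ is connected and $n\ge 2$, it executes at most $C\,m\,\alpha(m,n)$ steps in each pass. Here $\alpha$ is the inverse Ackermann function, $\alpha(m,n)=\min\{i\ge 1: A(i,4\lceil m/n\rceil)>\log_2 n\}$ with $A(0,x)=2x$, $A(i,0)=0$ and $A(i,1)=2$ for $i\ge1$, and $A(i,x)=A(i-1,A(i,x-1))$ for $i\ge1$,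 $x\ge2$. The steps executed before the first pass satisfy the same bounds. -/

import Mathlib

/-! ## Programs

A multi-pass streaming algorithm is a fixed `while`-program for a random-access machine. It has
finitely many registers and finitely many arrays of memory cells, each holding a natural number
(a machine word), and it can read the input stream only sequentially, one edge at a time. -/

namespace Streaming

/-- Expressions over the registers and the memory. -/
inductive Expr : Type
  /-- a constant -/
  | const (c : ℕ)
  /-- the content of register `x` -/
  | var (x : ℕ)
  /-- the content of the cell of array `a` whose address is the value of `i` -/
  | load (a : ℕ) (i : Expr)
  | plus (e f : Expr)
  /-- truncated subtraction -/
  | minus (e f : Expr)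
  | times (e f : Expr)
  /-- division rounded down -/
  | quot (e f : Expr)
  /-- `1` if `e < f`, otherwise `0` -/
  | lt (e f : Expr)
  /-- `1` if `e = f`, otherwise `0` -/
  | eq (e f : Expr)

/-- The commands. A test succeeds if the value of its expression is not `0`. -/
inductive Cmd : Type
  | skip
  /-- put the value of `e` into register `x` -/
  | assign (x : ℕ) (e : Expr)
  /-- put the value of `e` into the cell of array `a` whose address is the value of `i` -/
  | store (a : ℕ) (i e : Expr)
  | seq (c d : Cmd)
  | branch (e : Expr) (c d : Cmd)
  /-- repeat `c` while the value of `e` is not `0` -/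
  | loop (e : Expr) (c : Cmd)
  /-- start a new pass over the stream -/
  | newPass
  /-- read the next edge of the current pass: its two ends go to the registers `x`, `y` and `1` goes
  to the register `f`; if the pass is over, `0` goes to `f` -/
  | next (x y f : ℕ)

/-- The number of elementary operations in an expression. -/
def Expr.size : Expr → ℕ
  | .const _ => 1
  | .var _ => 1
  | .load _ i => i.size + 1
  | .plus e f => e.size + f.size + 1
  | .minus e f => e.size + f.size + 1
  | .times e f => e.size + f.size + 1
  | .quot e f => e.size + f.size + 1
  | .lt e f => e.size + f.size + 1
  | .eq e f => e.size + f.size + 1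

/-- All registers and arrays that occur in the expression have an index smaller than this. -/
def Expr.width : Expr → ℕ
  | .const _ => 0
  | .var x => x + 1
  | .load a i => max (a + 1) i.width
  | .plus e f => max e.width f.width
  | .minus e f => max e.width f.width
  | .times e f => max e.width f.width
  | .quot e f => max e.width f.width
  | .lt e f => max e.width f.width
  | .eq e f => max e.width f.width

/-- All registers and arrays that occur in the program have an index smaller than this; the
registers `0` and `1`, which hold the parameters, are always counted. -/
def Cmd.width : Cmd → ℕ
  | .skip => 2
  | .assign x e => max (max 2 (x + 1)) e.width
  | .store a i e => max (max 2 (a + 1)) (max i.width e.width)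
  | .seq c d => max c.width d.width
  | .branch e c d => max e.width (max c.width d.width)
  | .loop e c => max e.width c.width
  | .newPass => 2
  | .next x y f => max (max 2 (x + 1)) (max (y + 1) (f + 1))

/-! ## Execution -/

/-- A configuration. The last three fields do not influence the computation; they record the
resources used so far. -/
structure State : Type where
  /-- the registers -/
  reg : ℕ → ℕ
  /-- the memory: `mem a i` is cell number `i` of array `a` -/
  mem : ℕ → ℕ → ℕ
  /-- the part of the stream that has not yet been read in the current pass -/
  rest : List (ℕ × ℕ)
  /-- the number of passes started so far -/
  pass : ℕ
  /-- `clock j` is the number of steps executed during pass number `j`, that is, from the start of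
  the `j`-th pass until the start of the next one (or until the program stops); `clock 0` is the
  number of steps before the first pass -/
  clock : ℕ → ℕ
  /-- the number of cells per array: every address written to so far is smaller than this -/
  cells : ℕ
  /-- the largest number held so far in a register or in a cell -/
  word : ℕ

/-- The value of an expression. -/
def Expr.val (s : State) : Expr → ℕ
  | .const c => c
  | .var x => s.reg x
  | .load a i => s.mem a (i.val s)
  | .plus e f => e.val s + f.val s
  | .minus e f => e.val s - f.val s
  | .times e f => e.val s * f.val s
  | .quot e f => e.val s / f.val s
  | .lt e f => if e.val s < f.val s then 1 else 0
  | .eq e f => if e.val s = f.val s then 1 else 0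

/-- Charge `t` steps to the current pass. -/
def State.tick (s : State) (t : ℕ) : State :=
  { s with clock := Function.update s.clock s.pass (s.clock s.pass + t) }

/-- Write `v` into register `x`. -/
def State.setReg (s : State) (x v : ℕ) : State :=
  { s with reg := Function.update s.reg x v, word := max s.word v }

/-- Write `v` into cell `i` of array `a`. -/
def State.setMem (s : State) (a i v : ℕ) : State :=
  { s with
    mem := Function.update s.mem a (Function.update (s.mem a) i v)
    cells := max s.cells (i + 1)
    word := max s.word v }

/-- Start a new pass; `σ j` is the sequence of edges shown in the pass number `j + 1`. -/
def State.startPass (σ : ℕ → List (ℕ × ℕ)) (s : State) : State :=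
  { s with rest := σ s.pass, pass := s.pass + 1 }

/-- Read the next edge of the stream. -/
def State.readEdge (s : State) (x y f : ℕ) : State :=
  match s.rest with
  | [] => s.setReg f 0
  | (u, v) :: l => ((({ s with rest := l }).setReg x u).setReg y v).setReg f 1

/-- `Exec σ c s s'`: on the streams `σ`, the command `c` started in the configuration `s` stops in
the configuration `s'`. Every elementary operation costs one step. -/
inductive Exec (σ : ℕ → List (ℕ × ℕ)) : Cmd → State → State → Prop
  | skip (s : State) : Exec σ .skip s (s.tick 1)
  | assign (x : ℕ) (e : Expr) (s : State) :
      Exec σ (.assign x e) s ((s.setReg x (e.val s)).tick (e.size + 1))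
  | store (a : ℕ) (i e : Expr) (s : State) :
      Exec σ (.store a i e) s
        ((s.setMem a (i.val s) (e.val s)).tick (i.size + e.size + 1))
  | seq {c d : Cmd} {s s' s'' : State} :
      Exec σ c s s' → Exec σ d s' s'' → Exec σ (.seq c d) s s''
  | branchTrue {e : Expr} {c d : Cmd} {s s' : State} :
      e.val s ≠ 0 → Exec σ c (s.tick (e.size + 1)) s' → Exec σ (.branch e c d) s s'
  | branchFalse {e : Expr} {c d : Cmd} {s s' : State} :
      e.val s = 0 → Exec σ d (s.tick (e.size + 1)) s' → Exec σ (.branch e c d) s s'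
  | loopTrue {e : Expr} {c : Cmd} {s s' s'' : State} :
      e.val s ≠ 0 → Exec σ c (s.tick (e.size + 1)) s' → Exec σ (.loop e c) s' s'' →
        Exec σ (.loop e c) s s''
  | loopFalse {e : Expr} {c : Cmd} {s : State} :
      e.val s = 0 → Exec σ (.loop e c) s (s.tick (e.size + 1))
  | newPass (s : State) : Exec σ .newPass s ((s.startPass σ).tick 1)
  | next (x y f : ℕ) (s : State) : Exec σ (.next x y f) s ((s.readEdge x y f).tick 1)

/-- The initial configuration: the parameters `n` and `k` are in the registers `0` and `1`, all
other registers and all cells are `0`, and no pass has been started. -/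
def State.init (n k : ℕ) : State where
  reg := fun x => if x = 0 then n else if x = 1 then k else 0
  mem := fun _ _ => 0
  rest := []
  pass := 0
  clock := fun _ => 0
  cells := 0
  word := max n k

/-- The space, in words, used by a run of `P` that stops in `s`: `P.width` registers and `P.width`
arrays with `s.cells` cells each. -/
def Cmd.space (P : Cmd) (s : State) : ℕ := P.width * (s.cells + 1)

/-! ## Graphs as streams -/

/-- The list `l` shows every edge of `G` exactly once, in an arbitrary order, and each edge with its
two ends in an arbitrary order. -/
def IsEdgeStream {V : Type*} (G : SimpleGraph V) (l : List (V × V)) : Prop :=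
  (l.map fun e => s(e.1, e.2)).Nodup ∧
    ∀ e : Sym2 V, e ∈ l.map (fun e => s(e.1, e.2)) ↔ e ∈ G.edgeSet

/-- The vertices of a graph on `Fin n` are shown to the machine as the numbers `0, …, n - 1`. -/
def toWords {n : ℕ} (l : List (Fin n × Fin n)) : List (ℕ × ℕ) :=
  l.map fun e => ((e.1 : ℕ), (e.2 : ℕ))

/-- The code of a parent: `0` for no parent (a root), and `u + 1` for the vertex `u`. -/
def parentCode {n : ℕ} : Option (Fin n) → ℕ
  | none => 0
  | some u => (u : ℕ) + 1

/-! ## Depth-first search trees -/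

/-- In the rooted forest with parent function `par`, the vertex `u` is an ancestor of `v` (not
necessarily a proper one). -/
def IsAncestor {V : Type*} (par : V → Option V) (u v : V) : Prop :=
  Relation.ReflTransGen (fun a b => par b = some a) u v

/-- The parent function `par` describes a DFS forest of `G`: a rooted forest consisting of one
spanning tree for each connected component of `G`, such that the ends of every edge of `G` are in
ancestor-descendant relation. For connected `G` this is a DFS tree of `G`. -/
structure IsDFSForest {V : Type*} (G : SimpleGraph V) (par : V → Option V) : Prop where
  /-- the edges of the forest are edges of `G` -/
  tree_edge : ∀ u v, par v = some u → G.Adj u v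
  /-- each component has a root, from which all its vertices descend -/
  spanning : ∀ c : G.ConnectedComponent,
    ∃ r ∈ c.supp, par r = none ∧ ∀ v ∈ c.supp, IsAncestor par r v
  /-- there are no cross edges -/
  back_edge : ∀ u v, G.Adj u v → IsAncestor par u v ∨ IsAncestor par v u

/-! ## The inverse Ackermann function -/

/-- Ackermann's function in Tarjan's normalization. -/
def tarjanAck : ℕ → ℕ → ℕ
  | 0, x => 2 * x
  | _ + 1, 0 => 0
  | _ + 1, 1 => 2
  | i + 1, x + 2 => tarjanAck i (tarjanAck (i + 1) (x + 1))

/-- Tarjan's functional inverse of Ackermann's function, for `m, n ≥ 1`: the least `i ≥ 1` such that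
`log₂ n < A(i, 4⌈m/n⌉)`. -/
noncomputable def invAck (m n : ℕ) : ℕ :=
  sInf {i : ℕ | 1 ≤ i ∧ Real.logb 2 n < (tarjanAck i (4 * ⌈(m : ℚ) / n⌉₊) : ℝ)}

end Streaming

open Streaming

/-! ## A weakest-precondition calculus -/

namespace Streaming

/-! The memory holds a partial DFS forest, subject to the invariant `Partial`: two of its vertices
that are joined by an edge, or by a path through vertices outside the forest (`Link`), are
comparable. Hence the forest neighbours of a component of free vertices (those with `dpt v = 0`)
form a chain, and a tree for this component may be hung below the deepest of them.

A pass stores edges between free vertices and, for every free vertex, its deepest forest neighbour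
(`Attach`). When `2(nk + n)` edges are stored, a DFS forest of the stored graph is computed and the
store is cut down to at most `nk + n` edges: all tree edges stay, and a tree `T` keeps at most
`k|T|` others. An edge is dropped only if its tree retains `k|T|` edges, i.e. is `Dense`, and the
tree edges preserve connectivity (`Kept.filter`). Between two cuts at least `nk + n` edges are read,
so a pass takes `O(m + n)` steps. No union-find structure is involved; the inverse Ackermann factor
enters only through the fact that it is at least `1`.

The pass ends with one more DFS of the stored graph, whose roots are tried by decreasing level of
their deepest forest neighbour. In a DFS tree every edge is determined by its lower end and the
level of its upper end; therefore the tree of a dense component reaches relative level `k`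
(`Search.exists_deep`). So if a tree stays below relative level `k`, nothing has been dropped in its
component, it is a DFS tree of the whole component, and it joins the forest. Of a higher tree only
the path from the root to one vertex of relative level at least `k` joins; the vertices of a path
are comparable whatever has been dropped. `PassEnd.partial_next` shows that the invariant survives,
and `PassEnd.card_next` that every remaining component has lost at least `k` vertices. After `p`
passes a remaining component has at most `n - pk` vertices, so another pass is started only if `pk <
n`; this gives `⌈n/k⌉` passes.

The program is verified in a weakest-precondition calculus (`wp_sound`) that bounds words and
addresses by constants and time by potentials. Only the main loop, which starts the passes, is
treated directly on executions (`exec_passes`). -/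

/-- The value of an expression in terms of the registers and the memory. -/
def Expr.ev (r : ℕ → ℕ) (m : ℕ → ℕ → ℕ) : Expr → ℕ
  | .const c => c
  | .var x => r x
  | .load a i => m a (i.ev r m)
  | .plus e f => e.ev r m + f.ev r m
  | .minus e f => e.ev r m - f.ev r m
  | .times e f => e.ev r m * f.ev r m
  | .quot e f => e.ev r m / f.ev r m
  | .lt e f => if e.ev r m < f.ev r m then 1 else 0
  | .eq e f => if e.ev r m = f.ev r m then 1 else 0

theorem Expr.val_eq_ev (s : State) (e : Expr) : e.val s = e.ev s.reg s.mem := by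
  induction e <;> simp_all [Expr.val, Expr.ev]

/-- Predicates on registers, memory, the unread part of the stream, and elapsed time. -/
abbrev Post := (ℕ → ℕ) → (ℕ → ℕ → ℕ) → List (ℕ × ℕ) → ℕ → Prop

/-- Write `v` into cell `i` of array `a`. -/
def setCell (m : ℕ → ℕ → ℕ) (a i v : ℕ) : ℕ → ℕ → ℕ :=
  Function.update m a (Function.update (m a) i v)

theorem setCell_self (m : ℕ → ℕ → ℕ) (a i v : ℕ) :
    setCell m a i v a = Function.update (m a) i v := by
  simp [setCell]

theorem setCell_of_ne (m : ℕ → ℕ → ℕ) {a b : ℕ} (i v : ℕ) (h : b ≠ a) :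
    setCell m a i v b = m b := by
  simp [setCell, h]

/-- A weakest precondition for total correctness of programs that start no pass: the words written
are at most `W`, the addresses written to are less than `Z`, and the postcondition is also about the
time used. A loop comes with an invariant `I` and a potential `Φ` that pays for it. -/
def wp (W Z : ℕ) : Cmd → (ℕ → ℕ) → (ℕ → ℕ → ℕ) → List (ℕ × ℕ) → Post → Prop
  | .skip, r, m, l, Q => Q r m l 1
  | .assign x e, r, m, l, Q =>
      e.ev r m ≤ W ∧ Q (Function.update r x (e.ev r m)) m l (e.size + 1)
  | .store a i e, r, m, l, Q =>
      i.ev r m < Z ∧ e.ev r m ≤ W ∧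
        Q r (setCell m a (i.ev r m) (e.ev r m)) l (i.size + e.size + 1)
  | .seq c d, r, m, l, Q =>
      wp W Z c r m l fun r' m' l' t => wp W Z d r' m' l' fun r'' m'' l'' t' => Q r'' m'' l'' (t + t')
  | .branch e c d, r, m, l, Q =>
      (e.ev r m ≠ 0 → wp W Z c r m l fun r' m' l' t => Q r' m' l' (e.size + 1 + t)) ∧
      (e.ev r m = 0 → wp W Z d r m l fun r' m' l' t => Q r' m' l' (e.size + 1 + t))
  | .loop e c, r, m, l, Q =>
      ∃ (I : (ℕ → ℕ) → (ℕ → ℕ → ℕ) → List (ℕ × ℕ) → Prop)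
        (Φ : (ℕ → ℕ) → (ℕ → ℕ → ℕ) → List (ℕ × ℕ) → ℕ),
        I r m l ∧
        (∀ r₁ m₁ l₁, I r₁ m₁ l₁ → e.ev r₁ m₁ ≠ 0 → wp W Z c r₁ m₁ l₁ fun r' m' l' t =>
          I r' m' l' ∧ t + (e.size + 1) + Φ r' m' l' ≤ Φ r₁ m₁ l₁) ∧
        (∀ r' m' l' t, I r' m' l' → e.ev r' m' = 0 → t ≤ Φ r m l + (e.size + 1) → Q r' m' l' t)
  | .newPass, _, _, _, _ => False
  | .next x y f, r, m, l, Q =>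
      match l with
      | [] => Q (Function.update r f 0) m [] 1
      | (u, v) :: l' => u ≤ W ∧ v ≤ W ∧ 1 ≤ W ∧
          Q (Function.update (Function.update (Function.update r x u) y v) f 1) m l' 1

/-- The command may write register `x`. -/
def Cmd.writesReg (x : ℕ) : Cmd → Bool
  | .skip => false
  | .assign y _ => x == y
  | .store _ _ _ => false
  | .seq c d => c.writesReg x || d.writesReg x
  | .branch _ c d => c.writesReg x || d.writesReg x
  | .loop _ c => c.writesReg x
  | .newPass => false
  | .next y z f => x == y || x == z || x == f

/-- The command may write array `a`. -/
def Cmd.writesMem (a : ℕ) : Cmd → Bool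
  | .skip => false
  | .assign _ _ => false
  | .store b _ _ => a == b
  | .seq c d => c.writesMem a || d.writesMem a
  | .branch _ c d => c.writesMem a || d.writesMem a
  | .loop _ c => c.writesMem a
  | .newPass => false
  | .next _ _ _ => false

/-- The command may read the stream. -/
def Cmd.reads : Cmd → Bool
  | .skip => false
  | .assign _ _ => false
  | .store _ _ _ => false
  | .seq c d => c.reads || d.reads
  | .branch _ c d => c.reads || d.reads
  | .loop _ c => c.reads
  | .newPass => true
  | .next _ _ _ => true

/-- Only what `c` may write has changed. -/
structure Frame (c : Cmd) (r : ℕ → ℕ) (m : ℕ → ℕ → ℕ) (l : List (ℕ × ℕ))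
    (r' : ℕ → ℕ) (m' : ℕ → ℕ → ℕ) (l' : List (ℕ × ℕ)) : Prop where
  reg : ∀ x, c.writesReg x = false → r' x = r x
  mem : ∀ a, c.writesMem a = false → m' a = m a
  rest : c.reads = false → l' = l

theorem Frame.refl (c : Cmd) (r m l) : Frame c r m l r m l :=
  ⟨fun _ _ => rfl, fun _ _ => rfl, fun _ => rfl⟩

theorem Frame.trans {c : Cmd} {r m l r₁ m₁ l₁ r₂ m₂ l₂} (h : Frame c r m l r₁ m₁ l₁)
    (h' : Frame c r₁ m₁ l₁ r₂ m₂ l₂) : Frame c r m l r₂ m₂ l₂ :=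
  ⟨fun x hx => (h'.reg x hx).trans (h.reg x hx), fun a ha => (h'.mem a ha).trans (h.mem a ha),
    fun hr => (h'.rest hr).trans (h.rest hr)⟩

theorem Frame.weaken {c d : Cmd} {r m l r₁ m₁ l₁} (h : Frame c r m l r₁ m₁ l₁)
    (hr : ∀ x, d.writesReg x = false → c.writesReg x = false)
    (hm : ∀ x, d.writesMem x = false → c.writesMem x = false)
    (hl : d.reads = false → c.reads = false) : Frame d r m l r₁ m₁ l₁ :=
  ⟨fun x hx => h.reg x (hr x hx), fun x hx => h.mem x (hm x hx), fun hx => h.rest (hl hx)⟩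

/-- The rule of consequence, together with the frame property. -/
theorem wp_conseq {W Z : ℕ} {c : Cmd} {r m l} {Q Q' : Post} (h : wp W Z c r m l Q)
    (hQ : ∀ r' m' l' t, Frame c r m l r' m' l' → Q r' m' l' t → Q' r' m' l' t) :
    wp W Z c r m l Q' := by
  induction c generalizing r m l Q Q' with
  | skip => exact hQ _ _ _ _ (Frame.refl _ _ _ _) h
  | assign x e =>
    refine ⟨h.1, hQ _ _ _ _ ⟨fun y hy => ?_, fun _ _ => rfl, fun _ => rfl⟩ h.2⟩
    simp only [Cmd.writesReg, beq_eq_false_iff_ne] at hy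
    simp [hy]
  | store a i e =>
    refine ⟨h.1, h.2.1, hQ _ _ _ _ ⟨fun _ _ => rfl, fun y hy => ?_, fun _ => rfl⟩ h.2.2⟩
    simp only [Cmd.writesMem, beq_eq_false_iff_ne] at hy
    exact setCell_of_ne _ _ _ hy
  | seq c d ihc ihd =>
    refine ihc h fun r₁ m₁ l₁ t₁ hf h₁ => ihd h₁ fun r₂ m₂ l₂ t₂ hf' h₂ => hQ _ _ _ _ ?_ h₂
    refine Frame.trans (hf.weaken ?_ ?_ ?_) (hf'.weaken ?_ ?_ ?_) <;>
      simp +contextual [Cmd.writesReg, Cmd.writesMem, Cmd.reads]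
  | branch e c d ihc ihd =>
    refine ⟨fun he => ihc (h.1 he) fun r₁ m₁ l₁ t₁ hf h₁ => hQ _ _ _ _ (hf.weaken ?_ ?_ ?_) h₁,
      fun he => ihd (h.2 he) fun r₁ m₁ l₁ t₁ hf h₁ => hQ _ _ _ _ (hf.weaken ?_ ?_ ?_) h₁⟩ <;>
      simp +contextual [Cmd.writesReg, Cmd.writesMem, Cmd.reads]
  | loop e c ih =>
    obtain ⟨I, Φ, h0, hb, hq⟩ := h
    -- The frame since the entry of the loop becomes part of the invariant, since `hQ` asks for it
    -- at the exit.
    refine ⟨fun r₁ m₁ l₁ => I r₁ m₁ l₁ ∧ Frame (.loop e c) r m l r₁ m₁ l₁, Φ,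
      ⟨h0, Frame.refl _ _ _ _⟩, fun r₁ m₁ l₁ h₁ he => ?_, fun r' m' l' t h₁ he ht =>
        hQ _ _ _ _ h₁.2 (hq _ _ _ _ h₁.1 he ht)⟩
    refine ih (hb _ _ _ h₁.1 he) fun r₂ m₂ l₂ t hf h₂ => ⟨⟨h₂.1, h₁.2.trans ?_⟩, h₂.2⟩
    exact hf.weaken (fun _ h => h) (fun _ h => h) (fun h => h)
  | newPass => exact h.elim
  | next x y f =>
    rcases l with _ | ⟨⟨u, v⟩, l⟩
    · refine hQ _ _ _ _ ⟨fun z hz => ?_, fun _ _ => rfl, fun _ => rfl⟩ h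
      simp only [Cmd.writesReg, Bool.or_eq_false_iff, beq_eq_false_iff_ne] at hz
      simp [hz]
    · refine ⟨h.1, h.2.1, h.2.2.1, hQ _ _ _ _ ⟨fun z hz => ?_, fun _ _ => rfl, ?_⟩ h.2.2.2⟩
      · simp only [Cmd.writesReg, Bool.or_eq_false_iff, beq_eq_false_iff_ne] at hz
        simp [hz]
      · simp [Cmd.reads]

/-- The loop rule, with the frame property of the body built in. -/
theorem wp_loop {W Z : ℕ} {e : Expr} {c : Cmd} {r m l} {Q : Post}
    (I : (ℕ → ℕ) → (ℕ → ℕ → ℕ) → List (ℕ × ℕ) → Prop)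
    (Φ : (ℕ → ℕ) → (ℕ → ℕ → ℕ) → List (ℕ × ℕ) → ℕ) (h0 : I r m l)
    (hb : ∀ r₁ m₁ l₁, Frame c r m l r₁ m₁ l₁ → I r₁ m₁ l₁ → e.ev r₁ m₁ ≠ 0 →
      wp W Z c r₁ m₁ l₁ fun r' m' l' t => I r' m' l' ∧ t + (e.size + 1) + Φ r' m' l' ≤ Φ r₁ m₁ l₁)
    (hq : ∀ r' m' l' t, Frame c r m l r' m' l' → I r' m' l' → e.ev r' m' = 0 →
      t ≤ Φ r m l + (e.size + 1) → Q r' m' l' t) : wp W Z (.loop e c) r m l Q :=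
  ⟨fun r₁ m₁ l₁ => I r₁ m₁ l₁ ∧ Frame c r m l r₁ m₁ l₁, Φ, ⟨h0, Frame.refl _ _ _ _⟩,
    fun _ _ _ h he => wp_conseq (hb _ _ _ h.2 h.1 he) fun _ _ _ _ hf h' =>
      ⟨⟨h'.1, h.2.trans hf⟩, h'.2⟩,
    fun _ _ _ _ h he ht => hq _ _ _ _ h.2 h.1 he ht⟩

/-- Soundness of the calculus. -/
theorem wp_sound {W Z : ℕ} (σ : ℕ → List (ℕ × ℕ)) {c : Cmd} {s : State} {Q : Post}
    (h : wp W Z c s.reg s.mem s.rest Q) :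
    ∃ s' t, Exec σ c s s' ∧ Q s'.reg s'.mem s'.rest t ∧ s'.pass = s.pass ∧
      s'.clock = Function.update s.clock s.pass (s.clock s.pass + t) ∧
      s'.cells ≤ max s.cells Z ∧ s'.word ≤ max s.word W := by
  induction c generalizing s Q with
  | skip => exact ⟨_, 1, .skip s, h, rfl, rfl, by simp [State.tick], by simp [State.tick]⟩
  | assign x e =>
    refine ⟨_, e.size + 1, .assign x e s, ?_, rfl, rfl, by simp [State.tick, State.setReg], ?_⟩
    · simpa [State.tick, State.setReg, Expr.val_eq_ev] using h.2
    · have := h.1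
      simp only [State.tick, State.setReg, Expr.val_eq_ev]
      omega
  | store a i e =>
    refine ⟨_, i.size + e.size + 1, .store a i e s, ?_, rfl, rfl, ?_, ?_⟩
    · simpa [State.tick, State.setMem, Expr.val_eq_ev, setCell] using h.2.2
    · have := h.1
      simp only [State.tick, State.setMem, Expr.val_eq_ev]
      omega
    · have := h.2.1
      simp only [State.tick, State.setMem, Expr.val_eq_ev]
      omega
  | seq c d ihc ihd =>
    obtain ⟨s₁, t₁, h₁, hq₁, hp₁, hc₁, hz₁, hw₁⟩ := ihc h
    obtain ⟨s₂, t₂, h₂, hq₂, hp₂, hc₂, hz₂, hw₂⟩ := ihd hq₁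
    refine ⟨s₂, t₁ + t₂, .seq h₁ h₂, hq₂, hp₂.trans hp₁, ?_, by omega, by omega⟩
    rw [hc₂, hp₁, hc₁]; simp [add_assoc]
  | branch e c d ihc ihd =>
    by_cases he : e.ev s.reg s.mem = 0
    · obtain ⟨s₁, t₁, h₁, hq₁, hp₁, hc₁, hz₁, hw₁⟩ := ihd (s := s.tick (e.size + 1)) (h.2 he)
      refine ⟨s₁, _, .branchFalse (by rw [Expr.val_eq_ev, he]) h₁, hq₁, hp₁, ?_, hz₁, hw₁⟩
      rw [hc₁]; simp [State.tick, add_assoc]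
    · obtain ⟨s₁, t₁, h₁, hq₁, hp₁, hc₁, hz₁, hw₁⟩ := ihc (s := s.tick (e.size + 1)) (h.1 he)
      refine ⟨s₁, _, .branchTrue (by rwa [Expr.val_eq_ev]) h₁, hq₁, hp₁, ?_, hz₁, hw₁⟩
      rw [hc₁]; simp [State.tick, add_assoc]
  | loop e c ih =>
    obtain ⟨I, Φ, h0, hb, hq⟩ := h
    -- Induction on a bound of the potential: each round pays at least for the test, so the
    -- potential strictly decreases.
    suffices H : ∀ (b : ℕ) (s₁ : State), Φ s₁.reg s₁.mem s₁.rest ≤ b → I s₁.reg s₁.mem s₁.rest →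
        ∃ s' t, Exec σ (.loop e c) s₁ s' ∧ I s'.reg s'.mem s'.rest ∧ e.ev s'.reg s'.mem = 0 ∧
          t ≤ Φ s₁.reg s₁.mem s₁.rest + (e.size + 1) ∧ s'.pass = s₁.pass ∧
          s'.clock = Function.update s₁.clock s₁.pass (s₁.clock s₁.pass + t) ∧
          s'.cells ≤ max s₁.cells Z ∧ s'.word ≤ max s₁.word W by
      obtain ⟨s', t, hx, hI, he, ht, h'⟩ := H _ s le_rfl h0
      exact ⟨s', t, hx, hq _ _ _ _ hI he ht, h'⟩
    intro b
    induction b using Nat.strong_induction_on with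
    | _ b ihb =>
      intro s₁ hΦ hI
      by_cases he : e.ev s₁.reg s₁.mem = 0
      · exact ⟨_, e.size + 1, .loopFalse (by rw [Expr.val_eq_ev, he]), hI, he, by omega, rfl, rfl,
          by simp [State.tick], by simp [State.tick]⟩
      · obtain ⟨s₂, t₂, h₂, ⟨hI₂, ht₂⟩, hp₂, hc₂, hz₂, hw₂⟩ :=
          ih (s := s₁.tick (e.size + 1)) (hb _ _ _ hI he)
        have e₁ : (s₁.tick (e.size + 1)).reg = s₁.reg := rfl
        have e₂ : (s₁.tick (e.size + 1)).mem = s₁.mem := rfl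
        have e₃ : (s₁.tick (e.size + 1)).rest = s₁.rest := rfl
        rw [e₁, e₂, e₃] at ht₂
        obtain ⟨s₃, t₃, h₃, hI₃, he₃, ht₃, hp₃, hc₃, hz₃, hw₃⟩ := ihb _ (by omega) s₂ le_rfl hI₂
        refine ⟨s₃, e.size + 1 + t₂ + t₃, .loopTrue (by rwa [Expr.val_eq_ev]) h₂ h₃, hI₃, he₃,
          by omega, hp₃.trans hp₂, ?_, ?_, ?_⟩
        · rw [hc₃, hp₂, hc₂]; simp [State.tick, add_assoc]
        · simp only [State.tick] at hz₂; omega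
        · simp only [State.tick] at hw₂; omega
  | newPass => exact h.elim
  | next x y f =>
    refine ⟨_, 1, .next x y f s, ?_⟩
    rcases hl : s.rest with _ | ⟨⟨u, v⟩, l⟩
    · rw [hl] at h
      simp only [wp] at h
      simp [State.readEdge, hl, State.tick, State.setReg, h]
    · rw [hl] at h
      simp only [wp] at h
      simp only [State.readEdge, hl, State.tick, State.setReg]
      have h₁ := h.1
      have h₂ := h.2.1
      have h₃ := h.2.2.1
      exact ⟨h.2.2.2, trivial, trivial, by omega, by omega⟩

end Streaming

/-! ## Forests given by parent codes -/

namespace Streaming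

open Relation Finset

/-- Ancestors with respect to a parent function whose values are codes: `0` for a root and `a + 1`
for the parent `a`. -/
def Anc (p : ℕ → ℕ) : ℕ → ℕ → Prop := ReflTransGen fun a b => p b = a + 1

theorem Anc.refl {p : ℕ → ℕ} (a : ℕ) : Anc p a a := ReflTransGen.refl

theorem Anc.step {p : ℕ → ℕ} {a b c : ℕ} (h : Anc p a b) (hc : p c = b + 1) : Anc p a c :=
  ReflTransGen.tail h hc

theorem Anc.trans {p : ℕ → ℕ} {a b c : ℕ} (h : Anc p a b) (h' : Anc p b c) : Anc p a c :=
  ReflTransGen.trans h h'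

theorem Anc.cases {p : ℕ → ℕ} {a c : ℕ} (h : Anc p a c) : a = c ∨ ∃ b, Anc p a b ∧ p c = b + 1 := by
  rcases ReflTransGen.cases_tail h with h | ⟨b, hb, hc⟩
  · exact .inl h.symm
  · exact .inr ⟨b, hb, hc⟩

/-- A vertex has at most one parent, so two upward paths from `c` run together as long as both last.
-/
theorem Anc.total {p : ℕ → ℕ} {a b c : ℕ} (h : Anc p a c) (h' : Anc p b c) :
    Anc p a b ∨ Anc p b a := by
  induction h with
  | refl => exact .inr h'
  | tail ha hc ih =>
    rcases h'.cases with rfl | ⟨d, hd, hd'⟩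
    · exact .inl (Anc.step ha hc)
    · rw [hc] at hd'
      obtain rfl : _ = d := by simpa using hd'
      exact ih hd

theorem Anc.mono {p q : ℕ → ℕ} (hq : ∀ b, p b ≠ 0 → q b = p b) {a b : ℕ} (h : Anc p a b) :
    Anc q a b := by
  induction h with
  | refl => exact Anc.refl _
  | tail _ hc ih => exact ih.step (by rw [hq _ (by omega), hc])

/-- A function that increases by one from a parent to its child takes all the intermediate values
on the path from the root. -/
theorem Anc.exists_level {p f : ℕ → ℕ} {c : ℕ} {S : ℕ → Prop}
    (hp : ∀ b a, S b → p b = a + 1 → S a ∧ f b = f a + 1) (h0 : ∀ b, S b → p b = 0 → f b = c) :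
    ∀ b, S b → ∀ d, c ≤ d → d ≤ f b → ∃ a, S a ∧ Anc p a b ∧ f a = d := by
  suffices H : ∀ N b, f b ≤ N → S b → ∀ d, c ≤ d → d ≤ f b → ∃ a, S a ∧ Anc p a b ∧ f a = d from
    fun b => H _ b le_rfl
  intro N
  induction N with
  | zero =>
    intro b hb hS d hc hd
    exact ⟨b, hS, Anc.refl b, by omega⟩
  | succ N ih =>
    intro b hb hS d hc hd
    by_cases hd' : d = f b
    · exact ⟨b, hS, Anc.refl b, hd'.symm⟩
    · rcases hpb : p b with _ | a
      · have := h0 b hS hpb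
        omega
      · obtain ⟨hSa, hfa⟩ := hp b a hS hpb
        obtain ⟨x, hx, hxa, hxd⟩ := ih a (by omega) hSa d hc (by omega)
        exact ⟨x, hx, hxa.step hpb, hxd⟩

/-- Every vertex of the list is followed by its parent, and no vertex occurs twice. -/
def Closed (p : ℕ → ℕ) : List ℕ → Prop
  | [] => True
  | x :: l => x ∉ l ∧ (∀ a, p x = a + 1 → a ∈ l) ∧ Closed p l

theorem Closed.congr {p q : ℕ → ℕ} {l : List ℕ} (h : Closed p l) (hq : ∀ v ∈ l, q v = p v) :
    Closed q l := by
  induction l with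
  | nil => trivial
  | cons x l ih =>
    refine ⟨h.1, fun a ha => h.2.1 a ?_, ih h.2.2 fun v hv => hq v (by simp [hv])⟩
    rw [← hq x (by simp), ha]

theorem Closed.nodup {p : ℕ → ℕ} {l : List ℕ} (h : Closed p l) : l.Nodup := by
  induction l with
  | nil => simp
  | cons x l ih => exact List.nodup_cons.2 ⟨h.1, ih h.2.2⟩

theorem Closed.parent_mem {p : ℕ → ℕ} {l : List ℕ} (h : Closed p l) {a b : ℕ} (hb : b ∈ l)
    (hp : p b = a + 1) : a ∈ l := by
  induction l with
  | nil => simp at hb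
  | cons x l ih =>
    rcases List.mem_cons.1 hb with rfl | hb
    · exact List.mem_cons_of_mem _ (h.2.1 a hp)
    · exact List.mem_cons_of_mem _ (ih h.2.2 hb)

theorem Closed.anc_mem {p : ℕ → ℕ} {l : List ℕ} (h : Closed p l) {a b : ℕ} (hb : b ∈ l)
    (hp : Anc p a b) : a ∈ l := by
  induction hp with
  | refl => exact hb
  | tail _ hc ih => exact ih (h.parent_mem hb hc)

/-! ## Lists of edges -/

/-- The list contains the edge, in one of its two orientations. -/
def Und (l : List (ℕ × ℕ)) (u v : ℕ) : Prop := (u, v) ∈ l ∨ (v, u) ∈ l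

theorem Und.symm {l : List (ℕ × ℕ)} {u v : ℕ} (h : Und l u v) : Und l v u := Or.symm h

/-- Connectedness by the edges of the list. -/
def LConn (l : List (ℕ × ℕ)) : ℕ → ℕ → Prop := ReflTransGen (Und l)

theorem LConn.symm {l : List (ℕ × ℕ)} {u v : ℕ} (h : LConn l u v) : LConn l v u := by
  induction h with
  | refl => exact ReflTransGen.refl
  | tail _ hb ih => exact ReflTransGen.head hb.symm ih

theorem LConn.mono {l l' : List (ℕ × ℕ)} (hl : ∀ e ∈ l, e ∈ l') {u v : ℕ} (h : LConn l u v) :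
    LConn l' u v :=
  ReflTransGen.mono (fun _ _ h => Or.imp (hl _) (hl _) h) _ _ h

/-- No edge occurs twice, in whatever orientations. -/
def Distinct (l : List (ℕ × ℕ)) : Prop := l.Pairwise fun e f => e ≠ f ∧ e ≠ f.swap

theorem Distinct.nodup {l : List (ℕ × ℕ)} (h : Distinct l) : l.Nodup :=
  List.Pairwise.imp (fun h => h.1) h

theorem Distinct.sublist {l l' : List (ℕ × ℕ)} (h : Distinct l) (hl : l'.Sublist l) :
    Distinct l' := List.Pairwise.sublist hl h

theorem Distinct.eq_of_swap {l : List (ℕ × ℕ)} (h : Distinct l) {e f : ℕ × ℕ} (he : e ∈ l)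
    (hf : f ∈ l) (hs : e = f.swap) : e = f := by
  by_contra hne
  have : Std.Symm fun e f : ℕ × ℕ => e ≠ f ∧ e ≠ f.swap :=
    ⟨fun a b hab => ⟨hab.1.symm, fun h => hab.2 (by rw [h]; simp)⟩⟩
  exact (List.Pairwise.forall h he hf hne).2 hs

/-- The edges of the list with both ends in `A`. -/
def within (l : List (ℕ × ℕ)) (A : Finset ℕ) : List (ℕ × ℕ) :=
  l.filter fun e => decide (e.1 ∈ A ∧ e.2 ∈ A)

theorem mem_within {l : List (ℕ × ℕ)} {A : Finset ℕ} {e : ℕ × ℕ} :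
    e ∈ within l A ↔ e ∈ l ∧ e.1 ∈ A ∧ e.2 ∈ A := by
  simp [within]

/-- The vertex `u` is connected to a set of vertices that spans at least `k` edges per vertex. -/
def Dense (k : ℕ) (l : List (ℕ × ℕ)) (u : ℕ) : Prop :=
  ∃ A : Finset ℕ, A.Nonempty ∧ (∀ a ∈ A, LConn l u a) ∧ k * A.card ≤ (within l A).length

theorem Dense.mono {k : ℕ} {l l' : List (ℕ × ℕ)} {u : ℕ} (h : Dense k l u) (hl : l.Sublist l') :
    Dense k l' u := by
  obtain ⟨A, hA, hc, hk⟩ := h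
  exact ⟨A, hA, fun a ha => (hc a ha).mono fun e he => hl.subset he,
    hk.trans (hl.filter _).length_le⟩

/-! ## Depth-first search with an explicit stack -/

/-- The invariant of a depth-first search, on the vertices `v < n` with `dpt v = 0`, of the graph
with edge list `L`. The list `ord` contains the vertices visited so far, the last one first; `fp` is
the parent function of the search forest, `root` gives the roots (plus one) of visited vertices and
`0` for the others, and `ad` is the level, which is `ky v + 1` for a root `v`. The stack contains
pairs of a parent code and a vertex. Roots are tried by decreasing `ky`. -/
structure Search (n : ℕ) (dpt ky : ℕ → ℕ) (L : List (ℕ × ℕ)) (fp root ad : ℕ → ℕ) (ord : List ℕ)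
    (stk : List (ℕ × ℕ)) : Prop where
  visited : ∀ v, root v ≠ 0 ↔ v ∈ ord
  free : ∀ v ∈ ord, v < n ∧ dpt v = 0
  fp_zero : ∀ v, v ∉ ord → fp v = 0
  root_eq : ∀ v ∈ ord, fp v = 0 → root v = v + 1 ∧ ad v = ky v + 1
  child : ∀ v p, fp v = p + 1 → Und L p v ∧ root v = root p ∧ ad v = ad p + 1
  closed : Closed fp ord
  back : ∀ v w, v ∈ ord → w ∈ ord → Und L v w → Anc fp v w ∨ Anc fp w v
  stk_child : ∀ p w, (p + 1, w) ∈ stk → p ∈ ord ∧ Und L p w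
  stk_free : ∀ e ∈ stk, e.2 < n ∧ dpt e.2 = 0
  stk_chain : stk.Pairwise fun e e' => ∀ p', e'.1 = p' + 1 → ∃ p, e.1 = p + 1 ∧ Anc fp p' p
  stk_nb : ∀ v w, v ∈ ord → Und L v w → w ∉ ord → (v + 1, w) ∈ stk
  stk_seed : ∀ w < n, dpt w = 0 → w ∉ ord → (0, w) ∈ stk
  stk_key : stk.Pairwise fun e e' => e.1 = 0 → e'.1 = 0 → ky e'.2 ≤ ky e.2
  max_key : ∀ v ∈ ord, ∀ w, (0, w) ∈ stk → ky w ≤ ky (root v - 1)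
  root_key : ∀ v ∈ ord, ky v ≤ ky (root v - 1)

namespace Search

variable {n : ℕ} {dpt ky fp root ad : ℕ → ℕ} {L : List (ℕ × ℕ)} {ord : List ℕ} {stk : List (ℕ × ℕ)}

theorem init (hfp : ∀ v, fp v = 0) (hroot : ∀ v, root v = 0)
    (hfree : ∀ e ∈ stk, e.1 = 0 ∧ e.2 < n ∧ dpt e.2 = 0)
    (hseed : ∀ w < n, dpt w = 0 → (0, w) ∈ stk)
    (hkey : stk.Pairwise fun e e' => ky e'.2 ≤ ky e.2) :
    Search n dpt ky L fp root ad [] stk where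
  visited v := by simp [hroot]
  free := by simp
  fp_zero v _ := hfp v
  root_eq := by simp
  child v p h := by simp [hfp] at h
  closed := trivial
  back := by simp
  stk_child p w h := by simpa using (hfree _ h).1
  stk_free e he := (hfree e he).2
  stk_chain := List.pairwise_of_forall_mem_list fun e _ e' he' p' hp' => by
    rw [(hfree e' he').1] at hp'; omega
  stk_nb := by simp
  stk_seed w hw hd _ := hseed w hw hd
  stk_key := hkey.imp fun h _ _ => h
  max_key := by simp
  root_key := by simp

/-- A vertex may be on the stack once as a seed and once for each visited neighbour. An entry of a
vertex reached in the meantime can be discarded, because `stk_nb` and `stk_seed` only demand entries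
for unvisited vertices. -/
theorem pop {c x : ℕ} (h : Search n dpt ky L fp root ad ord ((c, x) :: stk)) (hx : root x ≠ 0) :
    Search n dpt ky L fp root ad ord stk where
  visited := h.visited
  free := h.free
  fp_zero := h.fp_zero
  root_eq := h.root_eq
  child := h.child
  closed := h.closed
  back := h.back
  stk_child p w hw := h.stk_child p w (List.mem_cons_of_mem _ hw)
  stk_free e he := h.stk_free e (List.mem_cons_of_mem _ he)
  stk_chain := (List.pairwise_cons.1 h.stk_chain).2
  stk_nb v w hv hu hw := by
    have hmem := h.stk_nb v w hv hu hw
    rw [List.mem_cons] at hmem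
    rcases hmem with heq | hmem
    · obtain rfl : w = x := congrArg Prod.snd heq
      exact absurd ((h.visited w).1 hx) hw
    · exact hmem
  stk_seed w hw hd ho := by
    have hmem := h.stk_seed w hw hd ho
    rw [List.mem_cons] at hmem
    rcases hmem with heq | hmem
    · obtain rfl : w = x := congrArg Prod.snd heq
      exact absurd ((h.visited w).1 hx) ho
    · exact hmem
  stk_key := (List.pairwise_cons.1 h.stk_key).2
  max_key v hv w hw := h.max_key v hv w (List.mem_cons_of_mem _ hw)
  root_key := h.root_key

/-- The absence of cross edges comes from `stk_nb` and `stk_chain`: a visited neighbour `w` of `x`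
has left `(w + 1, x)` on the stack, and the parents in lower entries are ancestors of the parents in
higher ones; so `w` is an ancestor of the parent of the popped entry. By the same chain condition, a
seed reaches the top only when all other entries are gone, and by `stk_key` it then has the largest
key among the remaining seeds. -/
theorem visit {c x : ℕ} {new : List (ℕ × ℕ)} {fp' root' ad' : ℕ → ℕ}
    (hL : ∀ u v, Und L u v → u < n ∧ dpt u = 0)
    (h : Search n dpt ky L fp root ad ord ((c, x) :: stk)) (hx : root x = 0)
    (hfp : fp' = Function.update fp x c)
    (hroot : root' = Function.update root x (if c = 0 then x + 1 else root (c - 1)))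
    (had : ad' = Function.update ad x (if c = 0 then ky x + 1 else ad (c - 1) + 1))
    (hnew : ∀ e ∈ new, e.1 = x + 1 ∧ Und L x e.2) (hnew' : ∀ w, Und L x w → (x + 1, w) ∈ new) :
    Search n dpt ky L fp' root' ad' (x :: ord) (new ++ stk) := by
  have hxo : x ∉ ord := fun hm => (h.visited x).2 hm hx
  have hxf := h.stk_free (c, x) (by simp)
  have hne : ∀ v ∈ ord, v ≠ x := fun v hv hvx => hxo (hvx ▸ hv)
  have hfx : fp x = 0 := h.fp_zero x hxo
  have hc : ∀ p, c = p + 1 → p ∈ ord ∧ Und L p x := fun p hp => h.stk_child p x (by simp [hp])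
  have hmono : ∀ {a b}, Anc fp a b → Anc fp' a b := fun hab => hab.mono fun b hb => by
    have : b ≠ x := fun hbx => hb (hbx ▸ hfx)
    simp [hfp, this]
  have hchain := List.pairwise_cons.1 h.stk_chain
  have hkey := List.pairwise_cons.1 h.stk_key
  -- All parents still on the stack become ancestors of `x`; this yields the back edges at `x` as
  -- well as the chain condition below the new entries.
  have hxp : ∀ p', (∃ w, (p' + 1, w) ∈ (c, x) :: stk) → Anc fp' p' x := by
    rintro p' ⟨w, hw⟩
    rw [List.mem_cons] at hw
    rcases hw with heq | hw
    · refine (Anc.refl p').step ?_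
      have : p' + 1 = c := congrArg Prod.fst heq
      simp [hfp, this]
    · obtain ⟨p, hp, hpp⟩ := hchain.1 _ hw p' rfl
      refine (hmono hpp).step ?_
      simpa [hfp] using hp
  refine ⟨fun v => ?_, fun v hv => ?_, fun v hv => ?_, fun v hv h0 => ?_, fun v p hp => ?_,
    ⟨hxo, fun a ha => ?_, h.closed.congr fun v hv => by simp [hfp, hne v hv]⟩,
    fun v w hv hw hu => ?_, fun p w hw => ?_, fun e he => ?_, ?_, fun v w hv hu hw => ?_,
    fun w hw hd ho => ?_, ?_, fun v hv w hw => ?_, fun v hv => ?_⟩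
  · by_cases hvx : v = x
    · subst hvx
      rcases c with _ | p
      · simp [hroot]
      · simpa [hroot] using (h.visited p).2 (hc p rfl).1
    · simp [hroot, hvx, h.visited v]
  · rcases List.mem_cons.1 hv with rfl | hv
    · exact hxf
    · exact h.free v hv
  · rw [List.mem_cons, not_or] at hv
    simp [hfp, hv.1, h.fp_zero v hv.2]
  · rcases List.mem_cons.1 hv with rfl | hv
    · have : c = 0 := by simpa [hfp] using h0
      simp [hroot, had, this]
    · have hv' := hne v hv
      simp only [hfp, ne_eq, hv', not_false_eq_true, Function.update_of_ne] at h0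
      simpa [hroot, had, hv'] using h.root_eq v hv h0
  · by_cases hvx : v = x
    · subst hvx
      have hcp : c = p + 1 := by simpa [hfp] using hp
      obtain ⟨hpo, hpu⟩ := hc p hcp
      simp [hroot, had, hcp, hne p hpo, hpu]
    · simp only [hfp, ne_eq, hvx, not_false_eq_true, Function.update_of_ne] at hp
      obtain ⟨h₁, h₂, h₃⟩ := h.child v p hp
      have hvo : v ∈ ord := by
        by_contra hv
        rw [h.fp_zero v hv] at hp
        omega
      have hpo : p ∈ ord := h.closed.parent_mem hvo hp
      simp [hroot, had, hvx, hne p hpo, h₁, h₂, h₃]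
  · have hcp : c = a + 1 := by simpa [hfp] using ha
    exact (hc a hcp).1
  · rw [List.mem_cons] at hv hw
    rcases hv with rfl | hv <;> rcases hw with rfl | hw
    · exact .inl (Anc.refl _)
    · exact .inr (hxp w ⟨_, h.stk_nb w _ hw hu.symm hxo⟩)
    · exact .inl (hxp v ⟨_, h.stk_nb v _ hv hu hxo⟩)
    · exact (h.back v w hv hw hu).imp hmono hmono
  · rcases List.mem_append.1 hw with hw | hw
    · obtain ⟨h₁, h₂⟩ := hnew _ hw
      obtain rfl : p = x := by simpa using h₁
      exact ⟨by simp, h₂⟩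
    · have := h.stk_child p w (List.mem_cons_of_mem _ hw)
      exact ⟨List.mem_cons_of_mem _ this.1, this.2⟩
  · rcases List.mem_append.1 he with he | he
    · exact hL _ _ (hnew e he).2.symm
    · exact h.stk_free e (List.mem_cons_of_mem _ he)
  · refine List.pairwise_append.2 ⟨?_, ?_, fun e he e' he' p' hp' => ?_⟩
    · refine List.pairwise_of_forall_mem_list fun e he e' he' p' hp' => ⟨x, (hnew e he).1, ?_⟩
      have : p' = x := by have := (hnew e' he').1; omega
      rw [this]; exact Anc.refl x
    · refine hchain.2.imp fun hh p' hp' => ?_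
      obtain ⟨p, hp, hpp⟩ := hh p' hp'
      exact ⟨p, hp, hmono hpp⟩
    · exact ⟨x, (hnew e he).1, hxp p' ⟨e'.2, List.mem_cons_of_mem _ (by rw [← hp']; exact he')⟩⟩
  · rw [List.mem_cons, not_or] at hw
    rcases List.mem_cons.1 hv with rfl | hv
    · exact List.mem_append_left _ (hnew' w hu)
    · have := h.stk_nb v w hv hu hw.2
      rcases List.mem_cons.1 this with heq | hm
      · exact absurd (congrArg Prod.snd heq) hw.1
      · exact List.mem_append_right _ hm
  · rw [List.mem_cons, not_or] at ho
    have := h.stk_seed w hw hd ho.2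
    rcases List.mem_cons.1 this with heq | hm
    · exact absurd (congrArg Prod.snd heq) ho.1
    · exact List.mem_append_right _ hm
  · refine List.pairwise_append.2 ⟨?_, hkey.2, fun e he e' he' h0 => ?_⟩
    · refine List.pairwise_of_forall_mem_list fun e he e' he' h0 => ?_
      have := (hnew e he).1
      omega
    · have := (hnew e he).1
      omega
  · have hws : (0, w) ∈ stk := by
      rcases List.mem_append.1 hw with hw | hw
      · have := (hnew _ hw).1
        simp at this
      · exact hw
    rcases List.mem_cons.1 hv with rfl | hv
    · rcases c with _ | p
      · simpa [hroot] using hkey.1 _ hws rfl rfl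
      · simpa [hroot] using h.max_key p (hc p rfl).1 w (List.mem_cons_of_mem _ hws)
    · simpa [hroot, hne v hv] using h.max_key v hv w (List.mem_cons_of_mem _ hws)
  · rcases List.mem_cons.1 hv with rfl | hv
    · rcases c with _ | p
      · simp [hroot]
      · simpa [hroot] using h.max_key p (hc p rfl).1 v (h.stk_seed v hxf.1 hxf.2 hxo)
    · simpa [hroot, hne v hv] using h.root_key v hv

theorem anc_level (h : Search n dpt ky L fp root ad ord stk) {a b : ℕ} (hab : Anc fp a b) :
    root b = root a ∧ ad a ≤ ad b ∧ (ad a = ad b → a = b) := by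
  induction hab with
  | refl => simp
  | tail _ hc ih =>
    obtain ⟨_, h₂, h₃⟩ := h.child _ _ hc
    exact ⟨h₂.trans ih.1, by omega, fun _ => by omega⟩

/-- Levels strictly increase along the chain of ancestors of `c`, so a level names at most one
ancestor. This is what makes the edge count in `exists_deep` injective. -/
theorem anc_unique (h : Search n dpt ky L fp root ad ord stk) {a b c : ℕ} (ha : Anc fp a c)
    (hb : Anc fp b c) (hab : ad a = ad b) : a = b := by
  rcases ha.total hb with hab' | hab'
  · exact (h.anc_level hab').2.2 hab
  · exact ((h.anc_level hab').2.2 hab.symm).symm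

theorem exists_root (h : Search n dpt ky L fp root ad ord stk) {v : ℕ} (hv : v ∈ ord) :
    ∃ r, root v = r + 1 ∧ r ∈ ord ∧ fp r = 0 ∧ root r = r + 1 ∧ Anc fp r v := by
  suffices H : ∀ N v, ad v ≤ N → v ∈ ord →
      ∃ r, root v = r + 1 ∧ r ∈ ord ∧ fp r = 0 ∧ root r = r + 1 ∧ Anc fp r v from H _ v le_rfl hv
  intro N
  induction N with
  | zero =>
    intro v hN hv
    rcases hp : fp v with _ | p
    · exact ⟨v, (h.root_eq v hv hp).1, hv, hp, (h.root_eq v hv hp).1, Anc.refl v⟩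
    · have := (h.child v p hp).2.2
      omega
  | succ N ih =>
    intro v hN hv
    rcases hp : fp v with _ | p
    · exact ⟨v, (h.root_eq v hv hp).1, hv, hp, (h.root_eq v hv hp).1, Anc.refl v⟩
    · obtain ⟨h₁, h₂, h₃⟩ := h.child v p hp
      obtain ⟨r, hr⟩ := ih p (by omega) (h.closed.parent_mem hv hp)
      exact ⟨r, by rw [h₂, hr.1], hr.2.1, hr.2.2.1, hr.2.2.2.1, hr.2.2.2.2.step hp⟩

theorem ad_pos (h : Search n dpt ky L fp root ad ord stk) {v : ℕ} (hv : v ∈ ord) : 0 < ad v := by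
  rcases hp : fp v with _ | p
  · rw [(h.root_eq v hv hp).2]; omega
  · rw [(h.child v p hp).2.2]; omega

/-- Connectivity by a list of edges that contains the edges of the search forest. -/
theorem lconn_of_anc {L' : List (ℕ × ℕ)} (hL' : ∀ v p, fp v = p + 1 → Und L' p v)
    {a b : ℕ} (hab : Anc fp a b) : LConn L' a b := by
  induction hab with
  | refl => exact ReflTransGen.refl
  | tail _ hc ih => exact ReflTransGen.tail ih (hL' _ _ hc)

theorem lconn_of_root_eq (h : Search n dpt ky L fp root ad ord stk) {L' : List (ℕ × ℕ)}
    (hL' : ∀ v p, fp v = p + 1 → Und L' p v) {a b : ℕ} (ha : a ∈ ord) (hb : b ∈ ord)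
    (hab : root a = root b) : LConn L' a b := by
  obtain ⟨r, hr, -, -, -, hra⟩ := h.exists_root ha
  obtain ⟨q, hq, -, -, -, hqb⟩ := h.exists_root hb
  obtain rfl : r = q := by omega
  exact (lconn_of_anc hL' hra).symm.trans (lconn_of_anc hL' hqb)

theorem mem_iff (h : Search n dpt ky L fp root ad ord []) {v : ℕ} :
    v ∈ ord ↔ v < n ∧ dpt v = 0 := by
  refine ⟨h.free v, fun hv => ?_⟩
  by_contra ho
  simpa using h.stk_seed v hv.1 hv.2 ho

theorem und_comparable (hL : ∀ u v, Und L u v → u < n ∧ dpt u = 0)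
    (h : Search n dpt ky L fp root ad ord []) {a b : ℕ} (hab : Und L a b) :
    Anc fp a b ∨ Anc fp b a :=
  h.back a b (h.mem_iff.2 (hL _ _ hab)) (h.mem_iff.2 (hL _ _ hab.symm)) hab

/-- Comparable vertices share their root, and every edge of `L` joins comparable vertices. Together
with `lconn_of_root_eq`, the trees of a finished search are the components of `L`. -/
theorem root_eq_of_lconn (hL : ∀ u v, Und L u v → u < n ∧ dpt u = 0)
    (h : Search n dpt ky L fp root ad ord []) {a b : ℕ} (hab : LConn L a b) :
    root b = root a := by
  induction hab with
  | refl => rfl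
  | tail _ hc ih =>
    rw [← ih]
    rcases h.und_comparable hL hc with h' | h'
    · exact (h.anc_level h').1
    · exact (h.anc_level h').1.symm

/-- A depth-first search tree of a dense graph is high. -/
theorem exists_deep {k : ℕ} (hk : 0 < k) (hL : ∀ u v, Und L u v → u < n ∧ dpt u = 0)
    (h : Search n dpt ky L fp root ad ord []) (hd : Distinct L) (hloop : ∀ e ∈ L, e.1 ≠ e.2)
    {u : ℕ} (hu : u ∈ ord) (hD : Dense k L u) :
    ∃ a ∈ ord, root a = root u ∧ ad (root u - 1) + k ≤ ad a := by
  classical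
  obtain ⟨A, hA, hconn, hcard⟩ := hD
  by_contra! hcon
  obtain ⟨r, hr, hro, hr0, hrr, hru⟩ := h.exists_root hu
  rw [hr] at hcon
  simp only [Nat.add_sub_cancel] at hcon
  have hlow : ∀ a ∈ ord, root a = r + 1 → ad r ≤ ad a := by
    intro a ha har
    obtain ⟨q, hq, -, -, -, hqa⟩ := h.exists_root ha
    obtain rfl : r = q := by omega
    exact (h.anc_level hqa).2.1
  have hmem : ∀ e ∈ within L A, e.1 ∈ ord ∧ e.2 ∈ ord ∧ root e.1 = r + 1 ∧ root e.2 = r + 1 := by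
    intro e he
    obtain ⟨heL, h₁, h₂⟩ := mem_within.1 he
    have hu₁ : Und L e.1 e.2 := .inl heL
    refine ⟨h.mem_iff.2 (hL _ _ hu₁), h.mem_iff.2 (hL _ _ hu₁.symm), ?_, ?_⟩
    · rw [h.root_eq_of_lconn hL (hconn _ h₁), hr]
    · rw [h.root_eq_of_lconn hL (hconn _ h₂), hr]
  -- An edge is charged to its lower end and the relative level of its upper end. Both ends can be
  -- recovered from this, and `Distinct` excludes a second orientation.
  let g : ℕ × ℕ → ℕ × ℕ := fun e =>
    if Anc fp e.1 e.2 then (e.2, ad e.1 - ad r) else (e.1, ad e.2 - ad r)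
  have hlt : ∀ a b, Anc fp a b → a ≠ b → ad a < ad b := fun a b hab hne =>
    lt_of_le_of_ne (h.anc_level hab).2.1 fun heq => hne ((h.anc_level hab).2.2 heq)
  have hcmp : ∀ e ∈ within L A, ¬ Anc fp e.1 e.2 → Anc fp e.2 e.1 := fun e he hn =>
    (h.und_comparable hL (.inl (mem_within.1 he).1)).resolve_left hn
  -- Lower ends have relative level at most `k - 1`, hence upper ends at most `k - 2`: only `k - 1`
  -- values are possible, which is one too few for `k * A.card` edges.
  have hmaps : ∀ e ∈ (within L A).toFinset, g e ∈ A ×ˢ range (k - 1) := by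
    intro e he
    rw [List.mem_toFinset] at he
    obtain ⟨heL, h₁, h₂⟩ := mem_within.1 he
    obtain ⟨ho₁, ho₂, hr₁, hr₂⟩ := hmem e he
    have l₁ := hlow _ ho₁ hr₁
    have l₂ := hlow _ ho₂ hr₂
    have c₁ := hcon _ ho₁ (by omega)
    have c₂ := hcon _ ho₂ (by omega)
    by_cases hanc : Anc fp e.1 e.2
    · have := hlt _ _ hanc (hloop e heL)
      simp only [g, hanc, if_true, mem_product, mem_range]
      exact ⟨h₂, by omega⟩
    · have := hlt _ _ (hcmp e he hanc) (hloop e heL).symm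
      simp only [g, hanc, if_false, mem_product, mem_range]
      exact ⟨h₁, by omega⟩
  have hinj : Set.InjOn g (within L A).toFinset := by
    intro e he f hf hef
    rw [mem_coe, List.mem_toFinset] at he hf
    obtain ⟨ho₁, ho₂, hr₁, hr₂⟩ := hmem e he
    obtain ⟨po₁, po₂, pr₁, pr₂⟩ := hmem f hf
    have l₁ := hlow _ ho₁ hr₁
    have l₂ := hlow _ ho₂ hr₂
    have l₃ := hlow _ po₁ pr₁
    have l₄ := hlow _ po₂ pr₂
    have heL := (mem_within.1 he).1
    have hfL := (mem_within.1 hf).1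
    by_cases ha : Anc fp e.1 e.2 <;> by_cases hb : Anc fp f.1 f.2 <;>
      simp only [g, ha, hb, if_true, if_false, Prod.mk.injEq] at hef
    · exact Prod.ext (h.anc_unique (hef.1 ▸ ha) hb (by omega)) hef.1
    · refine hd.eq_of_swap heL hfL (Prod.ext ?_ hef.1)
      refine h.anc_unique (hef.1 ▸ ha) (hcmp f hf hb) (?_ : ad e.1 = ad f.2)
      omega
    · refine hd.eq_of_swap heL hfL (Prod.ext hef.1 ?_)
      refine h.anc_unique (hef.1 ▸ hcmp e he ha) hb (?_ : ad e.2 = ad f.1)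
      omega
    · exact Prod.ext hef.1 (h.anc_unique (hef.1 ▸ hcmp e he ha) (hcmp f hf hb) (by omega))
  have hle := card_le_card_of_injOn g hmaps hinj
  have hnd : (within L A).Nodup := hd.nodup.filter _
  rw [List.toFinset_card_of_nodup hnd, card_product, card_range] at hle
  have hpos := hA.card_pos
  have : A.card * (k - 1) < k * A.card := by
    rw [mul_comm k]
    exact Nat.mul_lt_mul_of_pos_left (by omega) hpos
  omega

end Search

/-! ## Discarding edges -/

/-- The list `L` has been kept of the edges of `P` between vertices with `dpt v = 0`: every other
such edge joins vertices that are connected in `L` to a dense set. -/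
structure Kept (k : ℕ) (dpt : ℕ → ℕ) (P L : List (ℕ × ℕ)) : Prop where
  sub : L.Sublist P
  free : ∀ e ∈ L, dpt e.1 = 0 ∧ dpt e.2 = 0
  drop : ∀ e ∈ P, dpt e.1 = 0 → dpt e.2 = 0 → e ∈ L ∨ LConn L e.1 e.2 ∧ Dense k L e.1

theorem Kept.nil (k : ℕ) (dpt : ℕ → ℕ) : Kept k dpt [] [] := ⟨by simp, by simp, by simp⟩

theorem Kept.add {k : ℕ} {dpt : ℕ → ℕ} {P L : List (ℕ × ℕ)} (h : Kept k dpt P L) {e : ℕ × ℕ}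
    (he : dpt e.1 = 0 ∧ dpt e.2 = 0) : Kept k dpt (P ++ [e]) (L ++ [e]) where
  sub := h.sub.append (List.Sublist.refl _)
  free f hf := by
    rcases List.mem_append.1 hf with hf | hf
    · exact h.free f hf
    · rw [List.mem_singleton.1 hf]; exact he
  drop f hf h₁ h₂ := by
    rcases List.mem_append.1 hf with hf | hf
    · rcases h.drop f hf h₁ h₂ with h | h
      · exact .inl (List.mem_append_left _ h)
      · exact .inr ⟨h.1.mono fun e he => List.mem_append_left _ he,
          h.2.mono (List.sublist_append_left _ _)⟩
    · exact .inl (List.mem_append_right _ hf)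

theorem Kept.skip {k : ℕ} {dpt : ℕ → ℕ} {P L : List (ℕ × ℕ)} (h : Kept k dpt P L) {e : ℕ × ℕ}
    (he : ¬ (dpt e.1 = 0 ∧ dpt e.2 = 0)) : Kept k dpt (P ++ [e]) L where
  sub := h.sub.trans (List.sublist_append_left _ _)
  free := h.free
  drop f hf h₁ h₂ := by
    rcases List.mem_append.1 hf with hf | hf
    · exact h.drop f hf h₁ h₂
    · rw [List.mem_singleton.1 hf] at h₁ h₂; exact absurd ⟨h₁, h₂⟩ he

/-- As all tree edges stay, `L'` has the same components as `L`. A component that loses an edge is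
dense by `hdrop`, with its whole vertex set as witness; a component that loses none retains the
dense set it had. So earlier reasons for dropping remain valid after later cuts. -/
theorem Kept.filter {k n : ℕ} {dpt ky fp root ad : ℕ → ℕ} {P L L' : List (ℕ × ℕ)} {ord : List ℕ}
    (h : Kept k dpt P L) (hP : Distinct P) (hn : ∀ e ∈ P, e.1 < n ∧ e.2 < n)
    (hS : Search n dpt ky L fp root ad ord []) (hsub : L'.Sublist L)
    (htree : ∀ e ∈ L, fp e.1 = e.2 + 1 ∨ fp e.2 = e.1 + 1 → e ∈ L')
    (hdrop : ∀ e ∈ L, e ∉ L' → k * ((range n).filter fun v => root v = root e.1).card ≤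
      (L'.filter fun f => decide (root f.1 = root e.1)).length) :
    Kept k dpt P L' := by
  have hL : ∀ u v, Und L u v → u < n ∧ dpt u = 0 := by
    rintro u v (huv | huv)
    · exact ⟨(hn _ (h.sub.subset huv)).1, (h.free _ huv).1⟩
    · exact ⟨(hn _ (h.sub.subset huv)).2, (h.free _ huv).2⟩
  have htree' : ∀ v p, fp v = p + 1 → Und L' p v := by
    intro v p hp
    rcases (hS.child v p hp).1 with hm | hm
    · exact .inl (htree _ hm (.inr hp))
    · exact .inr (htree _ hm (.inl hp))
  have hconn : ∀ {u v}, u ∈ ord → v ∈ ord → root u = root v → LConn L' u v :=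
    fun hu hv huv => hS.lconn_of_root_eq htree' hu hv huv
  have hnew : ∀ e ∈ L, e ∉ L' → ∀ u ∈ ord, root u = root e.1 → Dense k L' u := by
    intro e he he' u hu hue
    refine ⟨(range n).filter fun v => root v = root e.1, ⟨u, ?_⟩, fun a ha => ?_, ?_⟩
    · simp [hue, (hS.free u hu).1]
    · rw [mem_filter] at ha
      refine hconn hu ((hS.visited a).1 ?_) (by rw [hue, ha.2])
      rw [ha.2, ← hue]
      exact (hS.visited u).2 hu
    · refine (hdrop e he he').trans (le_of_eq ?_)
      unfold within
      congr 1
      refine List.filter_congr fun f hf => ?_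
      have hfL := hsub.subset hf
      have hfP := hn f (h.sub.subset hfL)
      have hroot : root f.2 = root f.1 :=
        hS.root_eq_of_lconn hL (ReflTransGen.single (.inl hfL))
      simp [hfP.1, hfP.2, hroot]
  have hold : ∀ u ∈ ord, Dense k L u → Dense k L' u := by
    intro u hu hD
    by_cases hex : ∃ e ∈ L, e ∉ L' ∧ root u = root e.1
    · obtain ⟨e, he, he', hr⟩ := hex
      exact hnew e he he' u hu hr
    · push Not at hex
      obtain ⟨A, hA, hc, hcard⟩ := hD
      refine ⟨A, hA, fun a ha => ?_, hcard.trans ?_⟩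
      · have hr := hS.root_eq_of_lconn hL (hc a ha)
        refine hconn hu ((hS.visited a).1 ?_) hr.symm
        rw [hr]
        exact (hS.visited u).2 hu
      · refine List.Subperm.length_le (List.Nodup.subperm
          ((hP.nodup.sublist h.sub).filter _) fun e he => ?_)
        obtain ⟨heL, h₁, h₂⟩ := mem_within.1 he
        refine mem_within.2 ⟨?_, h₁, h₂⟩
        by_contra he'
        exact hex e heL he' (hS.root_eq_of_lconn hL (hc _ h₁)).symm
  refine ⟨hsub.trans h.sub, fun e he => h.free e (hsub.subset he), fun e he h₁ h₂ => ?_⟩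
  have ho₁ : e.1 ∈ ord := hS.mem_iff.2 ⟨(hn e he).1, h₁⟩
  have ho₂ : e.2 ∈ ord := hS.mem_iff.2 ⟨(hn e he).2, h₂⟩
  rcases h.drop e he h₁ h₂ with hm | ⟨hc, hD⟩
  · by_cases hm' : e ∈ L'
    · exact .inl hm'
    · refine .inr ⟨hconn ho₁ ho₂ ?_, hnew e hm hm' _ ho₁ rfl⟩
      exact (hS.root_eq_of_lconn hL (ReflTransGen.single (.inl hm))).symm
  · exact .inr ⟨hconn ho₁ ho₂ (hS.root_eq_of_lconn hL hc).symm, hold _ ho₁ hD⟩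

end Streaming

/-! ## Partial depth-first search forests -/

namespace Streaming

open Relation Finset

/-- The edge relation of a simple graph on `{0, …, n - 1}`. -/
structure IsGraph (n : ℕ) (E : ℕ → ℕ → Prop) : Prop where
  symm : ∀ {u v}, E u v → E v u
  ne : ∀ {u v}, E u v → u ≠ v
  lt : ∀ {u v}, E u v → u < n

/-- The list shows every edge once. -/
structure Lists (E : ℕ → ℕ → Prop) (P : List (ℕ × ℕ)) : Prop where
  sound : ∀ e ∈ P, E e.1 e.2
  complete : ∀ {u v}, E u v → Und P u v
  distinct : Distinct P

/-- Connectedness by edges between vertices with `dpt v = 0`. -/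
def FConn (E : ℕ → ℕ → Prop) (dpt : ℕ → ℕ) : ℕ → ℕ → Prop :=
  ReflTransGen fun a b => E a b ∧ dpt a = 0 ∧ dpt b = 0

theorem FConn.free {E : ℕ → ℕ → Prop} {dpt : ℕ → ℕ} {a b : ℕ} (h : FConn E dpt a b)
    (ha : dpt a = 0) : dpt b = 0 := by
  induction h with
  | refl => exact ha
  | tail _ hc _ => exact hc.2.2

theorem FConn.symm {n : ℕ} {E : ℕ → ℕ → Prop} (hE : IsGraph n E) {dpt : ℕ → ℕ} {a b : ℕ}
    (h : FConn E dpt a b) : FConn E dpt b a := by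
  induction h with
  | refl => exact ReflTransGen.refl
  | tail _ hc ih => exact ReflTransGen.head ⟨hE.symm hc.1, hc.2.2, hc.2.1⟩ ih

theorem FConn.mono {E : ℕ → ℕ → Prop} {dpt dpt' : ℕ → ℕ} (hd : ∀ v, dpt' v = 0 → dpt v = 0)
    {a b : ℕ} (h : FConn E dpt' a b) : FConn E dpt a b :=
  ReflTransGen.mono (fun _ _ h => ⟨h.1, hd _ h.2.1, hd _ h.2.2⟩) _ _ h

/-- The vertices are joined by an edge or by a path whose inner vertices have `dpt v = 0`. -/
def Link (E : ℕ → ℕ → Prop) (dpt : ℕ → ℕ) (x y : ℕ) : Prop :=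
  E x y ∨ ∃ a b, dpt a = 0 ∧ dpt b = 0 ∧ E x a ∧ FConn E dpt a b ∧ E b y

theorem Link.symm {n : ℕ} {E : ℕ → ℕ → Prop} (hE : IsGraph n E) {dpt : ℕ → ℕ} {x y : ℕ}
    (h : Link E dpt x y) : Link E dpt y x := by
  rcases h with h | ⟨a, b, ha, hb, hxa, hab, hby⟩
  · exact .inl (hE.symm h)
  · exact .inr ⟨b, a, hb, ha, hE.symm hby, hab.symm hE, hE.symm hxa⟩

/-- A partial depth-first search forest: `par` is the (coded) parent function, and `dpt` the level of
the vertices of the forest and `0` for the other vertices. Two vertices of the forest that are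
linked outside of the forest are in ancestor-descendant relation. -/
structure Partial (n : ℕ) (E : ℕ → ℕ → Prop) (par dpt : ℕ → ℕ) : Prop where
  lt : ∀ v, dpt v ≠ 0 → v < n
  par_zero : ∀ v, dpt v = 0 → par v = 0
  root : ∀ v, dpt v ≠ 0 → par v = 0 → dpt v = 1
  tree : ∀ v u, par v = u + 1 → E u v ∧ dpt u ≠ 0 ∧ dpt v = dpt u + 1
  link : ∀ x y, dpt x ≠ 0 → dpt y ≠ 0 → Link E dpt x y → Anc par x y ∨ Anc par y x

theorem Partial.empty (n : ℕ) (E : ℕ → ℕ → Prop) : Partial n E (fun _ => 0) (fun _ => 0) := by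
  constructor <;> simp

theorem Partial.anc_level {n : ℕ} {E : ℕ → ℕ → Prop} {par dpt : ℕ → ℕ} (h : Partial n E par dpt)
    {a b : ℕ} (hab : Anc par a b) : dpt a ≤ dpt b ∧ (dpt a = dpt b → a = b) := by
  induction hab with
  | refl => simp
  | tail _ hc ih =>
    have := (h.tree _ _ hc).2.2
    exact ⟨by omega, fun _ => by omega⟩

/-- The path from the root to `v` takes all levels from `1` to `dpt v`, at different vertices. The
bound lets the program sort vertices by keys in `n + 1` buckets. -/
theorem Partial.dpt_le {n : ℕ} {E : ℕ → ℕ → Prop} {par dpt : ℕ → ℕ} (h : Partial n E par dpt)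
    (v : ℕ) : dpt v ≤ n := by
  by_cases hv : dpt v = 0
  · omega
  have hex := Anc.exists_level (p := par) (f := dpt) (c := 1) (S := fun v => dpt v ≠ 0)
    (fun b a _ hp => (h.tree b a hp).2) (fun b hb hp => h.root b hb hp) v hv
  have hsub : Icc 1 (dpt v) ⊆ (range n).image dpt := by
    intro d hd
    rw [mem_Icc] at hd
    obtain ⟨a, ha, -, had⟩ := hex d hd.1 hd.2
    exact mem_image.2 ⟨a, mem_range.2 (h.lt a ha), had⟩
  have := (card_le_card hsub).trans card_image_le
  simpa using this

/-- `ky v` is the largest level of the neighbours of `v` in the forest, and `att v` is the code of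
such a neighbour; only the edges of `P` are taken into account. -/
structure Attach (E : ℕ → ℕ → Prop) (dpt att ky : ℕ → ℕ) (P : List (ℕ × ℕ)) : Prop where
  zero : ∀ v, att v = 0 → ky v = 0
  code : ∀ v t, att v = t + 1 → E t v ∧ dpt t ≠ 0 ∧ ky v = dpt t
  max : ∀ v t, Und P t v → dpt v = 0 → dpt t ≤ ky v

/-- `deep r` is `0` if all vertices in the tree with root `r` have a relative level less than `k`;
otherwise it is the code of some vertex with relative level at least `k`. -/
structure Deepest (k : ℕ) (root ad : ℕ → ℕ) (ord : List ℕ) (deep : ℕ → ℕ) : Prop where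
  code : ∀ r y, deep r = y + 1 → y ∈ ord ∧ root y = r + 1 ∧ ad r + k ≤ ad y
  zero : ∀ y ∈ ord, deep (root y - 1) = 0 → ad y < ad (root y - 1) + k

/-- The vertices of the search forest that join the partial forest: those of the trees of small
height, and those of one long path from the root in every other tree. -/
def Joins (fp root deep : ℕ → ℕ) (ord : List ℕ) (x : ℕ) : Prop :=
  x ∈ ord ∧ (deep (root x - 1) = 0 ∨ ∃ y, deep (root x - 1) = y + 1 ∧ Anc fp x y)

/-- Extending a partial forest by the joining vertices of a search forest. -/
structure Extends (fp root ad att deep : ℕ → ℕ) (ord : List ℕ) (par dpt par' dpt' : ℕ → ℕ) :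
    Prop where
  old : ∀ x, dpt x ≠ 0 → par' x = par x ∧ dpt' x = dpt x
  new : ∀ x, Joins fp root deep ord x → dpt' x = ad x ∧ par' x = if fp x = 0 then att x else fp x
  rest : ∀ x, dpt x = 0 → ¬ Joins fp root deep ord x → dpt' x = 0 ∧ par' x = 0

/-! ### Correctness and progress of a single pass -/

section phase

variable {n k : ℕ} {E : ℕ → ℕ → Prop} {par dpt att ky fp root ad deep par' dpt' : ℕ → ℕ}
  {P L : List (ℕ × ℕ)} {ord : List ℕ}

theorem Kept.und_free (hE : IsGraph n E) (hP : Lists E P) (hK : Kept k dpt P L) :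
    ∀ u v, Und L u v → u < n ∧ dpt u = 0 := by
  rintro u v (huv | huv)
  · exact ⟨hE.lt (hP.sound _ (hK.sub.subset huv)), (hK.free _ huv).1⟩
  · exact ⟨hE.lt (hE.symm (hP.sound _ (hK.sub.subset huv))), (hK.free _ huv).2⟩

theorem Kept.fconn_of_lconn (hE : IsGraph n E) (hP : Lists E P) (hK : Kept k dpt P L) {a b : ℕ}
    (h : LConn L a b) : FConn E dpt a b := by
  refine ReflTransGen.mono (fun u v huv => ⟨?_, (hK.und_free hE hP _ _ huv).2,
    (hK.und_free hE hP _ _ huv.symm).2⟩) _ _ h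
  rcases huv with huv | huv
  · exact hP.sound _ (hK.sub.subset huv)
  · exact hE.symm (hP.sound _ (hK.sub.subset huv))

/-- The ends of a dropped edge are still connected by the list, so the list has the components of
the full graph on the free vertices. -/
theorem Kept.lconn_of_fconn (hP : Lists E P) (hK : Kept k dpt P L) {a b : ℕ}
    (h : FConn E dpt a b) : LConn L a b := by
  induction h with
  | refl => exact ReflTransGen.refl
  | @tail b c _ hc ih =>
    refine ih.trans ?_
    rcases hP.complete hc.1 with he | he
    · rcases hK.drop _ he hc.2.1 hc.2.2 with h | h
      · exact ReflTransGen.single (.inl h)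
      · exact h.1
    · rcases hK.drop _ he hc.2.2 hc.2.1 with h | h
      · exact ReflTransGen.single (.inr h)
      · exact h.1.symm

/-- The situation at the end of a pass, after the search on the edges that have been kept. -/
structure PassEnd (n k : ℕ) (E : ℕ → ℕ → Prop) (par dpt att ky fp root ad deep par' dpt' : ℕ → ℕ)
    (P L : List (ℕ × ℕ)) (ord : List ℕ) : Prop where
  pos : 0 < k
  graph : IsGraph n E
  lists : Lists E P
  forest : Partial n E par dpt
  kept : Kept k dpt P L
  search : Search n dpt ky L fp root ad ord []
  attach : Attach E dpt att ky P
  deepest : Deepest k root ad ord deep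
  ext : Extends fp root ad att deep ord par dpt par' dpt'

namespace PassEnd

theorem fconn_iff (h : PassEnd n k E par dpt att ky fp root ad deep par' dpt' P L ord) {a b : ℕ}
    (ha : a ∈ ord) (hb : b ∈ ord) : FConn E dpt a b ↔ root a = root b := by
  refine ⟨fun hc => ?_, fun hr => h.kept.fconn_of_lconn h.graph h.lists
    (h.search.lconn_of_root_eq (fun v p hp => (h.search.child v p hp).1) ha hb hr)⟩
  exact (h.search.root_eq_of_lconn (h.kept.und_free h.graph h.lists)
    (h.kept.lconn_of_fconn h.lists hc)).symm

theorem mem_of_fconn (h : PassEnd n k E par dpt att ky fp root ad deep par' dpt' P L ord) {a b : ℕ}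
    (ha : a ∈ ord) (hc : FConn E dpt a b) : b ∈ ord := by
  induction hc with
  | refl => exact ha
  | tail _ hc _ => exact h.search.mem_iff.2 ⟨h.graph.lt (h.graph.symm hc.1), hc.2.2⟩

theorem joins_anc (h : PassEnd n k E par dpt att ky fp root ad deep par' dpt' P L ord) {a b : ℕ}
    (hb : Joins fp root deep ord b) (hab : Anc fp a b) : Joins fp root deep ord a := by
  have hr := (h.search.anc_level hab).1
  refine ⟨h.search.closed.anc_mem hb.1 hab, ?_⟩
  rw [← hr]
  exact hb.2.imp_right fun ⟨y, hy, hby⟩ => ⟨y, hy, hab.trans hby⟩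

theorem joins_free (h : PassEnd n k E par dpt att ky fp root ad deep par' dpt' P L ord) {a : ℕ}
    (ha : Joins fp root deep ord a) : dpt a = 0 := (h.search.free a ha.1).2

theorem joins_dpt_ne (h : PassEnd n k E par dpt att ky fp root ad deep par' dpt' P L ord) {a : ℕ}
    (ha : Joins fp root deep ord a) : dpt' a ≠ 0 := by
  rw [(h.ext.new a ha).1]
  exact (h.search.ad_pos ha.1).ne'

theorem dpt_of_dpt' (h : PassEnd n k E par dpt att ky fp root ad deep par' dpt' P L ord) (v : ℕ)
    (hv : dpt' v = 0) : dpt v = 0 := by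
  by_contra hne
  rw [(h.ext.old v hne).2] at hv
  exact hne hv

theorem cases (h : PassEnd n k E par dpt att ky fp root ad deep par' dpt' P L ord) {v : ℕ}
    (hv : dpt' v ≠ 0) : dpt v ≠ 0 ∨ Joins fp root deep ord v := by
  by_contra! hc
  exact hv (h.ext.rest v hc.1 hc.2).1

theorem anc_old (h : PassEnd n k E par dpt att ky fp root ad deep par' dpt' P L ord) {a b : ℕ}
    (hab : Anc par a b) : Anc par' a b :=
  hab.mono fun b hb => (h.ext.old b fun h0 => hb (h.forest.par_zero b h0)).1

theorem anc_new (h : PassEnd n k E par dpt att ky fp root ad deep par' dpt' P L ord) {a b : ℕ}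
    (hab : Anc fp a b) (hb : Joins fp root deep ord b) : Anc par' a b := by
  induction hab with
  | refl => exact Anc.refl _
  | @tail b c hab hc ih =>
    have hb' := h.joins_anc hb ((Anc.refl b).step hc)
    refine (ih hb').step ?_
    rw [(h.ext.new c hb).2, hc]
    simp

/-- A vertex of the old forest that is linked to a new vertex is an ancestor of it. -/
theorem anc_mixed (h : PassEnd n k E par dpt att ky fp root ad deep par' dpt' P L ord) {x y : ℕ}
    (hx : dpt x ≠ 0) (hy : Joins fp root deep ord y) (hxy : Link E dpt x y) : Anc par' x y := by
  have hyf := h.joins_free hy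
  -- `z` is the vertex where the link from `x` enters the component of `y`.
  obtain ⟨z, hxz, hzy, hz⟩ : ∃ z, E x z ∧ FConn E dpt z y ∧ dpt z = 0 := by
    rcases hxy with hxy | ⟨a, b, ha, hb, hxa, hab, hby⟩
    · exact ⟨y, hxy, ReflTransGen.refl, hyf⟩
    · exact ⟨a, hxa, ReflTransGen.tail hab ⟨hby, hb, hyf⟩, ha⟩
  have hzo : z ∈ ord := h.search.mem_iff.2 ⟨h.graph.lt (h.graph.symm hxz), hz⟩
  obtain ⟨r, hyr, hro, hr0, hrr, hanc⟩ := h.search.exists_root hy.1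
  have hzr : root z = r + 1 := by rw [(h.fconn_iff hzo hy.1).1 hzy, hyr]
  -- The root has the largest key in its tree, so the vertex `t` to which it is attached is at least
  -- as deep as `x`.
  have hk₁ : dpt x ≤ ky z := h.attach.max z x (h.lists.complete hxz) hz
  have hk₂ : ky z ≤ ky r := by simpa [hzr] using h.search.root_key z hzo
  rcases hat : att r with _ | t
  · have := h.attach.zero r hat
    omega
  obtain ⟨htr, ht, hkt⟩ := h.attach.code r t hat
  -- The component links `x` to `t`, so they are comparable in the old forest, and the levels decide
  -- that `x` is the ancestor.
  have hlink : Link E dpt x t :=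
    .inr ⟨z, r, hz, (h.search.free r hro).2, hxz,
      (h.fconn_iff hzo hro).2 (by rw [hzr, hrr]), h.graph.symm htr⟩
  have hxt : Anc par x t := by
    rcases h.forest.link x t hx ht hlink with hxt | htx
    · exact hxt
    · have := h.forest.anc_level htx
      obtain rfl := this.2 (by omega)
      exact Anc.refl _
  have hjr := h.joins_anc hy hanc
  refine ((h.anc_old hxt).step ?_).trans (h.anc_new hanc hy)
  rw [(h.ext.new r hjr).2, if_pos hr0, hat]

/-- The contrapositive of `exists_deep`: a dense component would have produced a vertex of relative
level at least `k`, which `Deepest` would have recorded. -/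
theorem dense_deep (h : PassEnd n k E par dpt att ky fp root ad deep par' dpt' P L ord) {x : ℕ}
    (hx : x ∈ ord) (hd : deep (root x - 1) = 0) : ¬ Dense k L x := by
  intro hD
  obtain ⟨a, ha, har, had⟩ := h.search.exists_deep h.pos (h.kept.und_free h.graph h.lists)
    (h.lists.distinct.sublist h.kept.sub)
    (fun e he => h.graph.ne (h.lists.sound e (h.kept.sub.subset he))) hx hD
  have := h.deepest.zero a ha (by rw [har, hd])
  rw [har] at this
  omega

/-- In a tree without a deep vertex no edge is missing from `L`, because a missing edge would make
the component dense. -/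
theorem comparable_of_edge (h : PassEnd n k E par dpt att ky fp root ad deep par' dpt' P L ord)
    {x y : ℕ} (hx : x ∈ ord) (hy : y ∈ ord) (hxy : E x y) (hd : deep (root x - 1) = 0) :
    Anc fp x y ∨ Anc fp y x := by
  have hxf := (h.search.free x hx).2
  have hyf := (h.search.free y hy).2
  have hr : root x = root y :=
    (h.fconn_iff hx hy).1 (ReflTransGen.single ⟨hxy, hxf, hyf⟩)
  refine h.search.und_comparable (h.kept.und_free h.graph h.lists) ?_
  rcases h.lists.complete hxy with he | he
  · rcases h.kept.drop _ he hxf hyf with hm | hm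
    · exact .inl hm
    · exact absurd hm.2 (h.dense_deep hx hd)
  · rcases h.kept.drop _ he hyf hxf with hm | hm
    · exact .inr hm
    · exact absurd hm.2 (h.dense_deep hy (by rw [← hr]; exact hd))

/-- A tree without a deep vertex joins as a whole, so no path through vertices that stay free can
leave or enter it, and the link is a single edge. In a tree with a deep vertex, both vertices lie on
the one path that joins. -/
theorem comparable_new (h : PassEnd n k E par dpt att ky fp root ad deep par' dpt' P L ord)
    {x y : ℕ} (hx : Joins fp root deep ord x) (hy : Joins fp root deep ord y)
    (hxy : Link E dpt' x y) : Anc par' x y ∨ Anc par' y x := by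
  have hxf := h.joins_free hx
  have hyf := h.joins_free hy
  have hr : root x = root y := by
    refine (h.fconn_iff hx.1 hy.1).1 ?_
    rcases hxy with hxy | ⟨a, b, ha, hb, hxa, hab, hby⟩
    · exact ReflTransGen.single ⟨hxy, hxf, hyf⟩
    · refine (ReflTransGen.head ⟨hxa, hxf, h.dpt_of_dpt' a ha⟩
        (hab.mono h.dpt_of_dpt')).tail ⟨hby, h.dpt_of_dpt' b hb, hyf⟩
  have hcmp : Anc fp x y ∨ Anc fp y x := by
    rcases hd : deep (root x - 1) with _ | w
    · rcases hxy with hxy | ⟨a, b, ha, hb, hxa, hab, hby⟩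
      · exact h.comparable_of_edge hx.1 hy.1 hxy hd
      · have hc : FConn E dpt x a := ReflTransGen.single ⟨hxa, hxf, h.dpt_of_dpt' a ha⟩
        have hao := h.mem_of_fconn hx.1 hc
        refine absurd ha (h.joins_dpt_ne ⟨hao, .inl ?_⟩)
        rw [← (h.fconn_iff hx.1 hao).1 hc, hd]
    · obtain ⟨u, hu, hxu⟩ := hx.2.resolve_left (by omega)
      obtain ⟨v, hv, hyv⟩ := hy.2.resolve_left (by rw [← hr]; omega)
      rw [← hr] at hv
      obtain rfl : u = v := by omega
      exact hxu.total hyv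
  exact hcmp.imp (fun hc => h.anc_new hc hy) fun hc => h.anc_new hc hx

/-- The extended forest is again a partial depth-first search forest. -/
theorem partial_next (h : PassEnd n k E par dpt att ky fp root ad deep par' dpt' P L ord) :
    Partial n E par' dpt' where
  lt v hv := by
    rcases h.cases hv with hv | hv
    · exact h.forest.lt v hv
    · exact (h.search.free v hv.1).1
  par_zero v hv := by
    have hd := h.dpt_of_dpt' v hv
    exact (h.ext.rest v hd fun hj => h.joins_dpt_ne hj hv).2
  root v hv hp := by
    rcases h.cases hv with hv | hv
    · rw [(h.ext.old v hv).1] at hp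
      rw [(h.ext.old v hv).2, h.forest.root v hv hp]
    · obtain ⟨h₁, h₂⟩ := h.ext.new v hv
      rw [h₁]
      rw [h₂] at hp
      by_cases h0 : fp v = 0
      · rw [if_pos h0] at hp
        -- A search root without a forest neighbour has key `0`, so its level `ky v + 1` is the
        -- level `1` of a root.
        rw [(h.search.root_eq v hv.1 h0).2, h.attach.zero v hp]
      · rw [if_neg h0] at hp
        exact absurd hp h0
  tree v u hp := by
    have hv : dpt v ≠ 0 ∨ Joins fp root deep ord v := by
      by_contra! hc
      rw [(h.ext.rest v hc.1 hc.2).2] at hp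
      omega
    rcases hv with hv | hv
    · rw [(h.ext.old v hv).1] at hp
      obtain ⟨h₁, h₂, h₃⟩ := h.forest.tree v u hp
      rw [(h.ext.old v hv).2, (h.ext.old u h₂).2]
      exact ⟨h₁, h₂, h₃⟩
    · obtain ⟨h₁, h₂⟩ := h.ext.new v hv
      rw [h₁]
      rw [h₂] at hp
      rcases h0 : fp v with _ | p
      · rw [if_pos h0] at hp
        obtain ⟨a₁, a₂, a₃⟩ := h.attach.code v u hp
        rw [(h.search.root_eq v hv.1 h0).2, (h.ext.old u a₂).2, a₃]
        exact ⟨a₁, a₂, rfl⟩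
      · rw [if_neg (by omega), h0] at hp
        obtain rfl : p = u := by omega
        obtain ⟨c₁, c₂, c₃⟩ := h.search.child v p h0
        have hj := h.joins_anc hv ((Anc.refl p).step h0)
        refine ⟨?_, h.joins_dpt_ne hj, by rw [c₃, (h.ext.new p hj).1]⟩
        rcases c₁ with hm | hm
        · exact h.lists.sound _ (h.kept.sub.subset hm)
        · exact h.graph.symm (h.lists.sound _ (h.kept.sub.subset hm))
  link x y hx hy hxy := by
    have hold : Link E dpt x y := hxy.imp_right fun ⟨a, b, ha, hb, hxa, hab, hby⟩ =>
      ⟨a, b, h.dpt_of_dpt' a ha, h.dpt_of_dpt' b hb, hxa, hab.mono h.dpt_of_dpt', hby⟩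
    rcases h.cases hx with hx | hx <;> rcases h.cases hy with hy | hy
    · exact (h.forest.link x y hx hy hold).imp h.anc_old h.anc_old
    · exact .inl (h.anc_mixed hx hy hold)
    · exact .inr (h.anc_mixed hy hx (hold.symm h.graph))
    · exact h.comparable_new hx hy hxy

open Classical in
/-- A component that remains has at least `k` vertices less than before. -/
theorem card_next (h : PassEnd n k E par dpt att ky fp root ad deep par' dpt' P L ord) {v : ℕ}
    (hv : v < n) (hv' : dpt' v = 0) :
    ((range n).filter (FConn E dpt' v)).card + k ≤ ((range n).filter (FConn E dpt v)).card := by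
  have hvo : v ∈ ord := h.search.mem_iff.2 ⟨hv, h.dpt_of_dpt' v hv'⟩
  have hnj : ¬ Joins fp root deep ord v := fun hj => h.joins_dpt_ne hj hv'
  obtain ⟨y, hy⟩ : ∃ y, deep (root v - 1) = y + 1 := by
    refine Nat.exists_eq_succ_of_ne_zero fun h0 => hnj ⟨hvo, .inl h0⟩
  obtain ⟨r, hr, hro, hr0, hrr, -⟩ := h.search.exists_root hvo
  have hrv : root v - 1 = r := by omega
  rw [hrv] at hy
  obtain ⟨hyo, hyr, hyd⟩ := h.deepest.code r y hy
  have hjoin : ∀ a, Anc fp a y → Joins fp root deep ord a ∧ root a = root v := by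
    intro a ha
    have har := (h.search.anc_level ha).1
    rw [hyr] at har
    refine ⟨⟨h.search.closed.anc_mem hyo ha, .inr ⟨y, ?_, ha⟩⟩, by rw [← har, hr]⟩
    rw [← har]
    simpa using hy
  -- The path from `r` to `y` meets every level from `ad r` to `ad y`; there are at least `k + 1` of
  -- them.
  have hlev : k ≤ ((range n).filter fun a => Anc fp a y).card := by
    have hsub : Icc (ad r) (ad y) ⊆ ((range n).filter fun a => Anc fp a y).image ad := by
      intro d hd
      rw [mem_Icc] at hd
      obtain ⟨a, ⟨hao, har⟩, hanc, had⟩ := Anc.exists_level (p := fp) (f := ad) (c := ad r)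
        (S := fun a => a ∈ ord ∧ root a = r + 1)
        (fun b a hb hp => ⟨⟨h.search.closed.parent_mem hb.1 hp,
          by rw [← (h.search.child b a hp).2.1, hb.2]⟩, (h.search.child b a hp).2.2⟩)
        (fun b hb hp => by
          have := (h.search.root_eq b hb.1 hp).1
          rw [hb.2] at this
          obtain rfl : r = b := by omega
          rfl) y ⟨hyo, hyr⟩ d hd.1 hd.2
      exact mem_image.2 ⟨a, mem_filter.2 ⟨mem_range.2 (h.search.free a hao).1, hanc⟩, had⟩
    have := (card_le_card hsub).trans card_image_le
    rw [Nat.card_Icc] at this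
    omega
  -- The path has joined the forest, so none of it is in the new component, whereas all of it was in
  -- the old one.
  have hdisj : Disjoint ((range n).filter (FConn E dpt' v))
      ((range n).filter fun a => Anc fp a y) := by
    rw [disjoint_left]
    intro a ha ha'
    rw [mem_filter] at ha ha'
    exact h.joins_dpt_ne (hjoin a ha'.2).1 (ha.2.free hv')
  calc ((range n).filter (FConn E dpt' v)).card + k
      ≤ ((range n).filter (FConn E dpt' v)).card +
        ((range n).filter fun a => Anc fp a y).card := by omega
    _ = _ := (card_union_of_disjoint hdisj).symm
    _ ≤ _ := card_le_card fun a ha => by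
      rw [mem_union, mem_filter, mem_filter] at ha
      rw [mem_filter]
      rcases ha with ha | ha
      · exact ⟨ha.1, ha.2.mono h.dpt_of_dpt'⟩
      · exact ⟨ha.1, (h.fconn_iff hvo (hjoin a ha.2).1.1).2 (hjoin a ha.2).2.symm⟩

end PassEnd

end phase

/-! ## Complete forests -/

/-- The parent function on `Fin n` with the given codes. -/
def decodeParent {n : ℕ} (par : ℕ → ℕ) (v : Fin n) : Option (Fin n) :=
  if h : par v ≠ 0 ∧ par v - 1 < n then some ⟨par v - 1, h.2⟩ else none

/-- The edge relation on numbers of a graph on `Fin n`. -/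
def natAdj {n : ℕ} (G : SimpleGraph (Fin n)) (u v : ℕ) : Prop :=
  ∃ (hu : u < n) (hv : v < n), G.Adj ⟨u, hu⟩ ⟨v, hv⟩

theorem isGraph_natAdj {n : ℕ} (G : SimpleGraph (Fin n)) : IsGraph n (natAdj G) where
  symm := fun ⟨hu, hv, h⟩ => ⟨hv, hu, h.symm⟩
  ne := fun ⟨_, _, h⟩ heq => h.ne (Fin.ext heq)
  lt := fun ⟨hu, _, _⟩ => hu

theorem lists_toWords {n : ℕ} {G : SimpleGraph (Fin n)} {l : List (Fin n × Fin n)}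
    (h : IsEdgeStream G l) : Lists (natAdj G) (toWords l) where
  sound e he := by
    obtain ⟨f, hf, rfl⟩ := List.mem_map.1 he
    have := (h.2 s(f.1, f.2)).1 (List.mem_map.2 ⟨f, hf, rfl⟩)
    exact ⟨f.1.2, f.2.2, this⟩
  complete := by
    rintro u v ⟨hu, hv, ha⟩
    obtain ⟨f, hf, hfe⟩ := List.mem_map.1 ((h.2 s(⟨u, hu⟩, ⟨v, hv⟩)).2 ha)
    rcases Sym2.eq_iff.1 hfe with ⟨h₁, h₂⟩ | ⟨h₁, h₂⟩
    · exact .inl (List.mem_map.2 ⟨f, hf, by rw [h₁, h₂]⟩)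
    · exact .inr (List.mem_map.2 ⟨f, hf, by rw [h₁, h₂]⟩)
  distinct := by
    refine List.pairwise_map.2 ((List.pairwise_map.1 h.1).imp fun {a b} hab => ⟨?_, ?_⟩)
    · rintro heq
      simp only [Prod.mk.injEq] at heq
      exact hab (by rw [Fin.ext heq.1, Fin.ext heq.2])
    · rintro heq
      simp only [Prod.swap_prod_mk, Prod.mk.injEq] at heq
      exact hab (by rw [Fin.ext heq.1, Fin.ext heq.2, Sym2.eq_swap])

theorem length_toWords {n : ℕ} {G : SimpleGraph (Fin n)} {l : List (Fin n × Fin n)}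
    (h : IsEdgeStream G l) : (toWords l).length = G.edgeSet.ncard := by
  classical
  have : G.edgeSet = ((l.map fun e => s(e.1, e.2)).toFinset : Set (Sym2 (Fin n))) := by
    ext e
    simpa using (h.2 e).symm
  rw [this, Set.ncard_coe_finset, List.toFinset_card_of_nodup h.1]
  simp [toWords]

section complete

variable {n : ℕ} {G : SimpleGraph (Fin n)} {par dpt : ℕ → ℕ}

theorem decodeParent_eq_some {u v : Fin n} :
    decodeParent par v = some u ↔ par v = u + 1 := by
  unfold decodeParent
  constructor
  · intro hv
    split_ifs at hv with hc
    have := congrArg Fin.val (Option.some.inj hv)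
    simp only at this
    omega
  · intro hv
    have hu : par v - 1 < n := by have := u.2; omega
    rw [dif_pos ⟨by omega, hu⟩]
    congr 1
    ext
    simp only
    omega

theorem parentCode_decodeParent (h : Partial n (natAdj G) par dpt) (v : Fin n) :
    par v = parentCode (decodeParent par v) := by
  rcases hp : par v with _ | u
  · simp [decodeParent, hp, parentCode]
  · have hu : u < n := (isGraph_natAdj G).lt (h.tree v u hp).1
    have := (decodeParent_eq_some (u := ⟨u, hu⟩) (v := v)).2 hp
    simp [this, parentCode]

theorem isAncestor_of_anc (h : Partial n (natAdj G) par dpt) {a : ℕ} {v : Fin n}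
    (hav : Anc par a v) : ∃ ha : a < n, IsAncestor (decodeParent par) ⟨a, ha⟩ v := by
  suffices H : ∀ b, Anc par a b → ∀ hb : b < n,
      ∃ ha : a < n, IsAncestor (decodeParent par) ⟨a, ha⟩ ⟨b, hb⟩ from H _ hav v.2
  intro b hab
  induction hab with
  | refl => exact fun hb => ⟨hb, ReflTransGen.refl⟩
  | @tail b c _ hc ih =>
    intro hcn
    have hb : b < n := (isGraph_natAdj G).lt (h.tree c b hc).1
    obtain ⟨ha, hanc⟩ := ih hb
    exact ⟨ha, ReflTransGen.tail hanc ((decodeParent_eq_some (u := ⟨b, hb⟩)).2 hc)⟩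

/-- Two comparable vertices have the same root. -/
theorem IsAncestor.root_eq {V : Type*} {p : V → Option V} {r u v : V} (hr : p r = none)
    (hrv : IsAncestor p r v) (huv : IsAncestor p u v) : IsAncestor p r u := by
  induction hrv with
  | refl =>
    rcases ReflTransGen.cases_tail huv with h | ⟨b, _, hb⟩
    · rw [h]; exact ReflTransGen.refl
    · rw [hr] at hb; cases hb
  | @tail b c hrb hb ih =>
    rcases ReflTransGen.cases_tail huv with h | ⟨d, hd, hd'⟩
    · rw [← h]; exact ReflTransGen.tail hrb hb
    · rw [hb] at hd'
      obtain rfl : b = d := Option.some.inj hd'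
      exact ih hd

/-- If no vertex is free, `link` applied to single edges excludes cross edges. Comparable vertices
have a common root, so following a walk edge by edge shows that one root serves a whole component.
-/
theorem Partial.isDFSForest (h : Partial n (natAdj G) par dpt) (hall : ∀ v < n, dpt v ≠ 0) :
    IsDFSForest G (decodeParent par : Fin n → Option (Fin n)) := by
  have hback : ∀ u v, G.Adj u v → IsAncestor (decodeParent par) u v ∨
      IsAncestor (decodeParent par) v u := by
    intro u v huv
    rcases h.link u v (hall u u.2) (hall v v.2) (.inl ⟨u.2, v.2, huv⟩) with hc | hc
    · exact .inl (isAncestor_of_anc h hc).2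
    · exact .inr (isAncestor_of_anc h hc).2
  have hroot : ∀ v : Fin n, ∃ r, decodeParent par r = none ∧ IsAncestor (decodeParent par) r v := by
    intro v
    obtain ⟨a, ha, hav, had⟩ := Anc.exists_level (p := par) (f := dpt) (c := 1)
      (S := fun v => dpt v ≠ 0) (fun b a _ hp => (h.tree b a hp).2)
      (fun b hb hp => h.root b hb hp) v (hall v v.2) 1 le_rfl
      (Nat.one_le_iff_ne_zero.2 (hall v v.2))
    obtain ⟨han, hanc⟩ := isAncestor_of_anc h hav
    refine ⟨⟨a, han⟩, ?_, hanc⟩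
    rcases hp : decodeParent par (⟨a, han⟩ : Fin n) with _ | u
    · rfl
    · have := (h.tree a u (decodeParent_eq_some.1 hp)).2
      omega
  have htree : ∀ u v : Fin n, decodeParent par v = some u → G.Adj u v := by
    intro u v huv
    obtain ⟨_, _, ha⟩ := (h.tree v u (decodeParent_eq_some.1 huv)).1
    exact ha
  refine ⟨htree, fun c => ?_, hback⟩
  induction c using SimpleGraph.ConnectedComponent.ind with
  | _ v =>
    obtain ⟨r, hr, hrv⟩ := hroot v
    have hreach : ∀ w, IsAncestor (decodeParent par) r w → G.Reachable r w := by
      intro w hw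
      induction hw with
      | refl => exact SimpleGraph.Reachable.refl _
      | tail _ hc ih => exact ih.trans (htree _ _ hc).reachable
    refine ⟨r, ?_, hr, fun w hw => ?_⟩
    · rw [SimpleGraph.ConnectedComponent.mem_supp_iff, SimpleGraph.ConnectedComponent.eq]
      exact hreach v hrv
    · rw [SimpleGraph.ConnectedComponent.mem_supp_iff, SimpleGraph.ConnectedComponent.eq] at hw
      have key : ∀ {a b : Fin n}, G.Walk a b → IsAncestor (decodeParent par) r a →
          IsAncestor (decodeParent par) r b := by
        intro a b p
        induction p with
        | nil => exact id
        | cons hadj _ ih =>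
          intro ha
          refine ih ?_
          rcases hback _ _ hadj with hc | hc
          · exact ReflTransGen.trans ha hc
          · exact IsAncestor.root_eq hr ha hc
      obtain ⟨p⟩ := hw.symm
      exact key p hrv

end complete

/-! ## The inverse Ackermann function -/

theorem tarjanAck_two (i : ℕ) : tarjanAck i 2 = 4 := by
  induction i with
  | zero => simp [tarjanAck]
  | succ i ih => simpa [tarjanAck] using ih

/-- Since `A(i, 2) = 4` for all `i`, growth in `i` starts only at the argument `3`; this covers the
arguments `4⌈m/n⌉` of `invAck`. -/
theorem le_tarjanAck (i x : ℕ) : x + 3 + i + 1 ≤ tarjanAck i (x + 3) := by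
  induction i generalizing x with
  | zero => simp only [tarjanAck]; omega
  | succ i ih =>
    induction x with
    | zero =>
      have := ih 1
      have h3 : tarjanAck (i + 1) (0 + 3) = tarjanAck i (1 + 3) := by
        rw [tarjanAck, tarjanAck_two]
      omega
    | succ x ihx =>
      obtain ⟨z, hz⟩ : ∃ z, tarjanAck (i + 1) (x + 3) = z + 3 :=
        ⟨tarjanAck (i + 1) (x + 3) - 3, by omega⟩
      have := ih z
      have hrec : tarjanAck (i + 1) (x + 1 + 3) = tarjanAck i (tarjanAck (i + 1) (x + 3)) := by
        rw [tarjanAck]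
      rw [hrec, hz]
      omega

/-- The only property of the inverse Ackermann function that the time bounds need. The set must be
shown to be nonempty, because `sInf ∅ = 0`. -/
theorem one_le_invAck {m n : ℕ} (hm : 0 < m) (hn : 0 < n) : 1 ≤ invAck m n := by
  have hne : {i : ℕ | 1 ≤ i ∧
      Real.logb 2 n < (tarjanAck i (4 * ⌈(m : ℚ) / n⌉₊) : ℝ)}.Nonempty := by
    have hc : 0 < ⌈(m : ℚ) / n⌉₊ := Nat.ceil_pos.2 (by positivity)
    obtain ⟨N, hN⟩ := exists_nat_gt (Real.logb 2 n)
    obtain ⟨x, hx⟩ : ∃ x, 4 * ⌈(m : ℚ) / n⌉₊ = x + 3 := ⟨4 * ⌈(m : ℚ) / n⌉₊ - 3, by omega⟩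
    refine ⟨N + 1, by omega, ?_⟩
    rw [hx]
    refine hN.trans_le ?_
    have := le_tarjanAck (N + 1) x
    exact_mod_cast (by omega : N ≤ tarjanAck (N + 1) (x + 3))
  exact (Nat.sInf_mem hne).1

end Streaming

/-! ## The program

Registers: `0` and `1` hold the parameters `n` and `k`, `2` the number of edges kept, `3` whether a
vertex is missing in the forest, `4`, `5` and `6` are used for reading edges and as arguments, `9` is
the height of the stack, `13` the number of visited vertices.

Arrays: `0` parent codes, `1` levels, `2` and `3` codes and levels of the deepest neighbours in the
forest, `4` and `5` the ends of the half-edges, `6` and `7` linked lists of half-edges, `8` and `9`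
the stack, `10` codes of the roots, `11` parent codes and `12` levels in the search forest, `13` the
vertices in the order of their visits, `14` the sizes of the trees, `15` the numbers of edges kept
for each tree, `16` codes of deep vertices. -/

namespace Streaming

open Relation Finset Streaming.Expr Streaming.Cmd

theorem wp_assign (W Z x e r m l Q) : wp W Z (assign x e) r m l Q ↔
    e.ev r m ≤ W ∧ Q (Function.update r x (e.ev r m)) m l (e.size + 1) := Iff.rfl

theorem wp_store (W Z a i e r m l Q) : wp W Z (store a i e) r m l Q ↔
    i.ev r m < Z ∧ e.ev r m ≤ W ∧
      Q r (setCell m a (i.ev r m) (e.ev r m)) l (i.size + e.size + 1) := Iff.rfl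

theorem wp_skip (W Z r m l Q) : wp W Z skip r m l Q ↔ Q r m l 1 := Iff.rfl

theorem wp_seq_iff (W Z c d r m l) (Q : Post) : wp W Z (seq c d) r m l Q ↔
    wp W Z c r m l fun r' m' l' t =>
      wp W Z d r' m' l' fun r'' m'' l'' t' => Q r'' m'' l'' (t + t') := Iff.rfl

theorem wp_branch (W Z e c d r m l) (Q : Post) : wp W Z (branch e c d) r m l Q ↔
    (e.ev r m ≠ 0 → wp W Z c r m l fun r' m' l' t => Q r' m' l' (e.size + 1 + t)) ∧
    (e.ev r m = 0 → wp W Z d r m l fun r' m' l' t => Q r' m' l' (e.size + 1 + t)) := Iff.rfl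

attribute [simp] wp_assign wp_store wp_skip wp_seq_iff wp_branch Expr.ev Expr.size setCell_self
  setCell_of_ne

/-! ### Lists stored in arrays -/

/-- The largest `i < j` with `src i = x`, plus one, or `0`. -/
def last (src : ℕ → ℕ) (x : ℕ) : ℕ → ℕ
  | 0 => 0
  | j + 1 => if src j = x then j + 1 else last src x j

/-- The pairs `(c, dst i)` for all `i < j` with `src i = x`. -/
def adjl (src dst : ℕ → ℕ) (c x : ℕ) : ℕ → List (ℕ × ℕ)
  | 0 => []
  | j + 1 => if src j = x then adjl src dst c x j ++ [(c, dst j)] else adjl src dst c x j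

/-- The stack, from the top to the bottom. -/
def stkOf (sp sv : ℕ → ℕ) : ℕ → List (ℕ × ℕ)
  | 0 => []
  | t + 1 => (sp t, sv t) :: stkOf sp sv t

/-- The first entries of an array, the last one first. -/
def ordOf (o : ℕ → ℕ) : ℕ → List ℕ
  | 0 => []
  | t + 1 => o t :: ordOf o t

/-- The first entries of two arrays. -/
def pairsOf (f g : ℕ → ℕ) (c : ℕ) : List (ℕ × ℕ) := (List.range c).map fun i => (f i, g i)

theorem last_le (src : ℕ → ℕ) (x j : ℕ) : last src x j ≤ j := by
  induction j with
  | zero => simp [last]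
  | succ j ih => unfold last; split_ifs <;> omega

theorem src_of_last {src : ℕ → ℕ} {x j e : ℕ} (h : last src x j = e + 1) : src e = x := by
  induction j with
  | zero => simp [last] at h
  | succ j ih =>
    unfold last at h
    split_ifs at h with hc
    · obtain rfl : j = e := by omega
      exact hc
    · exact ih h

/-- A pointer `e + 1` to the element `e` doubles as the bound `i < e + 1`. By this lemma and
`adjl_last`, the rest of a linked list is a function of the current pointer alone, which is how the
loop of `push` is described. -/
theorem last_last (src : ℕ → ℕ) (x j : ℕ) : last src x (last src x j) = last src x j := by
  rcases h : last src x j with _ | e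
  · rfl
  · rw [last, if_pos (src_of_last h)]

theorem adjl_last (src dst : ℕ → ℕ) (c x j : ℕ) :
    adjl src dst c x (last src x j) = adjl src dst c x j := by
  induction j with
  | zero => rfl
  | succ j ih =>
    by_cases hc : src j = x
    · simp [last, hc]
    · simp [last, adjl, hc, ih]

theorem mem_adjl {src dst : ℕ → ℕ} {c x j : ℕ} {e : ℕ × ℕ} :
    e ∈ adjl src dst c x j ↔ ∃ i < j, src i = x ∧ e = (c, dst i) := by
  induction j with
  | zero => simp [adjl]
  | succ j ih =>
    have hsplit : (∃ i < j + 1, src i = x ∧ e = (c, dst i)) ↔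
        (∃ i < j, src i = x ∧ e = (c, dst i)) ∨ (src j = x ∧ e = (c, dst j)) := by
      constructor
      · rintro ⟨i, hi, h⟩
        rcases Nat.lt_succ_iff_lt_or_eq.1 hi with hi | rfl
        · exact .inl ⟨i, hi, h⟩
        · exact .inr h
      · rintro (⟨i, hi, h⟩ | h)
        · exact ⟨i, by omega, h⟩
        · exact ⟨j, by omega, h⟩
    rw [hsplit]
    by_cases hc : src j = x <;> simp [adjl, hc, ih]

theorem length_adjl (src dst : ℕ → ℕ) (c x j : ℕ) :
    (adjl src dst c x j).length = ((range j).filter fun i => src i = x).card := by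
  induction j with
  | zero => simp [adjl]
  | succ j ih =>
    rw [range_add_one, filter_insert]
    by_cases hc : src j = x <;> simp [adjl, hc, ih]

theorem stkOf_congr {sp sv sp' sv' : ℕ → ℕ} {t : ℕ} (h : ∀ j < t, sp' j = sp j ∧ sv' j = sv j) :
    stkOf sp' sv' t = stkOf sp sv t := by
  induction t with
  | zero => rfl
  | succ t ih =>
    rw [stkOf, stkOf, ih fun j hj => h j (by omega), (h t (by omega)).1, (h t (by omega)).2]

theorem ordOf_congr {o o' : ℕ → ℕ} {t : ℕ} (h : ∀ j < t, o' j = o j) : ordOf o' t = ordOf o t := by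
  induction t with
  | zero => rfl
  | succ t ih => rw [ordOf, ordOf, ih fun j hj => h j (by omega), h t (by omega)]

theorem length_ordOf (o : ℕ → ℕ) (t : ℕ) : (ordOf o t).length = t := by
  induction t with
  | zero => rfl
  | succ t ih => rw [ordOf, List.length_cons, ih]

theorem pairsOf_succ (f g : ℕ → ℕ) (c : ℕ) : pairsOf f g (c + 1) = pairsOf f g c ++ [(f c, g c)] := by
  simp [pairsOf, List.range_succ]

theorem pairsOf_congr {f g f' g' : ℕ → ℕ} {c : ℕ} (h : ∀ j < c, f' j = f j ∧ g' j = g j) :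
    pairsOf f' g' c = pairsOf f g c := by
  refine List.map_congr_left fun j hj => ?_
  rw [(h j (List.mem_range.1 hj)).1, (h j (List.mem_range.1 hj)).2]

theorem mem_pairsOf {f g : ℕ → ℕ} {c : ℕ} {e : ℕ × ℕ} :
    e ∈ pairsOf f g c ↔ ∃ j < c, f j = e.1 ∧ g j = e.2 := by
  simp [pairsOf, Prod.ext_iff]

theorem length_pairsOf (f g : ℕ → ℕ) (c : ℕ) : (pairsOf f g c).length = c := by simp [pairsOf]

/-! ### Half-edges -/

/-- The half-edges `h < H` lead from `src h` to `dst h`. There is one for each direction of every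
edge in `L`, and one from `n + ky v` to `v` for every vertex `v` that is to be searched. -/
structure Half (n : ℕ) (dpt ky : ℕ → ℕ) (L : List (ℕ × ℕ)) (src dst : ℕ → ℕ) (H : ℕ) : Prop where
  edge : ∀ h < H, src h < n → Und L (src h) (dst h)
  cover : ∀ u v, Und L u v → ∃ h < H, src h = u ∧ dst h = v
  seed : ∀ h < H, n ≤ src h → dst h < n ∧ dpt (dst h) = 0 ∧ src h = n + ky (dst h)
  seeds : ∀ w < n, dpt w = 0 → ∃ h < H, src h = n + ky w ∧ dst h = w

/-- Add the reversed edges. -/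
def mirror : Cmd :=
  seq (assign 7 (const 0)) <|
  loop (lt (var 7) (var 2)) <|
    seq (store 4 (plus (var 2) (var 7)) (load 5 (var 7))) <|
    seq (store 5 (plus (var 2) (var 7)) (load 4 (var 7))) <|
    assign 7 (plus (var 7) (const 1))

/-- Add the half-edges to the vertices that are to be searched. -/
def addSeeds : Cmd :=
  seq (assign 7 (const 0)) <|
  seq (assign 8 (plus (var 2) (var 2))) <|
  loop (lt (var 7) (var 0)) <|
    seq (branch (load 1 (var 7)) skip <|
      seq (store 4 (var 8) (plus (var 0) (load 3 (var 7)))) <|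
      seq (store 5 (var 8) (var 7)) <|
      assign 8 (plus (var 8) (const 1))) <|
    assign 7 (plus (var 7) (const 1))

theorem wp_mirror {M : ℕ} {r m l} (hM : 2 * r 2 ≤ M)
    (hv : ∀ j < r 2, m 4 j ≤ M ∧ m 5 j ≤ M) :
    wp M M mirror r m l fun _ m' _ t =>
      (∀ j < r 2, m' 4 j = m 4 j ∧ m' 5 j = m 5 j ∧ m' 4 (r 2 + j) = m 5 j ∧
        m' 5 (r 2 + j) = m 4 j) ∧ t ≤ 100 * (r 2 + 1) := by
  unfold mirror
  rw [wp_seq_iff, wp_assign]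
  refine ⟨by simp, ?_⟩
  refine wp_loop (fun r₁ m₁ _ => r₁ 7 ≤ r 2 ∧
    (∀ j < r 2, m₁ 4 j = m 4 j ∧ m₁ 5 j = m 5 j) ∧
    ∀ j < r₁ 7, m₁ 4 (r 2 + j) = m 5 j ∧ m₁ 5 (r 2 + j) = m 4 j)
    (fun r₁ _ _ => 40 * (r 2 - r₁ 7)) ?_ ?_ ?_
  · simp
  · rintro r₁ m₁ l₁ hf ⟨h₁, h₂, h₃⟩ hc
    have h0 : r₁ 2 = r 2 := by simpa using hf.reg 2 rfl
    simp [h0] at hc ⊢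
    -- The first store writes behind the `r 2` original entries and leaves intact the entry that the
    -- second one reads.
    have e₁ : Function.update (m₁ 4) (r 2 + r₁ 7) (m₁ 5 (r₁ 7)) (r₁ 7) = m₁ 4 (r₁ 7) := by
      rw [Function.update_of_ne (by omega)]
    have := h₂ _ hc
    have := hv _ hc
    rw [e₁]
    and_intros
    any_goals omega
    · grind
    · grind
  · rintro r₁ m₁ l₁ t hf ⟨h₁, h₂, h₃⟩ hc ht
    have h0 : r₁ 2 = r 2 := by simpa using hf.reg 2 rfl
    simp [h0] at hc ht ⊢
    exact ⟨by grind, by omega⟩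

theorem wp_addSeeds {M : ℕ} {r m l} (hM : 2 * r 2 + 2 * r 0 ≤ M) (hky : ∀ v, m 3 v ≤ r 0) :
    wp M M addSeeds r m l fun r' m' _ t =>
      (∀ j < 2 * r 2, m' 4 j = m 4 j ∧ m' 5 j = m 5 j) ∧
      2 * r 2 ≤ r' 8 ∧ r' 8 ≤ 2 * r 2 + r 0 ∧
      (∀ j < r' 8, 2 * r 2 ≤ j → m' 5 j < r 0 ∧ m 1 (m' 5 j) = 0 ∧ m' 4 j = r 0 + m 3 (m' 5 j)) ∧
      (∀ w < r 0, m 1 w = 0 → ∃ j < r' 8, 2 * r 2 ≤ j ∧ m' 4 j = r 0 + m 3 w ∧ m' 5 j = w) ∧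
      t ≤ 100 * (r 0 + 1) := by
  unfold addSeeds
  simp only [wp_seq_iff]
  simp only [wp_assign]
  refine ⟨by simp, by simp; omega, ?_⟩
  refine wp_loop (fun r₁ m₁ _ => r₁ 7 ≤ r 0 ∧
      (∀ j < 2 * r 2, m₁ 4 j = m 4 j ∧ m₁ 5 j = m 5 j) ∧
      2 * r 2 ≤ r₁ 8 ∧ r₁ 8 ≤ 2 * r 2 + r₁ 7 ∧
      (∀ j < r₁ 8, 2 * r 2 ≤ j → m₁ 5 j < r 0 ∧ m 1 (m₁ 5 j) = 0 ∧ m₁ 4 j = r 0 + m 3 (m₁ 5 j)) ∧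
      (∀ w < r₁ 7, m 1 w = 0 → ∃ j < r₁ 8, 2 * r 2 ≤ j ∧ m₁ 4 j = r 0 + m 3 w ∧ m₁ 5 j = w))
    (fun r₁ _ _ => 40 * (r 0 - r₁ 7)) ?_ ?_ ?_
  · simp
    refine ⟨by omega, by omega, fun j hj hj' => by omega⟩
  · rintro r₁ m₁ l₁ hf ⟨h₁, h₂, h₃, h₄, h₅, h₆⟩ hc
    have e0 : r₁ 0 = r 0 := by simpa using hf.reg 0 rfl
    have e1 : m₁ 1 = m 1 := by simpa using hf.mem 1 rfl
    have e3 : m₁ 3 = m 3 := by simpa using hf.mem 3 rfl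
    simp [e0] at hc
    have := hky (r₁ 7)
    simp [e0, e1, e3]
    refine ⟨fun hb => ?_, fun hb => ?_⟩ <;> and_intros
    any_goals omega
    · intro w hw hw'
      exact h₆ w (by grind) hw'
    · grind
    · grind
    · intro w hw hw'
      rcases Nat.lt_or_ge w (r₁ 7) with hlt | hge
      · obtain ⟨j, hj⟩ := h₆ w hlt hw'
        exact ⟨j, by grind⟩
      · obtain rfl : w = r₁ 7 := by omega
        exact ⟨r₁ 8, by grind⟩
  · rintro r₁ m₁ l₁ t hf ⟨h₁, h₂, h₃, h₄, h₅, h₆⟩ hc ht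
    have e0 : r₁ 0 = r 0 := by simpa using hf.reg 0 rfl
    simp [e0] at hc ht ⊢
    have e7 : r₁ 7 = r 0 := by omega
    rw [e7] at h₄ h₆
    exact ⟨h₂, h₃, h₄, h₅, h₆, by omega⟩

/-- Prepare the half-edges. -/
def halves : Cmd := seq mirror addSeeds

theorem wp_halves {M : ℕ} {r m l} (hM : 2 * r 2 + 2 * r 0 ≤ M) (hky : ∀ v, m 3 v ≤ r 0)
    (hL : ∀ u v, Und (pairsOf (m 4) (m 5) (r 2)) u v → u < r 0) :
    wp M M halves r m l fun r' m' _ t =>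
      Half (r 0) (m 1) (m 3) (pairsOf (m 4) (m 5) (r 2)) (m' 4) (m' 5) (r' 8) ∧
      pairsOf (m' 4) (m' 5) (r 2) = pairsOf (m 4) (m 5) (r 2) ∧
      r' 8 ≤ 2 * r 2 + r 0 ∧ t ≤ 100 * (r 2 + r 0 + 2) := by
  have hv : ∀ j < r 2, m 4 j < r 0 ∧ m 5 j < r 0 := fun j hj =>
    have hm : (m 4 j, m 5 j) ∈ pairsOf (m 4) (m 5) (r 2) := mem_pairsOf.2 ⟨j, hj, rfl, rfl⟩
    ⟨hL _ _ (.inl hm), hL _ _ (.inr hm)⟩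
  rw [halves, wp_seq_iff]
  refine wp_conseq (wp_mirror (by omega) fun j hj => by have := hv j hj; omega) ?_
  rintro r₁ m₁ l₁ t₁ hf ⟨h₁, ht₁⟩
  have e0 : r₁ 0 = r 0 := hf.reg 0 rfl
  have e2 : r₁ 2 = r 2 := hf.reg 2 rfl
  have e1 : m₁ 1 = m 1 := hf.mem 1 rfl
  have e3 : m₁ 3 = m 3 := hf.mem 3 rfl
  refine wp_conseq (wp_addSeeds (by omega) (by rwa [e0, e3])) ?_
  rintro r₂ m₂ l₂ t₂ - ⟨h₂, h₃, h₄, h₅, h₆, ht₂⟩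
  rw [e0, e2, e1, e3] at *
  have hlow : ∀ j < r 2, m₂ 4 j = m 4 j ∧ m₂ 5 j = m 5 j := fun j hj => by
    have := h₁ j hj
    have := h₂ j (by omega)
    omega
  have hhigh : ∀ j < r 2, m₂ 4 (r 2 + j) = m 5 j ∧ m₂ 5 (r 2 + j) = m 4 j := fun j hj => by
    have := h₁ j hj
    have := h₂ (r 2 + j) (by omega)
    omega
  refine ⟨⟨fun h hh hs => ?_, fun u v huv => ?_, fun h hh hs => ?_, fun w hw hd => ?_⟩,
    pairsOf_congr hlow, h₄, by omega⟩
  · rcases Nat.lt_or_ge h (r 2) with hlt | hge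
    · exact .inl (mem_pairsOf.2 ⟨h, hlt, by grind⟩)
    · rcases Nat.lt_or_ge h (2 * r 2) with hlt' | hge'
      · obtain ⟨j, rfl⟩ := Nat.exists_eq_add_of_le hge
        exact .inr (mem_pairsOf.2 ⟨j, by omega, by grind⟩)
      · have := h₅ h hh hge'
        omega
  · rcases huv with huv | huv
    · obtain ⟨j, hj, h⟩ := mem_pairsOf.1 huv
      exact ⟨j, by omega, by grind⟩
    · obtain ⟨j, hj, h⟩ := mem_pairsOf.1 huv
      exact ⟨r 2 + j, by omega, by grind⟩
  · refine h₅ h hh ?_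
    by_contra hlt
    rcases Nat.lt_or_ge h (r 2) with hlt' | hge
    · have := hv h hlt'
      have := hlow h hlt'
      omega
    · obtain ⟨j, rfl⟩ := Nat.exists_eq_add_of_le hge
      have := hv j (by omega)
      have := hhigh j (by omega)
      omega
  · obtain ⟨j, hj, -, h⟩ := h₆ w hw hd
    exact ⟨j, hj, h⟩

/-- Build the linked lists of half-edges. -/
def link : Cmd :=
  seq (assign 7 (const 0)) <|
  loop (lt (var 7) (var 8)) <|
    seq (store 6 (var 7) (load 7 (load 4 (var 7)))) <|
    seq (store 7 (load 4 (var 7)) (plus (var 7) (const 1))) <|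
    assign 7 (plus (var 7) (const 1))

/-- Array `7` holds the heads and array `6` the successors; half-edge `j` is put in front, so its
successor is the largest earlier index with the same source. There are `N` lists: in the application
`n` for the vertices and `n + 1` for the keys. -/
theorem wp_link {M N : ℕ} {r m l} (hM : r 8 ≤ M) (hN : N ≤ M) (h0 : ∀ x < N, m 7 x = 0)
    (hs : ∀ j < r 8, m 4 j < N) :
    wp M M link r m l fun _ m' _ t =>
      (∀ x < N, m' 7 x = last (m 4) x (r 8)) ∧ (∀ j < r 8, m' 6 j = last (m 4) (m 4 j) j) ∧
      t ≤ 100 * (r 8 + 1) := by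
  unfold link
  rw [wp_seq_iff, wp_assign]
  refine ⟨by simp, ?_⟩
  refine wp_loop (fun r₁ m₁ _ => r₁ 7 ≤ r 8 ∧ (∀ x < N, m₁ 7 x = last (m 4) x (r₁ 7)) ∧
      (∀ j < r₁ 7, m₁ 6 j = last (m 4) (m 4 j) j)) (fun r₁ _ _ => 40 * (r 8 - r₁ 7)) ?_ ?_ ?_
  · simpa [last] using h0
  · rintro r₁ m₁ l₁ hf ⟨h₁, h₂, h₃⟩ hc
    have e8 : r₁ 8 = r 8 := by simpa using hf.reg 8 rfl
    have e4 : m₁ 4 = m 4 := by simpa using hf.mem 4 rfl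
    simp [e8] at hc
    have hsc := hs _ hc
    have hle := last_le (m 4) (m 4 (r₁ 7)) (r₁ 7)
    simp [e4]
    rw [h₂ _ hsc]
    refine ⟨by omega, by omega, by omega, by omega, ⟨by omega, ?_, ?_⟩, by omega⟩
    · intro x hx
      rw [last, Function.update_apply]
      grind
    · grind
  · rintro r₁ m₁ l₁ t hf ⟨h₁, h₂, h₃⟩ hc ht
    have e8 : r₁ 8 = r 8 := by simpa using hf.reg 8 rfl
    simp [e8] at hc ht ⊢
    obtain e7 : r₁ 7 = r 8 := by omega
    rw [e7] at h₂ h₃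
    exact ⟨h₂, h₃, by omega⟩

/-- Push the targets of all half-edges from the vertex in register `4` on the stack, with the code in
register `5`. -/
def push : Cmd :=
  seq (assign 7 (load 7 (var 4))) <|
  loop (var 7) <|
    seq (assign 7 (minus (var 7) (const 1))) <|
    seq (store 8 (var 9) (var 5)) <|
    seq (store 9 (var 9) (load 5 (var 7))) <|
    seq (assign 9 (plus (var 9) (const 1))) <|
    assign 7 (load 6 (var 7))

/-- The part of the list not yet pushed, followed by the stack, stays the same list. The largest
index is pushed first, which is why `adjl` has it at the end. -/
theorem wp_push {M H : ℕ} {r m l} (hHM : H ≤ M) (h7 : m 7 (r 4) = last (m 4) (r 4) H)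
    (h6 : ∀ j < H, m 6 j = last (m 4) (m 4 j) j) (h5 : r 5 ≤ M) (hd : ∀ j < H, m 5 j ≤ M)
    (hM : r 9 + (adjl (m 4) (m 5) (r 5) (r 4) H).length ≤ M) :
    wp M M push r m l fun r' m' _ t =>
      stkOf (m' 8) (m' 9) (r' 9) =
        adjl (m 4) (m 5) (r 5) (r 4) H ++ stkOf (m 8) (m 9) (r 9) ∧
      r' 9 = r 9 + (adjl (m 4) (m 5) (r 5) (r 4) H).length ∧
      t ≤ 100 * ((adjl (m 4) (m 5) (r 5) (r 4) H).length + 1) := by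
  unfold push
  rw [wp_seq_iff, wp_assign]
  have hle := last_le (m 4) (r 4) H
  refine ⟨by simp [h7]; omega, ?_⟩
  refine wp_loop (fun r₁ m₁ _ => r₁ 7 ≤ H ∧ r₁ 7 = last (m 4) (r 4) (r₁ 7) ∧
      adjl (m 4) (m 5) (r 5) (r 4) (r₁ 7) ++ stkOf (m₁ 8) (m₁ 9) (r₁ 9) =
        adjl (m 4) (m 5) (r 5) (r 4) H ++ stkOf (m 8) (m 9) (r 9) ∧
      r₁ 9 + (adjl (m 4) (m 5) (r 5) (r 4) (r₁ 7)).length =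
        r 9 + (adjl (m 4) (m 5) (r 5) (r 4) H).length)
    (fun r₁ _ _ => 40 * (adjl (m 4) (m 5) (r 5) (r 4) (r₁ 7)).length) ?_ ?_ ?_
  · simp [h7, adjl_last, last_last, hle]
  · rintro r₁ m₁ l₁ hf ⟨h₁, h₂, h₃, h₄⟩ hc
    have e5 : r₁ 5 = r 5 := by simpa using hf.reg 5 rfl
    have e4 : m₁ 4 = m 4 := by simpa using hf.mem 4 rfl
    have e5' : m₁ 5 = m 5 := by simpa using hf.mem 5 rfl
    have e6 : m₁ 6 = m 6 := by simpa using hf.mem 6 rfl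
    obtain ⟨e, he⟩ : ∃ e, r₁ 7 = e + 1 := Nat.exists_eq_succ_of_ne_zero (by simpa using hc)
    have hse : m 4 e = r 4 := src_of_last (j := r₁ 7) (by rw [← h₂, he])
    have hadj : adjl (m 4) (m 5) (r 5) (r 4) (e + 1) =
        adjl (m 4) (m 5) (r 5) (r 4) e ++ [(r 5, m 5 e)] := by rw [adjl, if_pos hse]
    have hle' := last_le (m 4) (r 4) e
    have hde := hd e (by omega)
    simp [e5, e5', e6, he]
    rw [h6 e (by omega), hse, last_last, adjl_last]
    rw [he, hadj] at h₃ h₄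
    rw [hadj]
    simp only [List.length_append, List.length_singleton] at h₄ ⊢
    and_intros
    any_goals omega
    · trivial
    rw [stkOf, Function.update_self, Function.update_self, ← h₃,
      stkOf_congr (sp := m₁ 8) (sv := m₁ 9) fun j hj => by
        rw [Function.update_of_ne (by omega), Function.update_of_ne (by omega)]; simp]
    simp
  · rintro r₁ m₁ l₁ t hf ⟨h₁, h₂, h₃, h₄⟩ hc ht
    simp at hc
    rw [hc] at h₃ h₄
    simp [adjl_last, h7] at ht ⊢
    simp [adjl] at h₃ h₄
    refine ⟨h₃, h₄, by omega⟩

/-- Set the auxiliary arrays to zero. -/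
def clear : Cmd :=
  seq (assign 7 (const 0)) <|
  loop (lt (var 7) (plus (plus (var 0) (var 0)) (const 1))) <|
    seq (store 7 (var 7) (const 0)) <|
    seq (store 10 (var 7) (const 0)) <|
    seq (store 11 (var 7) (const 0)) <|
    seq (store 14 (var 7) (const 0)) <|
    seq (store 15 (var 7) (const 0)) <|
    seq (store 16 (var 7) (const 0)) <|
    assign 7 (plus (var 7) (const 1))

/-- `Search` speaks of all natural numbers while the loop reaches only finitely many cells; hence
the zeros beyond `n` are assumed here and maintained throughout the algorithm. -/
theorem wp_clear {M : ℕ} {r m l} (hM : 2 * r 0 + 1 ≤ M)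
    (hhi : ∀ v ≥ r 0, m 10 v = 0 ∧ m 11 v = 0 ∧ m 16 v = 0) :
    wp M M clear r m l fun _ m' _ t =>
      (∀ v, m' 10 v = 0 ∧ m' 11 v = 0 ∧ m' 16 v = 0) ∧
      (∀ v < 2 * r 0 + 1, m' 7 v = 0 ∧ m' 14 v = 0 ∧ m' 15 v = 0) ∧ t ≤ 100 * (r 0 + 1) := by
  unfold clear
  simp only [wp_seq_iff]
  simp only [wp_assign]
  refine ⟨by simp, ?_⟩
  refine wp_loop (fun r₁ m₁ _ => r₁ 7 ≤ 2 * r 0 + 1 ∧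
    (∀ v, v < r₁ 7 ∨ r 0 ≤ v → m₁ 10 v = 0 ∧ m₁ 11 v = 0 ∧ m₁ 16 v = 0) ∧
    (∀ v < r₁ 7, m₁ 7 v = 0 ∧ m₁ 14 v = 0 ∧ m₁ 15 v = 0))
    (fun r₁ _ _ => 40 * (2 * r 0 + 1 - r₁ 7)) ?_ ?_ ?_
  · simpa using hhi
  · intro r₁ m₁ l₁ hf hI hc
    have h0 : r₁ 0 = r 0 := by simpa using hf.reg 0 rfl
    simp [h0] at hc ⊢
    refine ⟨by omega, ⟨by omega, ?_, ?_⟩, by omega⟩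
    · grind
    · grind
  · intro r₁ m₁ l₁ t hf hI hc ht
    have h0 : r₁ 0 = r 0 := by simpa using hf.reg 0 rfl
    simp [h0] at hc ht ⊢
    refine ⟨?_, ?_, by omega⟩
    · grind
    · grind
end Streaming

/-! ## The search -/

namespace Streaming

open Relation Finset Streaming.Expr Streaming.Cmd

theorem card_filter_split {s : Finset ℕ} {p q q' : ℕ → Prop} [DecidablePred p] [DecidablePred q]
    [DecidablePred q'] (h : ∀ x, p x ↔ q x ∨ q' x) (hd : ∀ x, q x → ¬ q' x) :
    (s.filter p).card = (s.filter q).card + (s.filter q').card := by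
  rw [← card_union_of_disjoint (disjoint_filter.2 fun x _ => hd x), ← filter_or]
  congr 1
  exact filter_congr fun x _ => h x

theorem Half.dst_lt {n H : ℕ} {dpt ky src dst : ℕ → ℕ} {L : List (ℕ × ℕ)}
    (h : Half n dpt ky L src dst H) (hL : ∀ u v, Und L u v → u < n) {j : ℕ} (hj : j < H) :
    dst j < n := by
  rcases Nat.lt_or_ge (src j) n with hs | hs
  · exact hL _ _ (h.edge j hj hs).symm
  · exact (h.seed j hj hs).1

theorem Half.src_lt {n H : ℕ} {dpt ky src dst : ℕ → ℕ} {L : List (ℕ × ℕ)}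
    (h : Half n dpt ky L src dst H) (hky : ∀ v, ky v ≤ n) {j : ℕ} (hj : j < H) :
    src j < 2 * n + 1 := by
  rcases Nat.lt_or_ge (src j) n with hs | hs
  · omega
  · have := (h.seed j hj hs).2.2
    have := hky (dst j)
    omega

/-- Initialize the stack with the vertices to be searched, in the order of their keys. -/
def pushSeeds : Cmd :=
  seq (assign 9 (const 0)) <|
  seq (assign 12 (const 0)) <|
  loop (lt (var 12) (plus (var 0) (const 1))) <|
    seq (assign 4 (plus (var 0) (var 12))) <|
    seq (assign 5 (const 0)) <|
    seq push <|
    assign 12 (plus (var 12) (const 1))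

/-- A bucket sort: the vertices of key `d` are the targets of the half-edges from `n + d`, and the
buckets are pushed by increasing `d`, so that large keys end on top. The stack height is bounded
together with the number of half-edges still to be pushed by the search. -/
theorem wp_pushSeeds {M : ℕ} {r m l} {L : List (ℕ × ℕ)} (hM : r 8 ≤ M) (hM' : 2 * r 0 + 1 ≤ M)
    (hhalf : Half (r 0) (m 1) (m 3) L (m 4) (m 5) (r 8)) (hL : ∀ u v, Und L u v → u < r 0)
    (hky : ∀ v, m 3 v ≤ r 0) (h7 : ∀ x < 2 * r 0 + 1, m 7 x = last (m 4) x (r 8))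
    (h6 : ∀ j < r 8, m 6 j = last (m 4) (m 4 j) j) :
    wp M M pushSeeds r m l fun r' m' _ t =>
      (∀ e ∈ stkOf (m' 8) (m' 9) (r' 9), e.1 = 0 ∧ e.2 < r 0 ∧ m 1 e.2 = 0) ∧
      (∀ w < r 0, m 1 w = 0 → (0, w) ∈ stkOf (m' 8) (m' 9) (r' 9)) ∧
      (stkOf (m' 8) (m' 9) (r' 9)).Pairwise (fun e e' => m 3 e'.2 ≤ m 3 e.2) ∧
      r' 9 + ((range (r 8)).filter fun h => m 4 h < r 0).card ≤ r 8 ∧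
      t ≤ 400 * (r 0 + r 8 + 2) := by
  have hcount : ∀ d, ((range (r 8)).filter fun h => r 0 ≤ m 4 h ∧ m 4 h < r 0 + d).card +
      ((range (r 8)).filter fun h => m 4 h < r 0).card ≤ r 8 := by
    intro d
    rw [← card_filter_split (p := fun h => (r 0 ≤ m 4 h ∧ m 4 h < r 0 + d) ∨ m 4 h < r 0)
      (fun _ => Iff.rfl) (fun x hx hx' => by omega)]
    exact (card_filter_le _ _).trans (by simp)
  unfold pushSeeds
  simp only [wp_seq_iff]
  simp only [wp_assign]
  refine ⟨by simp, by simp, ?_⟩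
  refine wp_loop (fun r₁ m₁ _ => r₁ 12 ≤ r 0 + 1 ∧
      (∀ e ∈ stkOf (m₁ 8) (m₁ 9) (r₁ 9),
        e.1 = 0 ∧ (e.2 < r 0 ∧ m 1 e.2 = 0) ∧ m 3 e.2 < r₁ 12) ∧
      (∀ w < r 0, m 1 w = 0 → m 3 w < r₁ 12 → (0, w) ∈ stkOf (m₁ 8) (m₁ 9) (r₁ 9)) ∧
      (stkOf (m₁ 8) (m₁ 9) (r₁ 9)).Pairwise (fun e e' => m 3 e'.2 ≤ m 3 e.2) ∧
      r₁ 9 = ((range (r 8)).filter fun h => r 0 ≤ m 4 h ∧ m 4 h < r 0 + r₁ 12).card)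
    (fun r₁ _ _ => 200 * (r 0 + 1 - r₁ 12) + 200 * (r 8 - r₁ 9)) ?_ ?_ ?_
  · refine ⟨by simp, by simp [stkOf], by simp, by simp [stkOf], ?_⟩
    simp
    symm
    rw [card_eq_zero, filter_eq_empty_iff]
    intro x _
    omega
  · rintro r₁ m₁ l₁ hf ⟨h₁, h₂, h₃, h₄, h₅⟩ hc
    have e0 : r₁ 0 = r 0 := by simpa using hf.reg 0 rfl
    have e4 : m₁ 4 = m 4 := by simpa using hf.mem 4 rfl
    have e5 : m₁ 5 = m 5 := by simpa using hf.mem 5 rfl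
    have e6 : m₁ 6 = m 6 := by simpa using hf.mem 6 rfl
    have e7 : m₁ 7 = m 7 := by simpa using hf.mem 7 rfl
    simp [e0] at hc
    have hlen := length_adjl (m 4) (m 5) 0 (r 0 + r₁ 12) (r 8)
    have hsplit : ((range (r 8)).filter fun h => r 0 ≤ m 4 h ∧ m 4 h < r 0 + (r₁ 12 + 1)).card =
        ((range (r 8)).filter fun h => r 0 ≤ m 4 h ∧ m 4 h < r 0 + r₁ 12).card +
        ((range (r 8)).filter fun h => m 4 h = r 0 + r₁ 12).card :=
      card_filter_split (fun x => by omega) (fun x hx hx' => by omega)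
    have hb := hcount (r₁ 12 + 1)
    simp [e0]
    refine ⟨by omega, ?_⟩
    refine wp_conseq (wp_push (H := r 8) hM ?_ ?_ ?_ ?_ ?_) ?_
    · simp [e4, e7]
      exact h7 _ (by omega)
    · rw [e4, e6]; exact h6
    · simp
    · intro j hj
      have := hhalf.dst_lt hL hj
      rw [e5]
      omega
    · simp [e4, e5]
      omega
    · rintro r₂ m₂ l₂ t₂ hf₂ ⟨p₁, p₂, p₃⟩
      have e12 : r₂ 12 = r₁ 12 := by simpa using hf₂.reg 12 rfl
      simp [e4, e5] at p₁ p₂ p₃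
      simp [e12]
      rw [p₁]
      have hnew : ∀ e ∈ adjl (m 4) (m 5) 0 (r 0 + r₁ 12) (r 8),
          e.1 = 0 ∧ (e.2 < r 0 ∧ m 1 e.2 = 0) ∧ m 3 e.2 = r₁ 12 := by
        intro e he
        obtain ⟨i, hi, hs, rfl⟩ := mem_adjl.1 he
        have := hhalf.seed i hi (by omega)
        exact ⟨rfl, ⟨this.1, this.2.1⟩, by simp only; omega⟩
      refine ⟨by omega, ⟨hc, ?_, ?_, ?_, by omega⟩, by omega⟩
      · intro a b hab
        rcases List.mem_append.1 hab with hab | hab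
        · have := hnew _ hab
          exact ⟨this.1, this.2.1, by have := this.2.2; simp only at this; omega⟩
        · have := h₂ _ hab
          exact ⟨this.1, this.2.1, by have := this.2.2; simp only at this; omega⟩
      · intro w hw hw' hk
        rcases Nat.lt_or_ge (m 3 w) (r₁ 12) with hlt | hge
        · exact List.mem_append_right _ (h₃ w hw hw' hlt)
        · obtain ⟨h, hh, hs, hd⟩ := hhalf.seeds w hw hw'
          exact List.mem_append_left _ (mem_adjl.2 ⟨h, hh, by omega, by rw [hd]⟩)
      · refine List.pairwise_append.2 ⟨?_, h₄, fun a ha b hb => ?_⟩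
        · refine List.pairwise_of_forall_mem_list fun a ha b hb => ?_
          rw [(hnew a ha).2.2, (hnew b hb).2.2]
        · have := (hnew a ha).2.2
          have := (h₂ b hb).2.2
          omega
  · rintro r₁ m₁ l₁ t hf ⟨h₁, h₂, h₃, h₄, h₅⟩ hc ht
    have e0 : r₁ 0 = r 0 := by simpa using hf.reg 0 rfl
    simp [e0] at hc ht ⊢
    have hb := hcount (r₁ 12)
    refine ⟨fun a b hab => ?_, fun w hw hw' => h₃ w hw hw' ?_, h₄, by omega, by omega⟩
    · exact ⟨(h₂ _ hab).1, (h₂ _ hab).2.1⟩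
    · have := hky w
      omega

/-- Record the root and the level of a vertex. -/
def mark : Cmd :=
  branch (var 11)
    (seq (store 10 (var 10) (load 10 (minus (var 11) (const 1)))) <|
      store 12 (var 10) (plus (load 12 (minus (var 11) (const 1))) (const 1)))
    (seq (store 10 (var 10) (plus (var 10) (const 1))) <|
      store 12 (var 10) (plus (load 3 (var 10)) (const 1)))

/-- Remember the vertex if its relative level is at least `k`. -/
def deepen : Cmd :=
  branch (lt (load 12 (var 10)) (plus (load 12 (var 15)) (var 1))) skip <|
    store 16 (var 15) (plus (var 10) (const 1))

/-- Visit the vertex in register `10`. -/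
def visit : Cmd :=
  seq (store 11 (var 10) (var 11)) <|
  seq mark <|
  seq (assign 15 (minus (load 10 (var 10)) (const 1))) <|
  seq (store 14 (var 15) (plus (load 14 (var 15)) (const 1))) <|
  seq (store 13 (var 13) (var 10)) <|
  seq (assign 13 (plus (var 13) (const 1))) <|
  seq deepen <|
  seq (assign 4 (var 10)) <|
  seq (assign 5 (plus (var 10) (const 1))) <|
  push

/-- The search. -/
def run : Cmd :=
  seq (assign 13 (const 0)) <|
  loop (var 9) <|
    seq (assign 9 (minus (var 9) (const 1))) <|
    seq (assign 10 (load 9 (var 9))) <|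
    seq (assign 11 (load 8 (var 9))) <|
    branch (load 10 (var 10)) skip visit

theorem wp_mark {M : ℕ} {r m l} (hM : r 10 + 1 ≤ M) (h₁ : r 11 ≠ 0 → m 10 (r 11 - 1) ≤ M)
    (h₂ : r 11 ≠ 0 → m 12 (r 11 - 1) + 1 ≤ M) (h₃ : m 3 (r 10) + 1 ≤ M) :
    wp M M mark r m l fun r' m' _ t => r' = r ∧
      m' = setCell (setCell m 10 (r 10) (if r 11 = 0 then r 10 + 1 else m 10 (r 11 - 1))) 12 (r 10)
        (if r 11 = 0 then m 3 (r 10) + 1 else m 12 (r 11 - 1) + 1) ∧ t ≤ 30 := by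
  unfold mark
  simp
  constructor
  · intro hr
    have := h₁ hr
    have := h₂ hr
    simp [hr]
    omega
  · intro hr
    simp [hr]
    omega

theorem wp_deepen {M : ℕ} {r m l} (hM : r 10 + 1 ≤ M) (hM' : r 15 + 1 ≤ M) :
    wp M M deepen r m l fun r' m' _ t => r' = r ∧
      m' 16 = (if m 12 (r 15) + r 1 ≤ m 12 (r 10) then Function.update (m 16) (r 15) (r 10 + 1)
        else m 16) ∧ t ≤ 30 := by
  unfold deepen
  rw [wp_branch]
  constructor
  · intro h
    have h' : m 12 (r 10) < m 12 (r 15) + r 1 := by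
      by_contra hc
      simp [hc] at h
    simp
    omega
  · intro h
    have h' : ¬ m 12 (r 10) < m 12 (r 15) + r 1 := by
      intro hc
      simp [hc] at h
    rw [if_pos (by omega)]
    simp
    omega

/-- Only the tree `q` of `x` can change its entry. The test reads the level of `q` from `ad'` and
not from `ad`, since `x` may itself be the new root `q`. -/
theorem Deepest.visit {n k q x a : ℕ} {dpt ky fp root ad deep root' ad' deep' : ℕ → ℕ}
    {L : List (ℕ × ℕ)} {ord : List ℕ} {stk : List (ℕ × ℕ)} (h : Deepest k root ad ord deep)
    (hS : Search n dpt ky L fp root ad ord stk) (hx : root x = 0)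
    (hroot : root' = Function.update root x (q + 1)) (had : ad' = Function.update ad x a)
    (hdeep : deep' = if ad' q + k ≤ a then Function.update deep q (x + 1) else deep) :
    Deepest k root' ad' (x :: ord) deep' := by
  have hne : ∀ v ∈ ord, v ≠ x := fun v hv hvx => (hS.visited v).2 hv (hvx ▸ hx)
  have hord : ∀ y ∈ ord, root' y = root y ∧ ad' y = ad y := fun y hy => by
    simp [hroot, had, hne y hy]
  have hx' : root' x = q + 1 ∧ ad' x = a := by simp [hroot, had]
  have hrt : ∀ y ∈ ord, ∃ r ∈ ord, root y = r + 1 := fun y hy => by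
    obtain ⟨r, hr, hro, -⟩ := hS.exists_root hy
    exact ⟨r, hro, hr⟩
  constructor
  · intro r y hy
    by_cases hnew : ad' q + k ≤ a ∧ r = q
    · obtain ⟨hc, rfl⟩ := hnew
      rw [if_pos hc] at hdeep
      obtain rfl : x = y := by simpa [hdeep] using hy
      exact ⟨by simp, hx'.1, by rw [hx'.2]; exact hc⟩
    · have hold : deep r = y + 1 := by
        rw [← hy, hdeep]
        split_ifs with hc
        · rw [Function.update_of_ne fun hr => hnew ⟨hc, hr⟩]
        · rfl
      obtain ⟨h₁, h₂, h₃⟩ := h.code r y hold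
      obtain ⟨r', hr', hr⟩ := hrt y h₁
      obtain rfl : r = r' := by omega
      exact ⟨by simp [h₁], by rw [(hord y h₁).1, h₂], by rw [(hord y h₁).2, (hord r hr').2]; exact h₃⟩
  · intro y hy h0
    rw [List.mem_cons] at hy
    rcases hy with rfl | hy
    · rw [hx'.1] at h0 ⊢
      rw [hx'.2]
      by_contra hlt
      rw [hdeep, if_pos (by simpa using hlt)] at h0
      simp at h0
    · obtain ⟨r, hr, hry⟩ := hrt y hy
      rw [(hord y hy).1, hry] at h0 ⊢
      rw [(hord y hy).2]
      simp only [Nat.add_sub_cancel] at h0 ⊢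
      rw [(hord r hr).2]
      have := h.zero y hy
      rw [hry] at this
      refine this ?_
      simp only [Nat.add_sub_cancel]
      rw [hdeep] at h0
      split_ifs at h0 with hc
      · by_cases hrq : r = q
        · simp [hrq] at h0
        · rwa [Function.update_of_ne hrq] at h0
      · exact h0

/-- The invariant of the search, as far as it is about memory. -/
structure RunInv (n k : ℕ) (L : List (ℕ × ℕ)) (dpt ky src : ℕ → ℕ) (H : ℕ) (m : ℕ → ℕ → ℕ)
    (i top : ℕ) (stk : List (ℕ × ℕ)) : Prop where
  search : Search n dpt ky L (m 11) (m 10) (m 12) (ordOf (m 13) i) stk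
  deep : Deepest k (m 10) (m 12) (ordOf (m 13) i) (m 16)
  size : ∀ q < n, m 14 q = ((range n).filter fun v => m 10 v = q + 1).card
  level : ∀ v ∈ ordOf (m 13) i, m 12 v ≤ n + i
  stack : top + ((range H).filter fun h => src h < n ∧ m 10 (src h) = 0).card ≤ H

theorem RunInv.count_lt {n k H i top x : ℕ} {L : List (ℕ × ℕ)} {dpt ky src : ℕ → ℕ}
    {m : ℕ → ℕ → ℕ} {stk : List (ℕ × ℕ)} (h : RunInv n k L dpt ky src H m i top stk) (hx : x < n)
    (hx' : m 10 x = 0) : i < n := by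
  have hnd : (x :: ordOf (m 13) i).Nodup := List.nodup_cons.2
    ⟨fun hm => (h.search.visited x).2 hm hx', h.search.closed.nodup⟩
  have hsub : (x :: ordOf (m 13) i).toFinset ⊆ range n := by
    intro v hv
    rw [List.mem_toFinset, List.mem_cons] at hv
    rcases hv with rfl | hv
    · exact mem_range.2 hx
    · exact mem_range.2 (h.search.free v hv).1
  have := card_le_card hsub
  rw [List.toFinset_card_of_nodup hnd, List.length_cons, length_ordOf, card_range] at this
  omega

/-- Here `d` is the number of half-edges leaving the vertex. They pass from the half-edges with
unvisited source to the stack, so the sum bounded in `RunInv.stack` does not grow. -/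
theorem wp_visit {M : ℕ} {r m l} {L : List (ℕ × ℕ)} (hM : r 8 ≤ M) (hM' : 2 * r 0 + 2 ≤ M)
    (hhalf : Half (r 0) (m 1) (m 3) L (m 4) (m 5) (r 8))
    (hL : ∀ u v, Und L u v → u < r 0 ∧ m 1 u = 0)
    (hky : ∀ v, m 3 v ≤ r 0) (h7 : ∀ x < 2 * r 0 + 1, m 7 x = last (m 4) x (r 8))
    (h6 : ∀ j < r 8, m 6 j = last (m 4) (m 4 j) j)
    (hinv : RunInv (r 0) (r 1) L (m 1) (m 3) (m 4) (r 8) m (r 13) (r 9)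
      ((r 11, r 10) :: stkOf (m 8) (m 9) (r 9))) (hx : m 10 (r 10) = 0) :
    wp M M visit r m l fun r' m' _ t =>
      RunInv (r 0) (r 1) L (m 1) (m 3) (m 4) (r 8) m' (r' 13) (r' 9) (stkOf (m' 8) (m' 9) (r' 9)) ∧
      r 13 < r 0 ∧ r' 13 = r 13 + 1 ∧ ∃ d, r' 9 = r 9 + d ∧
      ((range (r 8)).filter fun h => m 4 h < r 0 ∧ m 10 (m 4 h) = 0).card =
        ((range (r 8)).filter fun h => m 4 h < r 0 ∧ m' 10 (m 4 h) = 0).card + d ∧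
      t ≤ 400 + 100 * d := by
  have hxs := hinv.search.stk_free (r 11, r 10) (by simp)
  simp only at hxs
  have hin := hinv.count_lt hxs.1 hx
  have hxo : r 10 ∉ ordOf (m 13) (r 13) := fun hm => (hinv.search.visited _).2 hm hx
  have hkx := hky (r 10)
  have hpar : r 11 ≠ 0 → r 11 - 1 ∈ ordOf (m 13) (r 13) := fun hp =>
    (hinv.search.stk_child (r 11 - 1) (r 10) (by
      rw [Nat.sub_add_cancel (by omega)]; exact List.mem_cons_self)).1
  obtain ⟨q, hq, hqn⟩ : ∃ q, (if r 11 = 0 then r 10 + 1 else m 10 (r 11 - 1)) = q + 1 ∧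
      q < r 0 := by
    split_ifs with hp
    · exact ⟨_, rfl, hxs.1⟩
    · obtain ⟨q, hq, hqo, -⟩ := hinv.search.exists_root (hpar hp)
      exact ⟨q, hq, (hinv.search.free q hqo).1⟩
  have hal : (if r 11 = 0 then m 3 (r 10) + 1 else m 12 (r 11 - 1) + 1) ≤ r 0 + r 13 + 1 := by
    split_ifs with hp
    · omega
    · have := hinv.level _ (hpar hp)
      omega
  -- The abstract visit is prepared here, before the memory changes; `new` will be the list that
  -- `push` turns out to have pushed.
  have hS' : ∀ new : List (ℕ × ℕ), (∀ e ∈ new, e.1 = r 10 + 1 ∧ Und L (r 10) e.2) →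
      (∀ w, Und L (r 10) w → (r 10 + 1, w) ∈ new) → _ := fun new h₁ h₂ =>
    hinv.search.visit (fp' := Function.update (m 11) (r 10) (r 11))
      (root' := Function.update (m 10) (r 10) (q + 1))
      (ad' := Function.update (m 12) (r 10)
        (if r 11 = 0 then m 3 (r 10) + 1 else m 12 (r 11 - 1) + 1))
      hL hx rfl (by rw [hq]) rfl h₁ h₂
  generalize ha : (if r 11 = 0 then m 3 (r 10) + 1 else m 12 (r 11 - 1) + 1) = a at hal hS'
  have hcard := (card_le_card (filter_subset (fun v => m 10 v = q + 1) (range (r 0))))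
  rw [card_range] at hcard
  have hdq := hinv.size q hqn
  unfold visit
  simp
  have hpn : r 11 ≠ 0 → r 11 - 1 < r 0 ∧ m 10 (r 11 - 1) = q + 1 ∧ m 12 (r 11 - 1) + 1 = a :=
    fun hp => ⟨(hinv.search.free _ (hpar hp)).1, by rw [← hq, if_neg hp], by rw [← ha, if_neg hp]⟩
  refine ⟨by omega, by omega, ?_⟩
  refine wp_conseq (wp_mark (by simp; omega) (by simp; omega) (by simp; omega) (by simp; omega)) ?_
  rintro r₁ m₁ l₁ t₁ - ⟨rfl, rfl, ht₁⟩
  simp [ha, hq]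
  refine ⟨by omega, by omega, by omega, by omega, by omega, by omega, ?_⟩
  refine wp_conseq (wp_deepen (by simp; omega) (by simp; omega)) ?_
  rintro r₂ m₂ l₂ t₂ hf₂ ⟨rfl, h16, ht₂⟩
  have e4 := hf₂.mem 4 rfl
  have e5 := hf₂.mem 5 rfl
  have e6 := hf₂.mem 6 rfl
  have e7 := hf₂.mem 7 rfl
  have e8 := hf₂.mem 8 rfl
  have e9 := hf₂.mem 9 rfl
  have e10 := hf₂.mem 10 rfl
  have e11 := hf₂.mem 11 rfl
  have e12 := hf₂.mem 12 rfl
  have e13 := hf₂.mem 13 rfl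
  have e14 := hf₂.mem 14 rfl
  simp at e4 e5 e6 e7 e8 e9 e10 e11 e12 e13 e14 h16
  simp
  refine ⟨by omega, by omega, ?_⟩
  have hlen := length_adjl (m 4) (m 5) (r₁ 10 + 1) (r₁ 10) (r₁ 8)
  have hsplit : ((range (r₁ 8)).filter fun h => m 4 h < r₁ 0 ∧ m 10 (m 4 h) = 0).card =
      ((range (r₁ 8)).filter fun h => m 4 h < r₁ 0 ∧ m₂ 10 (m 4 h) = 0).card +
      ((range (r₁ 8)).filter fun h => m 4 h = r₁ 10).card := by
    refine card_filter_split (fun x => ?_) (fun x hx hx' => ?_)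
    · rw [e10]
      by_cases hxx : m 4 x = r₁ 10
      · simp [hxx, hxs.1, hx]
      · simp [hxx]
    · rw [e10, hx'] at hx
      simp at hx
  have hstk := hinv.stack
  refine wp_conseq (wp_push (H := r₁ 8) hM ?_ ?_ ?_ ?_ ?_) ?_
  · simp [e4, e7]
    exact h7 _ (by omega)
  · simp [e4, e6]
    exact h6
  · simp
    omega
  · intro j hj
    have := hhalf.dst_lt (fun u v h => (hL u v h).1) hj
    simp [e5]
    omega
  · simp [e4, e5]
    omega
  · rintro r₃ m₃ l₃ t₃ hf₃ ⟨p₁, p₂, p₃⟩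
    have f10 := hf₃.mem 10 rfl
    have f11 := hf₃.mem 11 rfl
    have f12 := hf₃.mem 12 rfl
    have f13 := hf₃.mem 13 rfl
    have f14 := hf₃.mem 14 rfl
    have f16 := hf₃.mem 16 rfl
    have g13 := hf₃.reg 13 rfl
    simp [e4, e5, e8, e9] at p₁ p₂ p₃ g13
    have hord : ordOf (m₃ 13) (r₁ 13 + 1) = r₁ 10 :: ordOf (m 13) (r₁ 13) := by
      rw [ordOf, f13, e13, Function.update_self, ordOf_congr fun j hj => by
        rw [Function.update_of_ne (by omega)]]
    refine ⟨?_, hin, g13, _, p₂, by rw [f10, hlen]; exact hsplit, by omega⟩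
    rw [g13, p₁]
    refine ⟨?_, ?_, fun p hp => ?_, fun v hv => ?_, ?_⟩
    · rw [f11, e11, f10, e10, f12, e12, hord]
      refine hS' _ (fun e he => ?_) (fun w hw => ?_)
      · obtain ⟨i, hi, hs, rfl⟩ := mem_adjl.1 he
        refine ⟨rfl, ?_⟩
        rw [← hs]
        exact hhalf.edge i hi (by omega)
      · obtain ⟨h, hh, hs, hd⟩ := hhalf.cover _ _ hw
        exact mem_adjl.2 ⟨h, hh, hs, by rw [hd]⟩
    · rw [hord]
      refine hinv.deep.visit hinv.search hx (q := q) (a := a) (by rw [f10, e10])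
        (by rw [f12, e12]) ?_
      rw [f16, h16, f12, e12]
    · rw [f14, e14, f10, e10]
      have hc : ((range (r₁ 0)).filter fun v =>
          Function.update (m 10) (r₁ 10) (q + 1) v = p + 1).card =
          ((range (r₁ 0)).filter fun v => m 10 v = p + 1).card +
          ((range (r₁ 0)).filter fun v => v = r₁ 10 ∧ p = q).card := by
        refine card_filter_split (fun v => ?_) (fun v hv hv' => ?_)
        · by_cases hv : v = r₁ 10
          · subst hv
            simp [hx, eq_comm]
          · simp [hv]
        · rw [hv'.1, hx] at hv
          omega
      rw [hc]
      by_cases hpq : p = q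
      · have : ((range (r₁ 0)).filter fun v => v = r₁ 10 ∧ p = q) = {r₁ 10} := by
          ext v
          simp only [mem_filter, mem_range, mem_singleton, hpq, and_true]
          exact ⟨fun h => h.2, fun h => ⟨h ▸ hxs.1, h⟩⟩
        rw [this, hpq]
        simp [hdq]
      · rw [Function.update_of_ne hpq, hinv.size p hp]
        simp [hpq]
    · rw [hord] at hv
      rw [f12, e12]
      rcases List.mem_cons.1 hv with rfl | hv
      · simpa [add_assoc] using hal
      · have := hinv.level v hv
        have hne : v ≠ r₁ 10 := fun h => hxo (h ▸ hv)
        rw [Function.update_of_ne hne]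
        omega
    · rw [p₂, f10]
      omega

set_option maxHeartbeats 1000000 in
theorem wp_run {M : ℕ} {r m l} {L : List (ℕ × ℕ)} (hM : r 8 ≤ M) (hM' : 2 * r 0 + 2 ≤ M)
    (hhalf : Half (r 0) (m 1) (m 3) L (m 4) (m 5) (r 8))
    (hL : ∀ u v, Und L u v → u < r 0 ∧ m 1 u = 0)
    (hky : ∀ v, m 3 v ≤ r 0) (h7 : ∀ x < 2 * r 0 + 1, m 7 x = last (m 4) x (r 8))
    (h6 : ∀ j < r 8, m 6 j = last (m 4) (m 4 j) j)
    (hzero : ∀ v, m 10 v = 0 ∧ m 11 v = 0 ∧ m 16 v = 0) (hsize : ∀ v < r 0, m 14 v = 0)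
    (hstk : ∀ e ∈ stkOf (m 8) (m 9) (r 9), e.1 = 0 ∧ e.2 < r 0 ∧ m 1 e.2 = 0)
    (hseed : ∀ w < r 0, m 1 w = 0 → (0, w) ∈ stkOf (m 8) (m 9) (r 9))
    (hkey : (stkOf (m 8) (m 9) (r 9)).Pairwise fun e e' => m 3 e'.2 ≤ m 3 e.2)
    (htop : r 9 + ((range (r 8)).filter fun h => m 4 h < r 0).card ≤ r 8) :
    wp M M run r m l fun r' m' _ t =>
      RunInv (r 0) (r 1) L (m 1) (m 3) (m 4) (r 8) m' (r' 13) 0 [] ∧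
      t ≤ 1000 * (r 0 + r 8 + 2) := by
  unfold run
  rw [wp_seq_iff, wp_assign]
  refine ⟨by simp, ?_⟩
  refine wp_loop (fun r₁ m₁ _ => r₁ 13 ≤ r 0 ∧
      RunInv (r 0) (r 1) L (m 1) (m 3) (m 4) (r 8) m₁ (r₁ 13) (r₁ 9) (stkOf (m₁ 8) (m₁ 9) (r₁ 9)))
    -- A half-edge pays `200`: `100` when it is pushed and `100` left on the stack for its removal.
    -- The `600` per unvisited vertex covers the rest of a visit.
    (fun r₁ m₁ _ => 100 * r₁ 9 +
      200 * ((range (r 8)).filter fun h => m 4 h < r 0 ∧ m₁ 10 (m 4 h) = 0).card +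
      600 * (r 0 - r₁ 13)) ?_ ?_ ?_
  · simp
    refine ⟨?_, ?_, fun q hq => ?_, ?_, ?_⟩
    · exact Search.init (fun v => (hzero v).2.1) (fun v => (hzero v).1) hstk hseed hkey
    · exact ⟨fun q y hy => by rw [(hzero q).2.2] at hy; omega, by simp [ordOf]⟩
    · rw [hsize q hq]
      symm
      rw [card_eq_zero, filter_eq_empty_iff]
      intro v _
      rw [(hzero v).1]
      omega
    · simp [ordOf]
    · simpa [fun v => (hzero v).1] using htop
  · rintro r₁ m₁ l₁ hf ⟨hi, hinv⟩ hc
    have e0 : r₁ 0 = r 0 := by simpa using hf.reg 0 rfl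
    have e1 : r₁ 1 = r 1 := by simpa using hf.reg 1 rfl
    have e8 : r₁ 8 = r 8 := by simpa using hf.reg 8 rfl
    have f1 : m₁ 1 = m 1 := by simpa using hf.mem 1 rfl
    have f3 : m₁ 3 = m 3 := by simpa using hf.mem 3 rfl
    have f4 : m₁ 4 = m 4 := by simpa using hf.mem 4 rfl
    have f5 : m₁ 5 = m 5 := by simpa using hf.mem 5 rfl
    have f6 : m₁ 6 = m 6 := by simpa using hf.mem 6 rfl
    have f7 : m₁ 7 = m 7 := by simpa using hf.mem 7 rfl
    obtain ⟨p, hp⟩ : ∃ p, r₁ 9 = p + 1 := Nat.exists_eq_succ_of_ne_zero (by simpa using hc)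
    rw [hp, stkOf] at hinv
    have hx := hinv.search.stk_free _ List.mem_cons_self
    have hstack := hinv.stack
    have hcode : m₁ 8 p ≤ r 0 := by
      rcases hq : m₁ 8 p with _ | q
      · omega
      · have := hinv.search.free q (hinv.search.stk_child q (m₁ 9 p) (by rw [← hq]; simp)).1
        omega
    simp only at hx
    rw [wp_seq_iff, wp_assign, wp_seq_iff, wp_assign, wp_seq_iff, wp_assign]
    simp only [Expr.ev, hp]
    refine ⟨by omega, by simp; omega, by simp; omega, ?_⟩
    rw [wp_branch]
    refine ⟨fun hb => ?_, fun hb => ?_⟩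
    · simp at hb ⊢
      exact ⟨⟨hi, hinv.search.pop hb, hinv.deep, hinv.size, hinv.level, by omega⟩, by omega⟩
    · simp at hb
      refine wp_conseq (wp_visit (L := L) ?_ ?_ ?_ ?_ ?_ ?_ ?_ ?_ ?_) ?_
      · simp [e8, hM]
      · simp [e0, hM']
      · simpa [e0, f1, f3, f4, f5, e8] using hhalf
      · simpa [e0, f1] using hL
      · simpa [e0, f3] using hky
      · simpa [e0, f7, f4, e8] using h7
      · simpa [f6, f4, e8] using h6
      · simp [e0, e1, e8, f1, f3, f4]
        exact ⟨hinv.search, hinv.deep, hinv.size, hinv.level, by omega⟩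
      · simpa using hb
      · rintro r₂ m₂ l₂ t₂ hf₂ ⟨hinv₂, hlt, h13, d, h9, hcard, ht⟩
        simp [e0, e1, e8, f1, f3, f4] at hinv₂ hlt h13 h9 hcard
        simp
        exact ⟨⟨by omega, hinv₂⟩, by omega⟩
  · rintro r₁ m₁ l₁ t hf ⟨hi, hinv⟩ hc ht
    simp at hc ht ⊢
    rw [hc, stkOf] at hinv
    refine ⟨hinv, ?_⟩
    have : ((range (r 8)).filter fun h => m 4 h < r 0 ∧ m 10 (m 4 h) = 0).card ≤ r 8 :=
      (card_filter_le _ _).trans (by simp)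
    omega

end Streaming

/-! ### The complete search of the kept edges -/

namespace Streaming

open Relation Finset Streaming.Expr Streaming.Cmd

/-- Depth-first search of the graph formed by the edges that have been kept. -/
def dfs : Cmd := seq clear <| seq halves <| seq link <| seq pushSeeds run

/-- The arrays contain the result of a search. -/
structure Searched (n k : ℕ) (L : List (ℕ × ℕ)) (dpt ky : ℕ → ℕ) (m : ℕ → ℕ → ℕ) (i : ℕ) :
    Prop where
  search : Search n dpt ky L (m 11) (m 10) (m 12) (ordOf (m 13) i) []
  deep : Deepest k (m 10) (m 12) (ordOf (m 13) i) (m 16)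
  size : ∀ q < n, m 14 q = ((range n).filter fun v => m 10 v = q + 1).card
  level : ∀ v ∈ ordOf (m 13) i, m 12 v ≤ 2 * n
  zero : ∀ v ≥ n, m 10 v = 0 ∧ m 11 v = 0 ∧ m 16 v = 0

theorem Search.length_le {n : ℕ} {dpt ky fp root ad : ℕ → ℕ} {L stk : List (ℕ × ℕ)} {ord : List ℕ}
    (h : Search n dpt ky L fp root ad ord stk) : ord.length ≤ n := by
  rw [← List.toFinset_card_of_nodup h.closed.nodup]
  refine (card_le_card (t := range n) fun v hv => ?_).trans (by simp)
  exact mem_range.2 (h.free v (List.mem_toFinset.1 hv)).1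

theorem RunInv.searched {n k H i : ℕ} {L : List (ℕ × ℕ)} {dpt ky src : ℕ → ℕ} {m : ℕ → ℕ → ℕ}
    (h : RunInv n k L dpt ky src H m i 0 []) : Searched n k L dpt ky m i where
  search := h.search
  deep := h.deep
  size := h.size
  level v hv := by
    have := h.search.length_le
    rw [length_ordOf] at this
    have := h.level v hv
    omega
  zero v hv := by
    have hout : v ∉ ordOf (m 13) i := fun hm => by
      have := (h.search.free v hm).1
      omega
    refine ⟨?_, h.search.fp_zero v hout, ?_⟩
    · by_contra hr
      exact hout ((h.search.visited v).1 hr)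
    · rcases hd : m 16 v with _ | y
      · rfl
      · obtain ⟨hy, hr, -⟩ := h.deep.code v y hd
        obtain ⟨q, hq, hqo, -⟩ := h.search.exists_root hy
        obtain rfl : v = q := by omega
        exact absurd hqo hout

theorem wp_dfs {M : ℕ} {r m l} (hM : 2 * r 2 + 2 * r 0 + 2 ≤ M) (hky : ∀ v, m 3 v ≤ r 0)
    (hL : ∀ u v, Und (pairsOf (m 4) (m 5) (r 2)) u v → u < r 0 ∧ m 1 u = 0)
    (hz : ∀ v ≥ r 0, m 10 v = 0 ∧ m 11 v = 0 ∧ m 16 v = 0) :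
    wp M M dfs r m l fun r' m' _ t =>
      Searched (r 0) (r 1) (pairsOf (m 4) (m 5) (r 2)) (m 1) (m 3) m' (r' 13) ∧
      pairsOf (m' 4) (m' 5) (r 2) = pairsOf (m 4) (m 5) (r 2) ∧
      (∀ q < r 0, m' 15 q = 0) ∧ t ≤ 4000 * (r 2 + r 0 + 2) := by
  unfold dfs
  rw [wp_seq_iff]
  refine wp_conseq (wp_clear (by omega) hz) ?_
  rintro r₁ m₁ l₁ t₁ hf₁ ⟨z₁, z₁', ht₁⟩
  have a0 : r₁ 0 = r 0 := hf₁.reg 0 rfl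
  have a1 : r₁ 1 = r 1 := hf₁.reg 1 rfl
  have a2 : r₁ 2 = r 2 := hf₁.reg 2 rfl
  have b1 : m₁ 1 = m 1 := hf₁.mem 1 rfl
  have b3 : m₁ 3 = m 3 := hf₁.mem 3 rfl
  have b4 : m₁ 4 = m 4 := hf₁.mem 4 rfl
  have b5 : m₁ 5 = m 5 := hf₁.mem 5 rfl
  rw [wp_seq_iff]
  refine wp_conseq (wp_halves (by omega) (by rwa [b3, a0])
    (by rw [b4, b5, a2, a0]; exact fun u v h => (hL u v h).1)) ?_
  rintro r₂ m₂ l₂ t₂ hf₂ ⟨hhalf, hpairs, h8, ht₂⟩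
  rw [b1, b3, b4, b5, a0, a2] at hhalf
  rw [b4, b5, a2] at hpairs
  rw [a0, a2] at h8 ht₂
  have c0 : r₂ 0 = r 0 := (hf₂.reg 0 rfl).trans a0
  have c1 : r₂ 1 = r 1 := (hf₂.reg 1 rfl).trans a1
  have d1 : m₂ 1 = m 1 := (hf₂.mem 1 rfl).trans b1
  have d3 : m₂ 3 = m 3 := (hf₂.mem 3 rfl).trans b3
  have d7 : m₂ 7 = m₁ 7 := hf₂.mem 7 rfl
  have d10 : m₂ 10 = m₁ 10 := hf₂.mem 10 rfl
  have d11 : m₂ 11 = m₁ 11 := hf₂.mem 11 rfl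
  have d14 : m₂ 14 = m₁ 14 := hf₂.mem 14 rfl
  have d15 : m₂ 15 = m₁ 15 := hf₂.mem 15 rfl
  have d16 : m₂ 16 = m₁ 16 := hf₂.mem 16 rfl
  rw [wp_seq_iff]
  refine wp_conseq (wp_link (N := 2 * r 0 + 1) (by omega) (by omega)
    (fun x hx => by rw [d7]; exact (z₁' x hx).1) fun j hj => hhalf.src_lt hky hj) ?_
  rintro r₃ m₃ l₃ t₃ hf₃ ⟨h7, h6, ht₃⟩
  have e0 : r₃ 0 = r 0 := (hf₃.reg 0 rfl).trans c0
  have e1 : r₃ 1 = r 1 := (hf₃.reg 1 rfl).trans c1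
  have e8 : r₃ 8 = r₂ 8 := hf₃.reg 8 rfl
  have f1 : m₃ 1 = m 1 := (hf₃.mem 1 rfl).trans d1
  have f3 : m₃ 3 = m 3 := (hf₃.mem 3 rfl).trans d3
  have f4 : m₃ 4 = m₂ 4 := hf₃.mem 4 rfl
  have f5 : m₃ 5 = m₂ 5 := hf₃.mem 5 rfl
  rw [wp_seq_iff]
  refine wp_conseq (wp_pushSeeds (L := pairsOf (m 4) (m 5) (r 2)) (by omega) (by omega)
    (by rwa [e0, f1, f3, f4, f5, e8]) (by rw [e0]; exact fun u v h => (hL u v h).1)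
    (by rwa [e0, f3]) (by rwa [e0, f4, e8]) (by rwa [f4, e8])) ?_
  rintro r₄ m₄ l₄ t₄ hf₄ ⟨s₁, s₂, s₃, s₄, ht₄⟩
  rw [e0, f1] at s₁ s₂
  rw [f3] at s₃
  rw [f4, e8, e0] at s₄
  rw [e0, e8] at ht₄
  have g0 : r₄ 0 = r 0 := (hf₄.reg 0 rfl).trans e0
  have g1 : r₄ 1 = r 1 := (hf₄.reg 1 rfl).trans e1
  have g8 : r₄ 8 = r₂ 8 := (hf₄.reg 8 rfl).trans e8
  have k1 : m₄ 1 = m 1 := (hf₄.mem 1 rfl).trans f1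
  have k3 : m₄ 3 = m 3 := (hf₄.mem 3 rfl).trans f3
  have k4 : m₄ 4 = m₂ 4 := (hf₄.mem 4 rfl).trans f4
  have k5 : m₄ 5 = m₂ 5 := (hf₄.mem 5 rfl).trans f5
  have k6 : m₄ 6 = m₃ 6 := hf₄.mem 6 rfl
  have k7 : m₄ 7 = m₃ 7 := hf₄.mem 7 rfl
  have k10 : m₄ 10 = m₁ 10 := ((hf₄.mem 10 rfl).trans (hf₃.mem 10 rfl)).trans d10
  have k11 : m₄ 11 = m₁ 11 := ((hf₄.mem 11 rfl).trans (hf₃.mem 11 rfl)).trans d11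
  have k14 : m₄ 14 = m₁ 14 := ((hf₄.mem 14 rfl).trans (hf₃.mem 14 rfl)).trans d14
  have k15 : m₄ 15 = m₁ 15 := ((hf₄.mem 15 rfl).trans (hf₃.mem 15 rfl)).trans d15
  have k16 : m₄ 16 = m₁ 16 := ((hf₄.mem 16 rfl).trans (hf₃.mem 16 rfl)).trans d16
  refine wp_conseq (wp_run (L := pairsOf (m 4) (m 5) (r 2)) (by omega) (by omega)
    (by rwa [g0, k1, k3, k4, k5, g8]) (by rwa [g0, k1]) (by rwa [g0, k3])
    (by rwa [g0, k7, k4, g8]) (by rwa [k6, k4, g8]) (by rwa [k10, k11, k16])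
    (by rw [g0, k14]; exact fun v hv => (z₁' v (by omega)).2.1) (by rwa [g0, k1])
    (by rwa [g0, k1]) (by rwa [k3]) (by rwa [g8, k4, g0])) ?_
  rintro r₅ m₅ l₅ t₅ hf₅ ⟨hrun, ht₅⟩
  rw [g0, g1, k1, k3] at hrun
  rw [g0, g8] at ht₅
  refine ⟨hrun.searched, ?_, fun q hq => ?_, by rw [a0] at *; omega⟩
  · rw [show m₅ 4 = m₂ 4 from (hf₅.mem 4 rfl).trans k4,
      show m₅ 5 = m₂ 5 from (hf₅.mem 5 rfl).trans k5, hpairs]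
  · rw [show m₅ 15 = m₁ 15 from (hf₅.mem 15 rfl).trans k15]
    exact (z₁' q (by omega)).2.2

end Streaming

/-! ## Forgetting edges -/

namespace Streaming

open Relation Finset Streaming.Expr Streaming.Cmd

/-- Every edge of `A` that is missing in the sublist `K` is no tree edge, and belongs to a tree for
which many edges are in `K`; the number of the other edges of `K` that belong to the tree with root
`q` is `ct q`. -/
structure Pruned (n k : ℕ) (fp root sz ct : ℕ → ℕ) (A K : List (ℕ × ℕ)) : Prop where
  sub : K.Sublist A
  tree : ∀ e ∈ A, fp e.1 = e.2 + 1 ∨ fp e.2 = e.1 + 1 → e ∈ K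
  drop : ∀ e ∈ A, e ∉ K → k * sz (root e.1 - 1) ≤ ct (root e.1 - 1)
  count : ∀ q, ct q ≤ (K.filter fun f => decide (root f.1 = q + 1)).length
  card : K.length = (K.filter fun e => decide (fp e.1 = e.2 + 1 ∨ fp e.2 = e.1 + 1)).length +
    ∑ q ∈ range n, ct q
  bound : ∀ q < n, ct q ≤ k * sz q

namespace Pruned

variable {n k : ℕ} {fp root sz ct : ℕ → ℕ} {A K : List (ℕ × ℕ)} {e : ℕ × ℕ}

theorem keepTree (h : Pruned n k fp root sz ct A K) (he : fp e.1 = e.2 + 1 ∨ fp e.2 = e.1 + 1) :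
    Pruned n k fp root sz ct (A ++ [e]) (K ++ [e]) where
  sub := h.sub.append (List.Sublist.refl _)
  tree f hf ht := by
    rcases List.mem_append.1 hf with hf | hf
    · exact List.mem_append_left _ (h.tree f hf ht)
    · exact List.mem_append_right _ hf
  drop f hf hn := by
    rw [List.mem_append, not_or] at hn
    exact h.drop f ((List.mem_append.1 hf).resolve_right hn.2) hn.1
  count q := (h.count q).trans (by simp)
  card := by
    rw [List.length_append, List.filter_append, List.length_append, h.card]
    simp [he]
    omega
  bound := h.bound

theorem keepOther (h : Pruned n k fp root sz ct A K) {q : ℕ} (hq : root e.1 = q + 1) (hqn : q < n)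
    (he : ¬ (fp e.1 = e.2 + 1 ∨ fp e.2 = e.1 + 1)) (hlt : ct q < k * sz q) :
    Pruned n k fp root sz (Function.update ct q (ct q + 1)) (A ++ [e]) (K ++ [e]) where
  sub := h.sub.append (List.Sublist.refl _)
  tree f hf ht := by
    rcases List.mem_append.1 hf with hf | hf
    · exact List.mem_append_left _ (h.tree f hf ht)
    · exact List.mem_append_right _ hf
  drop f hf hn := by
    rw [List.mem_append, not_or] at hn
    have := h.drop f ((List.mem_append.1 hf).resolve_right hn.2) hn.1
    grind
  count p := by
    have := h.count p
    rw [List.filter_append, List.length_append]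
    by_cases hp : p = q
    · subst hp
      simpa [hq] using this
    · rw [Function.update_of_ne hp]
      omega
  card := by
    rw [List.length_append, List.filter_append, List.length_append, h.card,
      sum_update_of_mem (mem_range.2 hqn),
      sum_eq_add_sum_sdiff_singleton_of_mem (mem_range.2 hqn) ct]
    simp [he]
    omega
  bound p hp := by
    have := h.bound p hp
    grind

theorem dropOther (h : Pruned n k fp root sz ct A K) {q : ℕ} (hq : root e.1 = q + 1)
    (he : ¬ (fp e.1 = e.2 + 1 ∨ fp e.2 = e.1 + 1)) (hle : k * sz q ≤ ct q) :
    Pruned n k fp root sz ct (A ++ [e]) K where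
  sub := h.sub.trans (List.sublist_append_left _ _)
  tree f hf ht := by
    rcases List.mem_append.1 hf with hf | hf
    · exact h.tree f hf ht
    · rw [List.mem_singleton.1 hf] at ht
      exact absurd ht he
  drop f hf hn := by
    rcases List.mem_append.1 hf with hf | hf
    · exact h.drop f hf hn
    · rw [List.mem_singleton.1 hf, hq]
      exact hle
  count := h.count
  card := h.card
  bound := h.bound

/-- A list of distinct edges contains at most `n` tree edges. -/
theorem length_tree_le (hK : Distinct K) (hn : ∀ e ∈ K, e.1 < n ∧ e.2 < n) :
    (K.filter fun e => decide (fp e.1 = e.2 + 1 ∨ fp e.2 = e.1 + 1)).length ≤ n := by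
  have hK' := hK.sublist (List.filter_sublist
    (p := fun e => decide (fp e.1 = e.2 + 1 ∨ fp e.2 = e.1 + 1)))
  rw [← List.toFinset_card_of_nodup hK'.nodup]
  have hlow : ∀ e ∈ (K.filter fun e => decide (fp e.1 = e.2 + 1 ∨ fp e.2 = e.1 + 1)),
      ∃ x y, x < n ∧ fp x = y + 1 ∧ (if fp e.1 = e.2 + 1 then e.1 else e.2) = x ∧
        (e = (x, y) ∨ e = (y, x)) := by
    intro e he
    rw [List.mem_filter] at he
    have := hn e he.1
    by_cases h : fp e.1 = e.2 + 1
    · exact ⟨e.1, e.2, this.1, h, by simp [h], .inl rfl⟩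
    · have h' : fp e.2 = e.1 + 1 := by simpa [h] using he.2
      exact ⟨e.2, e.1, this.2, h', by simp [h], .inr rfl⟩
  -- A tree edge is determined by its child end, up to orientation.
  refine (card_le_card_of_injOn (t := range n) (fun e => if fp e.1 = e.2 + 1 then e.1 else e.2)
    (fun e he => ?_) fun e he f hf hef => ?_).trans (by simp)
  · obtain ⟨x, y, hx, -, hxe, -⟩ := hlow e (by simpa using he)
    simp only [hxe, coe_range, Set.mem_Iio, hx]
  · have he' := List.mem_toFinset.1 he
    have hf' := List.mem_toFinset.1 hf
    obtain ⟨x, y, -, hy, hxe, hor⟩ := hlow e he'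
    obtain ⟨x', y', -, hy', hxf, hor'⟩ := hlow f hf'
    simp only [hxe, hxf] at hef
    subst hef
    obtain rfl : y = y' := by omega
    rcases hor with rfl | rfl <;> rcases hor' with rfl | rfl
    · rfl
    · exact hK'.eq_of_swap he' hf' rfl
    · exact hK'.eq_of_swap he' hf' rfl
    · rfl

/-- At most `n` tree edges remain, and at most `k` times its size of other edges for each tree; the
trees are disjoint, so their sizes add up to at most `n`. -/
theorem length_le (h : Pruned n k fp root sz ct A K) (hK : Distinct K)
    (hn : ∀ e ∈ K, e.1 < n ∧ e.2 < n)
    (hsz : ∀ q < n, sz q = ((range n).filter fun v => root v = q + 1).card) :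
    K.length ≤ n * k + n := by
  have h₁ := length_tree_le (fp := fp) hK hn
  have h₂ : ∑ q ∈ range n, ct q ≤ n * k := by
    have h₃ : ∑ q ∈ range n, sz q ≤ n := by
      rw [sum_congr rfl fun q hq => hsz q (mem_range.1 hq), ← card_biUnion]
      · refine (card_le_card (t := range n) fun v hv => ?_).trans (by simp)
        obtain ⟨q, -, hq⟩ := mem_biUnion.1 hv
        exact (mem_filter.1 hq).1
      · intro a _ b _ hab
        refine disjoint_filter.2 fun v _ ha hb => hab ?_
        omega
    calc ∑ q ∈ range n, ct q ≤ ∑ q ∈ range n, k * sz q :=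
          sum_le_sum fun q hq => h.bound q (mem_range.1 hq)
      _ = k * ∑ q ∈ range n, sz q := (mul_sum _ _ _).symm
      _ ≤ k * n := Nat.mul_le_mul_left _ h₃
      _ = n * k := Nat.mul_comm _ _
  have := h.card
  omega

end Pruned

/-- Decide whether the edge number `h`, where `h` is in register `7`, is to be kept. -/
def testEdge : Cmd :=
  seq (assign 4 (load 4 (var 7))) <|
  seq (assign 5 (load 5 (var 7))) <|
  seq (assign 16 (plus (eq (load 11 (var 4)) (plus (var 5) (const 1)))
    (eq (load 11 (var 5)) (plus (var 4) (const 1))))) <|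
  seq (assign 15 (minus (load 10 (var 4)) (const 1))) <|
  branch (var 16) skip <|
    branch (lt (load 15 (var 15)) (times (var 1) (load 14 (var 15))))
      (seq (store 15 (var 15) (plus (load 15 (var 15)) (const 1))) (assign 16 (const 1)))
      skip

theorem wp_testEdge {M q : ℕ} {r m l} (h4 : m 4 (r 7) ≤ M) (h5 : m 5 (r 7) ≤ M) (hM : 2 ≤ M)
    (hq : m 10 (m 4 (r 7)) = q + 1) (hqM : q + 1 ≤ M) (hs : r 1 * m 14 q ≤ M) :
    wp M M testEdge r m l fun r' m' _ t => r' 4 = m 4 (r 7) ∧ r' 5 = m 5 (r 7) ∧ t ≤ 80 ∧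
      ((r' 16 ≠ 0 ∧ m' 15 = m 15 ∧
          (m 11 (m 4 (r 7)) = m 5 (r 7) + 1 ∨ m 11 (m 5 (r 7)) = m 4 (r 7) + 1)) ∨
        (r' 16 ≠ 0 ∧ m' 15 = Function.update (m 15) q (m 15 q + 1) ∧ m 15 q < r 1 * m 14 q ∧
          ¬ (m 11 (m 4 (r 7)) = m 5 (r 7) + 1 ∨ m 11 (m 5 (r 7)) = m 4 (r 7) + 1)) ∨
        (r' 16 = 0 ∧ m' 15 = m 15 ∧ r 1 * m 14 q ≤ m 15 q ∧
          ¬ (m 11 (m 4 (r 7)) = m 5 (r 7) + 1 ∨ m 11 (m 5 (r 7)) = m 4 (r 7) + 1))) := by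
  unfold testEdge
  by_cases ht : m 11 (m 4 (r 7)) = m 5 (r 7) + 1 <;>
    by_cases ht' : m 11 (m 5 (r 7)) = m 4 (r 7) + 1 <;>
      by_cases hlt : m 15 q < r 1 * m 14 q <;>
        simp [hq, ht, ht', hlt] <;> omega

/-- Forget edges that are dispensable. -/
def prune : Cmd :=
  seq (assign 7 (const 0)) <|
  seq (assign 14 (const 0)) <|
  seq (loop (lt (var 7) (var 2)) <|
    seq testEdge <|
    seq (branch (var 16)
      (seq (store 4 (var 14) (var 4)) <|
        seq (store 5 (var 14) (var 5)) <|
        assign 14 (plus (var 14) (const 1)))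
      skip) <|
    assign 7 (plus (var 7) (const 1))) <|
  assign 2 (var 14)

theorem wp_prune {M : ℕ} {r m l} (hM : r 2 ≤ M) (hM' : r 0 ≤ M) (hM2 : 2 ≤ M)
    (hL : ∀ e ∈ pairsOf (m 4) (m 5) (r 2), (e.1 < r 0 ∧ e.2 < r 0) ∧
      ∃ q < r 0, m 10 e.1 = q + 1) (hs : ∀ q < r 0, r 1 * m 14 q ≤ M)
    (hz : ∀ q < r 0, m 15 q = 0) :
    wp M M prune r m l fun r' m' _ t =>
      (∃ ct, Pruned (r 0) (r 1) (m 11) (m 10) (m 14) ct (pairsOf (m 4) (m 5) (r 2))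
        (pairsOf (m' 4) (m' 5) (r' 2))) ∧ t ≤ 200 * (r 2 + 1) := by
  unfold prune
  simp only [wp_seq_iff]
  simp only [wp_assign]
  refine ⟨by simp, by simp, ?_⟩
  -- The list is compacted in place: the write position `r₁ 14` never overtakes the read position
  -- `r₁ 7`, so unread edges are intact.
  refine wp_loop (fun r₁ m₁ _ => (r₁ 14 ≤ r₁ 7 ∧ r₁ 7 ≤ r 2) ∧
    (∀ j, r₁ 7 ≤ j → m₁ 4 j = m 4 j ∧ m₁ 5 j = m 5 j) ∧
    ∃ ct, (∀ q < r 0, m₁ 15 q = ct q) ∧ Pruned (r 0) (r 1) (m 11) (m 10) (m 14) ct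
      (pairsOf (m 4) (m 5) (r₁ 7)) (pairsOf (m₁ 4) (m₁ 5) (r₁ 14)))
    (fun r₁ _ _ => 150 * (r 2 - r₁ 7)) ?_ ?_ ?_
  · refine ⟨by simp, by simp, fun _ => 0, hz, ?_⟩
    constructor <;> simp [pairsOf]
  · rintro r₁ m₁ l₁ hf ⟨⟨h₁, h₂⟩, h₃, ct, h₄, h₅⟩ hc
    have e0 : r₁ 0 = r 0 := by simpa using hf.reg 0 rfl
    have e1 : r₁ 1 = r 1 := by simpa using hf.reg 1 rfl
    have e2 : r₁ 2 = r 2 := by simpa using hf.reg 2 rfl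
    have f10 : m₁ 10 = m 10 := by simpa using hf.mem 10 rfl
    have f11 : m₁ 11 = m 11 := by simpa using hf.mem 11 rfl
    have f14 : m₁ 14 = m 14 := by simpa using hf.mem 14 rfl
    simp [e2] at hc
    have h₃' := h₃ (r₁ 7) le_rfl
    obtain ⟨⟨hu, hv⟩, q, hqn, hq⟩ := hL (m 4 (r₁ 7), m 5 (r₁ 7)) (mem_pairsOf.2 ⟨_, hc, rfl, rfl⟩)
    simp only at hu hv hq
    have hsq := hs q hqn
    rw [wp_seq_iff]
    refine wp_conseq (wp_testEdge (q := q) (by omega) (by omega) hM2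
      (by rw [h₃'.1, f10, hq]) (by omega) (by rwa [e1, f14])) ?_
    rintro r₂ m₂ l₂ t₂ hf₂ ⟨p₁, p₂, ht₂, p₃⟩
    have g2 : r₂ 2 = r 2 := (hf₂.reg 2 rfl).trans e2
    have g7 : r₂ 7 = r₁ 7 := hf₂.reg 7 rfl
    have g14 : r₂ 14 = r₁ 14 := hf₂.reg 14 rfl
    have k4 : m₂ 4 = m₁ 4 := hf₂.mem 4 rfl
    have k5 : m₂ 5 = m₁ 5 := hf₂.mem 5 rfl
    rw [h₃'.1] at p₁
    rw [h₃'.2] at p₂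
    rw [h₃'.1, h₃'.2, f11, f14, e1] at p₃
    have hkeep : ∀ ct', Pruned (r 0) (r 1) (m 11) (m 10) (m 14) ct'
        (pairsOf (m 4) (m 5) (r₁ 7) ++ [(m 4 (r₁ 7), m 5 (r₁ 7))])
        (pairsOf (m₁ 4) (m₁ 5) (r₁ 14) ++ [(m 4 (r₁ 7), m 5 (r₁ 7))]) →
        Pruned (r 0) (r 1) (m 11) (m 10) (m 14) ct' (pairsOf (m 4) (m 5) (r₁ 7 + 1))
          (pairsOf (Function.update (m₁ 4) (r₁ 14) (m 4 (r₁ 7)))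
            (Function.update (m₁ 5) (r₁ 14) (m 5 (r₁ 7))) (r₁ 14 + 1)) := by
      intro ct' h
      rw [pairsOf_succ, pairsOf_succ, Function.update_self, Function.update_self]
      rwa [pairsOf_congr (f' := Function.update (m₁ 4) (r₁ 14) (m 4 (r₁ 7))) fun j hj => by
        rw [Function.update_of_ne (by omega), Function.update_of_ne (by omega)]
        exact ⟨rfl, rfl⟩]
    simp [g7, g14, k4, k5, p₁, p₂]
    refine ⟨fun hb => ?_, fun hb => ?_⟩
    · refine ⟨by omega, by omega, by omega, by omega, by omega, by omega, ⟨by omega, ?_, ?_⟩,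
        by omega⟩
      · intro j hj
        rw [Function.update_of_ne (by omega), Function.update_of_ne (by omega)]
        exact h₃ j (by omega)
      · rcases p₃ with ⟨-, q₁, q₂⟩ | ⟨-, q₁, q₂, q₃⟩ | ⟨q₀, -⟩
        · exact ⟨ct, by rwa [q₁], hkeep _ (h₅.keepTree q₂)⟩
        · refine ⟨_, ?_, hkeep _ (h₅.keepOther hq hqn q₃ (by rwa [← h₄ q hqn]))⟩
          rw [q₁]
          grind
        · exact absurd q₀ hb
    · refine ⟨by omega, ⟨by omega, fun j hj => h₃ j (by omega), ?_⟩, by omega⟩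
      rcases p₃ with ⟨q₀, -⟩ | ⟨q₀, -⟩ | ⟨-, q₁, q₂, q₃⟩
      · exact absurd hb q₀
      · exact absurd hb q₀
      · refine ⟨ct, by rwa [q₁], ?_⟩
        rw [pairsOf_succ]
        exact h₅.dropOther hq q₃ (by rwa [← h₄ q hqn])
  · rintro r₁ m₁ l₁ t hf ⟨⟨h₁, h₂⟩, h₃, ct, h₄, h₅⟩ hc ht
    have e2 : r₁ 2 = r 2 := by simpa using hf.reg 2 rfl
    simp [e2] at hc ht ⊢
    have e7 : r₁ 7 = r 2 := by omega
    rw [e7] at h₅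
    exact ⟨by omega, ⟨ct, h₅⟩, by omega⟩

end Streaming

/-! ## Extending the forest -/

namespace Streaming

open Relation Finset Streaming.Expr Streaming.Cmd

/-- Extending the partial forest, where the vertices of `b` still have to be considered. The entry
`deep₁ q` is the code of the last vertex of `b` on the path to the deep vertex. -/
structure Joining (fp root ad att deep : ℕ → ℕ) (ord : List ℕ) (par dpt : ℕ → ℕ) (b : List ℕ)
    (par₁ dpt₁ deep₁ : ℕ → ℕ) (g : ℕ) : Prop where
  closed : Closed fp b
  subset : b ⊆ ord
  new : ∀ x, x ∉ b → Joins fp root deep ord x →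
    dpt₁ x = ad x ∧ par₁ x = if fp x = 0 then att x else fp x
  same : ∀ x, x ∈ b ∨ ¬ Joins fp root deep ord x → par₁ x = par x ∧ dpt₁ x = dpt x
  path : ∀ x ∈ b, deep (root x - 1) = 0 ∧ deep₁ (root x - 1) = 0 ∨
    ∃ y₀ y, deep (root x - 1) = y₀ + 1 ∧ deep₁ (root x - 1) = y + 1 ∧ y ∈ b ∧ root y = root x ∧
      ∀ z ∈ b, Anc fp z y₀ ↔ Anc fp z y
  flag : g ≠ 0 ↔ ∃ x ∈ ord, x ∉ b ∧ ¬ Joins fp root deep ord x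

namespace Joining

variable {n k x g : ℕ} {dpt ky fp root ad att deep par par₁ dpt₁ deep₁ : ℕ → ℕ}
  {L : List (ℕ × ℕ)} {ord b : List ℕ}

theorem init (hS : Search n dpt ky L fp root ad ord []) (hD : Deepest k root ad ord deep) :
    Joining fp root ad att deep ord par dpt ord par dpt deep 0 where
  closed := hS.closed
  subset := List.Subset.refl _
  new x hx hj := absurd hj.1 hx
  same _ _ := ⟨rfl, rfl⟩
  path x hx := by
    rcases hd : deep (root x - 1) with _ | y
    · exact .inl ⟨rfl, rfl⟩
    · obtain ⟨h₁, h₂, -⟩ := hD.code _ _ hd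
      obtain ⟨q, hq, -⟩ := hS.exists_root hx
      exact .inr ⟨y, y, rfl, rfl, h₁, by omega, fun _ _ => Iff.rfl⟩
  flag := by simp +contextual

/-- Vertices are treated before their parents, so `x`, the head of the list, is not an ancestor of
any other vertex left. Hence it is on the path exactly if it is the lowest path vertex left, which
is the one recorded in `deep₁`. -/
theorem joins_iff (h : Joining fp root ad att deep ord par dpt (x :: b) par₁ dpt₁ deep₁ g) :
    Joins fp root deep ord x ↔ deep₁ (root x - 1) = 0 ∨ deep₁ (root x - 1) = x + 1 := by
  have hx := h.subset List.mem_cons_self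
  rcases h.path x List.mem_cons_self with ⟨h₁, h₂⟩ | ⟨y₀, y, h₁, h₂, hy, -, hz⟩
  · exact ⟨fun _ => .inl h₂, fun _ => ⟨hx, .inl h₁⟩⟩
  · constructor
    · rintro ⟨-, hj | ⟨w, hw, hxw⟩⟩
      · omega
      · obtain rfl : w = y₀ := by omega
        have hxy := (hz x List.mem_cons_self).1 hxw
        rcases List.mem_cons.1 hy with rfl | hy
        · exact .inr h₂
        · exact absurd (h.closed.2.2.anc_mem hy hxy) h.closed.1
    · rintro (hj | hj)
      · omega
      · obtain rfl : y = x := by omega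
        exact ⟨hx, .inr ⟨y₀, h₁, (hz y List.mem_cons_self).2 (Anc.refl y)⟩⟩

theorem skip (h : Joining fp root ad att deep ord par dpt (x :: b) par₁ dpt₁ deep₁ g)
    (hx : ¬ Joins fp root deep ord x) :
    Joining fp root ad att deep ord par dpt b par₁ dpt₁ deep₁ 1 where
  closed := h.closed.2.2
  subset _ hv := h.subset (List.mem_cons_of_mem _ hv)
  new v hv hj := by
    refine h.new v ?_ hj
    rw [List.mem_cons, not_or]
    exact ⟨fun hvx => hx (hvx ▸ hj), hv⟩
  same v hv := h.same v (hv.imp_left (List.mem_cons_of_mem _))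
  path v hv := by
    rcases h.path v (List.mem_cons_of_mem _ hv) with hp | ⟨y₀, y, h₁, h₂, hy, hr, hz⟩
    · exact .inl hp
    · refine .inr ⟨y₀, y, h₁, h₂, ?_, hr, fun z hzb => hz z (List.mem_cons_of_mem _ hzb)⟩
      refine (List.mem_cons.1 hy).resolve_left fun hyx => hx (h.joins_iff.2 (.inr ?_))
      rw [← hyx, hr, h₂]
  flag := by
    refine ⟨fun _ => ⟨x, h.subset List.mem_cons_self, h.closed.1, hx⟩, by simp⟩

/-- When a path vertex joins, the pointer of its tree moves to the parent, which by `Closed` is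
still to come. At the root the pointer becomes `0`, which would wrongly mark the tree as one that
joins entirely; this is harmless, as the root comes after all other vertices of its tree. -/
theorem join (h : Joining fp root ad att deep ord par dpt (x :: b) par₁ dpt₁ deep₁ g)
    (hS : Search n dpt ky L fp root ad ord []) (hx : Joins fp root deep ord x) :
    Joining fp root ad att deep ord par dpt b
      (Function.update par₁ x (if fp x = 0 then att x else fp x)) (Function.update dpt₁ x (ad x))
      (if deep₁ (root x - 1) = 0 then deep₁ else Function.update deep₁ (root x - 1) (fp x)) g where
  closed := h.closed.2.2
  subset _ hv := h.subset (List.mem_cons_of_mem _ hv)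
  new v hv hj := by
    by_cases hvx : v = x
    · subst hvx
      simp
    · rw [Function.update_of_ne hvx, Function.update_of_ne hvx]
      exact h.new v (by simp [hv, hvx]) hj
  same v hv := by
    have hvx : v ≠ x := by
      rintro rfl
      exact hv.elim h.closed.1 fun hj => hj hx
    rw [Function.update_of_ne hvx, Function.update_of_ne hvx]
    exact h.same v (hv.imp_left (List.mem_cons_of_mem _))
  path v hv := by
    have hvo := h.subset (List.mem_cons_of_mem x hv)
    obtain ⟨q, hq, hqo, hq0, hqq, hqv⟩ := hS.exists_root hvo
    obtain ⟨p, hp, -⟩ := hS.exists_root hx.1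
    rcases h.path v (List.mem_cons_of_mem _ hv) with ⟨h₁, h₂⟩ | ⟨y₀, y, h₁, h₂, hy, hr, hz⟩
    · refine .inl ⟨h₁, ?_⟩
      split_ifs with h0
      · exact h₂
      · rw [Function.update_of_ne fun he => h0 (by rw [← he, h₂]), h₂]
    · refine .inr ?_
      by_cases hvx : root v = root x
      · rw [hvx] at h₁ h₂ hr
        have hyx : y = x := by
          rcases h.joins_iff.1 hx with hj | hj <;> omega
        subst hyx
        rw [if_neg (by omega), hvx, Function.update_self]
        rcases hf : fp y with _ | w
        · have := (hS.root_eq y hx.1 hf).1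
          obtain rfl : q = y := by omega
          exact absurd (h.closed.2.2.anc_mem hv hqv) h.closed.1
        · refine ⟨y₀, w, h₁, rfl, h.closed.2.1 w hf, by rw [(hS.child y w hf).2.1], fun z hzb => ?_⟩
          rw [hz z (List.mem_cons_of_mem _ hzb)]
          refine ⟨fun hzy => ?_, fun hzw => hzw.step hf⟩
          rcases hzy.cases with rfl | ⟨c, hc, hc'⟩
          · exact absurd hzb h.closed.1
          · obtain rfl : w = c := by omega
            exact hc
      · refine ⟨y₀, y, h₁, ?_, (List.mem_cons.1 hy).resolve_left fun hyx => hvx ?_, hr,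
          fun z hzb => hz z (List.mem_cons_of_mem _ hzb)⟩
        · split_ifs with h0
          · exact h₂
          · rw [Function.update_of_ne (by omega), h₂]
        · rw [← hr, hyx]
  flag := by
    rw [h.flag]
    constructor
    · rintro ⟨v, hv, hvb, hj⟩
      exact ⟨v, hv, fun hm => hvb (List.mem_cons_of_mem _ hm), hj⟩
    · rintro ⟨v, hv, hvb, hj⟩
      refine ⟨v, hv, ?_, hj⟩
      rw [List.mem_cons, not_or]
      exact ⟨fun hvx => hj (hvx ▸ hx), hvb⟩

theorem extends_of_nil (h : Joining fp root ad att deep ord par dpt [] par₁ dpt₁ deep₁ g)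
    (hS : Search n dpt ky L fp root ad ord []) (hpar : ∀ v, dpt v = 0 → par v = 0) :
    Extends fp root ad att deep ord par dpt par₁ dpt₁ where
  old x hx := h.same x (.inr fun hj => hx (hS.free x hj.1).2)
  new x hx := h.new x (by simp) hx
  rest x hx hj := by
    obtain ⟨h₁, h₂⟩ := h.same x (.inr hj)
    exact ⟨h₂.trans hx, h₁.trans (hpar x hx)⟩

theorem flag_of_nil (h : Joining fp root ad att deep ord par dpt [] par₁ dpt₁ deep₁ g)
    (hS : Search n dpt ky L fp root ad ord []) : g = 0 ↔ ∀ v < n, dpt₁ v ≠ 0 := by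
  have hf := h.flag
  constructor
  · rintro hg v hv h0
    by_cases hj : Joins fp root deep ord v
    · have := hS.ad_pos hj.1
      rw [(h.new v (by simp) hj).1] at h0
      omega
    · refine hf.2 ⟨v, hS.mem_iff.2 ⟨hv, ?_⟩, by simp, hj⟩ hg
      rw [← (h.same v (.inr hj)).2, h0]
  · intro hv
    by_contra hg
    obtain ⟨x, hx, -, hj⟩ := hf.1 hg
    obtain ⟨hxn, hx0⟩ := hS.free x hx
    exact hv x hxn (by rw [(h.same x (.inr hj)).2, hx0])

end Joining

/-- Add the vertex in register `10` to the forest. -/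
def join : Cmd :=
  seq (store 1 (var 10) (load 12 (var 10))) <|
  seq (branch (load 11 (var 10)) (store 0 (var 10) (load 11 (var 10)))
    (store 0 (var 10) (load 2 (var 10)))) <|
  branch (load 16 (var 15)) (store 16 (var 15) (load 11 (var 10))) skip

theorem wp_join {M : ℕ} {r m l} (h10 : r 10 < M) (h15 : r 15 < M) (h12 : m 12 (r 10) ≤ M)
    (h11 : m 11 (r 10) ≤ M) (h2 : m 2 (r 10) ≤ M) :
    wp M M join r m l fun _ m' _ t =>
      m' 1 = Function.update (m 1) (r 10) (m 12 (r 10)) ∧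
      m' 0 = Function.update (m 0) (r 10) (if m 11 (r 10) = 0 then m 2 (r 10) else m 11 (r 10)) ∧
      m' 16 = (if m 16 (r 15) = 0 then m 16 else
        Function.update (m 16) (r 15) (m 11 (r 10))) ∧ t ≤ 40 := by
  unfold join
  by_cases h : m 11 (r 10) = 0 <;> by_cases h' : m 16 (r 15) = 0 <;> simp [h, h'] <;> omega

/-- Extend the forest by the result of the last search of a pass. -/
def commit : Cmd :=
  seq (assign 3 (const 0)) <|
  loop (var 13) <|
    seq (assign 13 (minus (var 13) (const 1))) <|
    seq (assign 10 (load 13 (var 13))) <|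
    seq (assign 15 (minus (load 10 (var 10)) (const 1))) <|
    branch (plus (eq (load 16 (var 15)) (const 0)) (eq (load 16 (var 15)) (plus (var 10) (const 1))))
      join (assign 3 (const 1))

theorem wp_commit {M : ℕ} {r m l} {L : List (ℕ × ℕ)} (hM : 2 * r 0 + 2 ≤ M)
    (hS : Searched (r 0) (r 1) L (m 1) (m 3) m (r 13)) (hatt : ∀ v, m 2 v ≤ r 0)
    (hpar : ∀ v, m 1 v = 0 → m 0 v = 0) :
    wp M M commit r m l fun r' m' _ t =>
      Extends (m 11) (m 10) (m 12) (m 2) (m 16) (ordOf (m 13) (r 13)) (m 0) (m 1) (m' 0) (m' 1) ∧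
      (r' 3 = 0 ↔ ∀ v < r 0, m' 1 v ≠ 0) ∧ (∀ v ≥ r 0, m' 16 v = 0) ∧ t ≤ 200 * (r 0 + 1) := by
  have hlen := hS.search.length_le
  rw [length_ordOf] at hlen
  unfold commit
  rw [wp_seq_iff, wp_assign]
  refine ⟨by simp, ?_⟩
  -- Counting register `13` down runs through the visits backwards, so children come before their
  -- parents.
  refine wp_loop (fun r₁ m₁ _ => r₁ 13 ≤ r 13 ∧ (∀ v ≥ r 0, m₁ 16 v = 0) ∧
    Joining (m 11) (m 10) (m 12) (m 2) (m 16) (ordOf (m 13) (r 13)) (m 0) (m 1)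
      (ordOf (m 13) (r₁ 13)) (m₁ 0) (m₁ 1) (m₁ 16) (r₁ 3))
    (fun r₁ _ _ => 100 * r₁ 13) ?_ ?_ ?_
  · simp only [Function.update_of_ne (show (13 : ℕ) ≠ 3 by decide), Function.update_self]
    exact ⟨le_rfl, fun v hv => (hS.zero v hv).2.2, Joining.init hS.search hS.deep⟩
  · rintro r₁ m₁ l₁ hf ⟨hi, hz, hJ⟩ hc
    have e0 : r₁ 0 = r 0 := by simpa using hf.reg 0 rfl
    have f2 : m₁ 2 = m 2 := by simpa using hf.mem 2 rfl
    have f10 : m₁ 10 = m 10 := by simpa using hf.mem 10 rfl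
    have f11 : m₁ 11 = m 11 := by simpa using hf.mem 11 rfl
    have f12 : m₁ 12 = m 12 := by simpa using hf.mem 12 rfl
    have f13 : m₁ 13 = m 13 := by simpa using hf.mem 13 rfl
    obtain ⟨p, hp⟩ : ∃ p, r₁ 13 = p + 1 := Nat.exists_eq_succ_of_ne_zero (by simpa using hc)
    rw [hp, ordOf] at hJ
    generalize hx : m 13 p = x at hJ
    have hxo := hJ.subset List.mem_cons_self
    have hxn := (hS.search.free x hxo).1
    obtain ⟨q, hq, hqo, -⟩ := hS.search.exists_root hxo
    have hqn := (hS.search.free q hqo).1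
    have hji := hJ.joins_iff
    have hlev := hS.level x hxo
    have hfx : m 11 x ≤ r 0 := by
      rcases hfp : m 11 x with _ | y
      · omega
      · have := (hS.search.free y (hS.search.closed.parent_mem hxo hfp)).1
        omega
    have hax := hatt x
    rw [hq] at hji
    simp only [Nat.add_sub_cancel] at hji
    rw [wp_seq_iff, wp_assign, wp_seq_iff, wp_assign, wp_seq_iff, wp_assign, wp_branch]
    simp only [Expr.ev, hp]
    simp [f10, f13, hx, hq]
    refine ⟨by omega, by omega, by omega, fun hb => ?_, fun hb hb' => ?_⟩
    · have hj : Joins (m 11) (m 10) (m 16) (ordOf (m 13) (r 13)) x := by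
        rw [hji]
        by_contra! hn
        simp [hn.1, hn.2] at hb
      refine wp_conseq (wp_join ?_ ?_ ?_ ?_ ?_) ?_
      · simp; omega
      · simp; omega
      · simp [f12]; omega
      · simp [f11]; omega
      · simp [f2]; omega
      · rintro r₂ m₂ l₂ t₂ hf₂ ⟨q₁, q₂, q₃, ht⟩
        have g13 := hf₂.reg 13 rfl
        have g3 := hf₂.reg 3 rfl
        simp [f11, f2, f12] at q₁ q₂ q₃ g13 g3
        have hJ' := hJ.join hS.search hj
        rw [hq] at hJ'
        simp only [Nat.add_sub_cancel] at hJ'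
        rw [g13, g3, q₁, q₂, q₃]
        refine ⟨⟨by omega, fun v hv => ?_, hJ'⟩, by omega⟩
        split_ifs
        · exact hz v hv
        · rw [Function.update_of_ne (by omega)]
          exact hz v hv
    · have hj : ¬ Joins (m 11) (m 10) (m 16) (ordOf (m 13) (r 13)) x := by
        rw [hji]
        exact fun h => h.elim hb hb'
      exact ⟨by omega, ⟨by omega, hz, hJ.skip hj⟩, by omega⟩
  · rintro r₁ m₁ l₁ t hf ⟨hi, hz, hJ⟩ hc ht
    simp at hc ht
    rw [hc, ordOf] at hJ
    simp only [Expr.size] at ht ⊢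
    exact ⟨hJ.extends_of_nil hS.search hpar, hJ.flag_of_nil hS.search, hz, by omega⟩

end Streaming

/-! ## Reading the stream -/

namespace Streaming

open Relation Finset Streaming.Expr Streaming.Cmd

section attach

variable {n : ℕ} {E : ℕ → ℕ → Prop} {dpt att ky : ℕ → ℕ} {P P' : List (ℕ × ℕ)}

theorem Attach.key_le (h : Attach E dpt att ky P) (hd : ∀ v, dpt v ≤ n) (v : ℕ) : ky v ≤ n := by
  rcases ha : att v with _ | t
  · rw [h.zero v ha]; omega
  · rw [(h.code v t ha).2.2]; exact hd t

theorem Attach.code_le (h : Attach E dpt att ky P) (hE : IsGraph n E) (v : ℕ) : att v ≤ n := by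
  rcases ha : att v with _ | t
  · omega
  · exact hE.lt (h.code v t ha).1

/-- The field `max` only constrains edges between a forest vertex and a free vertex; an edge inside
either side needs no action. -/
theorem Attach.same (h : Attach E dpt att ky P) {u v : ℕ} (huv : dpt u = 0 ↔ dpt v = 0) :
    Attach E dpt att ky (P ++ [(u, v)]) where
  zero := h.zero
  code := h.code
  max x t ht hx := by
    have : Und P t x ∨ (t = u ∧ x = v) ∨ (x = u ∧ t = v) := by
      simp only [Und, List.mem_append, List.mem_singleton, Prod.mk.injEq] at ht ⊢
      tauto
    rcases this with ht | ⟨rfl, rfl⟩ | ⟨rfl, rfl⟩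
    · exact h.max x t ht hx
    · rw [huv.2 hx]; omega
    · rw [huv.1 hx]; omega

theorem Attach.update (h : Attach E dpt att ky P) {x y : ℕ} (hxy : E y x) (hy : dpt y ≠ 0)
    {e : ℕ × ℕ} (he : e = (x, y) ∨ e = (y, x)) :
    Attach E dpt (if ky x < dpt y then Function.update att x (y + 1) else att)
      (if ky x < dpt y then Function.update ky x (dpt y) else ky) (P ++ [e]) := by
  have hund : ∀ a b, Und (P ++ [e]) a b → Und P a b ∨ (a = y ∧ b = x) ∨ (a = x ∧ b = y) := by
    intro a b hab
    rcases he with rfl | rfl <;>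
      simp only [Und, List.mem_append, List.mem_singleton, Prod.mk.injEq] at hab ⊢ <;> tauto
  split_ifs with hlt
  · constructor
    · intro v hv
      by_cases hvx : v = x
      · simp [hvx] at hv
      · rw [Function.update_of_ne hvx] at hv ⊢
        exact h.zero v hv
    · intro v t hv
      by_cases hvx : v = x
      · subst hvx
        obtain rfl : y = t := by simpa using hv
        exact ⟨hxy, hy, by simp⟩
      · rw [Function.update_of_ne hvx] at hv ⊢
        exact h.code v t hv
    · intro v t ht hv
      by_cases hvx : v = x
      · subst hvx
        rw [Function.update_self]
        rcases hund _ _ ht with ht | ⟨rfl, -⟩ | ⟨-, rfl⟩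
        · have := h.max v t ht hv
          omega
        · exact le_rfl
        · exact absurd hv hy
      · rw [Function.update_of_ne hvx]
        rcases hund _ _ ht with ht | ⟨-, hx⟩ | ⟨-, rfl⟩
        · exact h.max v t ht hv
        · exact absurd hx hvx
        · exact absurd hv hy
  · refine ⟨h.zero, h.code, fun v t ht hv => ?_⟩
    rcases hund _ _ ht with ht | ⟨rfl, rfl⟩ | ⟨-, rfl⟩
    · exact h.max v t ht hv
    · omega
    · exact absurd hv hy

end attach

/-- The contents of the memory after the edges of `P` have been read. -/
structure Reading (n k : ℕ) (E : ℕ → ℕ → Prop) (P : List (ℕ × ℕ)) (m : ℕ → ℕ → ℕ) (c : ℕ) :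
    Prop where
  kept : Kept k (m 1) P (pairsOf (m 4) (m 5) c)
  attach : Attach E (m 1) (m 2) (m 3) P
  zero : ∀ v ≥ n, m 10 v = 0 ∧ m 11 v = 0 ∧ m 16 v = 0

theorem Kept.und_lt {n k : ℕ} {E : ℕ → ℕ → Prop} {dpt : ℕ → ℕ} {P L : List (ℕ × ℕ)}
    (h : Kept k dpt P L) (hE : IsGraph n E) (hP : ∀ e ∈ P, E e.1 e.2) (u v : ℕ) (huv : Und L u v) :
    u < n ∧ dpt u = 0 := by
  rcases huv with huv | huv
  · exact ⟨hE.lt (hP _ (h.sub.subset huv)), (h.free _ huv).1⟩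
  · exact ⟨hE.lt (hE.symm (hP _ (h.sub.subset huv))), (h.free _ huv).2⟩

/-- Make room for further edges. -/
def shrink : Cmd := seq dfs prune

theorem wp_shrink {M : ℕ} {r m l} {E : ℕ → ℕ → Prop} {P : List (ℕ × ℕ)}
    (hM : 2 * r 2 + 2 * r 0 + 2 ≤ M) (hM' : r 0 * r 1 ≤ M) (hE : IsGraph (r 0) E)
    (hd : ∀ v, m 1 v ≤ r 0) (hP : Distinct P) (hPE : ∀ e ∈ P, E e.1 e.2)
    (h : Reading (r 0) (r 1) E P m (r 2)) :
    wp M M shrink r m l fun r' m' _ t => Reading (r 0) (r 1) E P m' (r' 2) ∧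
      r' 2 ≤ r 0 * r 1 + r 0 ∧ t ≤ 5000 * (r 2 + r 0 + 2) := by
  have hL := h.kept.und_lt hE hPE
  have hn : ∀ e ∈ P, e.1 < r 0 ∧ e.2 < r 0 := fun e he =>
    ⟨hE.lt (hPE e he), hE.lt (hE.symm (hPE e he))⟩
  unfold shrink
  rw [wp_seq_iff]
  refine wp_conseq (wp_dfs hM (h.attach.key_le hd) hL h.zero) ?_
  rintro r₁ m₁ l₁ t₁ hf₁ ⟨hS, hp, hz, ht₁⟩
  have a0 : r₁ 0 = r 0 := hf₁.reg 0 rfl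
  have a1 : r₁ 1 = r 1 := hf₁.reg 1 rfl
  have a2 : r₁ 2 = r 2 := hf₁.reg 2 rfl
  have b1 : m₁ 1 = m 1 := hf₁.mem 1 rfl
  have b2 : m₁ 2 = m 2 := hf₁.mem 2 rfl
  have b3 : m₁ 3 = m 3 := hf₁.mem 3 rfl
  have hroot : ∀ e ∈ pairsOf (m 4) (m 5) (r 2), ∃ q < r 0, m₁ 10 e.1 = q + 1 := by
    intro e he
    obtain ⟨q, hq, hqo, -⟩ := hS.search.exists_root (hS.search.mem_iff.2 (hL e.1 e.2 (.inl he)))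
    exact ⟨q, (hS.search.free q hqo).1, hq⟩
  have hsz : ∀ q < r 0, r 1 * m₁ 14 q ≤ M := by
    intro q hq
    rw [hS.size q hq]
    calc r 1 * ((range (r 0)).filter fun v => m₁ 10 v = q + 1).card ≤ r 1 * r 0 :=
          Nat.mul_le_mul_left _ ((card_filter_le _ _).trans (by simp))
      _ = r 0 * r 1 := Nat.mul_comm _ _
      _ ≤ M := hM'
  refine wp_conseq (wp_prune (by omega) (by omega) (by omega) ?_ (by rwa [a0, a1])
    (by rwa [a0])) ?_
  · rw [a2, hp, a0]
    exact fun e he => ⟨hn e (h.kept.sub.subset he), hroot e he⟩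
  rintro r₂ m₂ l₂ t₂ hf₂ ⟨⟨ct, hpr⟩, ht₂⟩
  rw [a2, hp, a0, a1] at hpr
  rw [a2] at ht₂
  have hdist := (hP.sublist h.kept.sub).sublist hpr.sub
  refine ⟨⟨?_, ?_, ?_⟩, ?_, by omega⟩
  · rw [show m₂ 1 = m 1 from (hf₂.mem 1 rfl).trans b1]
    refine h.kept.filter hP hn hS.search hpr.sub hpr.tree fun e he he' => ?_
    obtain ⟨q, hq, hqe⟩ := hroot e he
    -- The counter of a tree that dropped an edge is at least `k` times its size, and it counts only
    -- retained edges; this is the density that `Kept.filter` requires.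
    have h₁ := hpr.drop e he he'
    have h₂ := hpr.count q
    rw [hqe] at h₁ ⊢
    rw [Nat.add_sub_cancel, hS.size q hq] at h₁
    exact h₁.trans h₂
  · rw [show m₂ 1 = m 1 from (hf₂.mem 1 rfl).trans b1,
      show m₂ 2 = m 2 from (hf₂.mem 2 rfl).trans b2, show m₂ 3 = m 3 from (hf₂.mem 3 rfl).trans b3]
    exact h.attach
  · rw [show m₂ 10 = m₁ 10 from hf₂.mem 10 rfl, show m₂ 11 = m₁ 11 from hf₂.mem 11 rfl,
      show m₂ 16 = m₁ 16 from hf₂.mem 16 rfl]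
    exact hS.zero
  · rw [← length_pairsOf (m₂ 4) (m₂ 5) (r₂ 2)]
    exact hpr.length_le hdist (fun e he => hn e (h.kept.sub.subset (hpr.sub.subset he))) hS.size

/-- Note that the vertex in register `y` is a neighbour in the forest of the vertex in `x`. -/
def attachTo (x y : ℕ) : Cmd :=
  branch (lt (load 3 (var x)) (load 1 (var y)))
    (seq (store 3 (var x) (load 1 (var y))) (store 2 (var x) (plus (var y) (const 1))))
    skip

theorem wp_attachTo {M x y : ℕ} {r m l} (hx : r x < M) (hy : r y < M) (hd : m 1 (r y) ≤ M) :
    wp M M (attachTo x y) r m l fun r' m' _ t => r' = r ∧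
      m' 2 = (if m 3 (r x) < m 1 (r y) then Function.update (m 2) (r x) (r y + 1) else m 2) ∧
      m' 3 = (if m 3 (r x) < m 1 (r y) then Function.update (m 3) (r x) (m 1 (r y)) else m 3) ∧
      t ≤ 30 := by
  unfold attachTo
  by_cases h : m 3 (r x) < m 1 (r y)
  · simp [h]
    omega
  · simp [h]

/-- Process the edge in the registers `4` and `5`. -/
def takeEdge : Cmd :=
  branch (load 1 (var 4))
    (branch (load 1 (var 5)) skip (attachTo 5 4))
    (branch (load 1 (var 5)) (attachTo 4 5)
      (seq (store 4 (var 2) (var 4)) <|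
        seq (store 5 (var 2) (var 5)) <|
        assign 2 (plus (var 2) (const 1))))

theorem wp_takeEdge {M : ℕ} {r m l} {E : ℕ → ℕ → Prop} {P : List (ℕ × ℕ)} (hM : r 0 < M)
    (h2 : r 2 < M) (hE : IsGraph (r 0) E) (hd : ∀ v, m 1 v ≤ r 0) (he : E (r 4) (r 5))
    (h : Reading (r 0) (r 1) E P m (r 2)) :
    wp M M takeEdge r m l fun r' m' _ t =>
      Reading (r 0) (r 1) E (P ++ [(r 4, r 5)]) m' (r' 2) ∧ r' 2 ≤ r 2 + 1 ∧ t ≤ 50 := by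
  have h4 := hE.lt he
  have h5 := hE.lt (hE.symm he)
  have hd4 := hd (r 4)
  have hd5 := hd (r 5)
  unfold takeEdge
  rw [wp_branch]
  refine ⟨fun h₁ => ?_, fun h₁ => ?_⟩
  all_goals
    simp only [Expr.ev] at h₁
    rw [wp_branch]
    refine ⟨fun h₂ => ?_, fun h₂ => ?_⟩
    all_goals simp only [Expr.ev] at h₂
  · simp
    exact ⟨h.kept.skip fun hc => h₁ hc.1, h.attach.same (by omega), h.zero⟩
  · refine wp_conseq (wp_attachTo (by omega) (by omega) (by omega)) ?_
    rintro r' m' l' t' hf ⟨rfl, q₂, q₃, ht⟩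
    refine ⟨⟨?_, ?_, ?_⟩, by omega, by simp; omega⟩
    · rw [hf.mem 1 rfl, hf.mem 4 rfl, hf.mem 5 rfl]
      exact h.kept.skip fun hc => h₁ hc.1
    · rw [hf.mem 1 rfl, q₂, q₃]
      exact h.attach.update he h₁ (.inr rfl)
    · rw [hf.mem 10 rfl, hf.mem 11 rfl, hf.mem 16 rfl]
      exact h.zero
  · refine wp_conseq (wp_attachTo (by omega) (by omega) (by omega)) ?_
    rintro r' m' l' t' hf ⟨rfl, q₂, q₃, ht⟩
    refine ⟨⟨?_, ?_, ?_⟩, by omega, by simp; omega⟩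
    · rw [hf.mem 1 rfl, hf.mem 4 rfl, hf.mem 5 rfl]
      exact h.kept.skip fun hc => h₂ hc.2
    · rw [hf.mem 1 rfl, q₂, q₃]
      exact h.attach.update (hE.symm he) h₂ (.inl rfl)
    · rw [hf.mem 10 rfl, hf.mem 11 rfl, hf.mem 16 rfl]
      exact h.zero
  · simp
    refine ⟨by omega, by omega, by omega, by omega, by omega, ⟨?_, ?_, ?_⟩⟩
    · simp
      rw [pairsOf_succ, Function.update_self, Function.update_self, pairsOf_congr fun j hj => by
        rw [Function.update_of_ne (by omega), Function.update_of_ne (by omega)]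
        exact ⟨rfl, rfl⟩]
      exact h.kept.add ⟨h₁, h₂⟩
    · simpa using h.attach.same (by omega)
    · simpa using h.zero

/-- The number of edges for which there is room. -/
def capacity : Expr := times (const 2) (plus (times (var 0) (var 1)) (var 0))

/-- Read the stream. -/
def readStream : Cmd :=
  seq (assign 2 (const 0)) <|
  seq (assign 6 (const 1)) <|
  loop (var 6) <|
    seq (next 4 5 6) <|
    branch (var 6) (seq takeEdge <| branch (lt (var 2) capacity) skip shrink) skip

theorem wp_readStream {M : ℕ} {r m l} {E : ℕ → ℕ → Prop}
    (hM : 4 * (r 0 * r 1 + r 0) + 2 * r 0 + 2 ≤ M) (hn : 0 < r 0) (hk : 0 < r 1)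
    (hE : IsGraph (r 0) E) (hl : Lists E l) (hd : ∀ v, m 1 v ≤ r 0)
    (ha : Attach E (m 1) (m 2) (m 3) []) (hz : ∀ v ≥ r 0, m 10 v = 0 ∧ m 11 v = 0 ∧ m 16 v = 0) :
    wp M M readStream r m l fun r' m' _ t => Reading (r 0) (r 1) E l m' (r' 2) ∧
      r' 2 ≤ 2 * (r 0 * r 1 + r 0) ∧ t ≤ 100000 * (l.length + 1) := by
  have hnk : r 0 ≤ r 0 * r 1 := Nat.le_mul_of_pos_right _ hk
  generalize hN : r 0 * r 1 = N at *
  unfold readStream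
  simp only [wp_seq_iff]
  simp only [wp_assign]
  refine ⟨by simp, by simp; omega, ?_⟩
  refine wp_loop (fun r₁ m₁ l₁ => (r₁ 2 < 2 * (N + r 0) ∧ r₁ 6 ≤ 1 ∧ (r₁ 6 = 0 → l₁ = [])) ∧
      ∃ P, P ++ l₁ = l ∧ Reading (r 0) (r 1) E P m₁ (r₁ 2))
    -- Each stored edge beyond `N + n` carries a deposit of `50000`. A cut at `2 * (N + n)` edges
    -- costs at most `5000 * (2 * N + 3 * n + 2)` and releases `50000 * (N + n)`. An unread edge
    -- holds `60000`: the deposit and its own processing.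
    (fun r₁ _ l₁ => 60000 * l₁.length + 50000 * (r₁ 2 - (N + r 0)) + 100 * r₁ 6) ?_ ?_ ?_
  · refine ⟨by simp; omega, [], by simp, ?_, ha, hz⟩
    simpa [pairsOf] using Kept.nil _ _
  · rintro r₁ m₁ l₁ hf ⟨⟨h₁, h₂, h₃⟩, P, hP, h₄⟩ hc
    have e0 : r₁ 0 = r 0 := by simpa using hf.reg 0 rfl
    have e1 : r₁ 1 = r 1 := by simpa using hf.reg 1 rfl
    have f1 : m₁ 1 = m 1 := by simpa using hf.mem 1 rfl
    simp only [Expr.ev] at hc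
    rcases l₁ with _ | ⟨⟨u, v⟩, l₁⟩
    · rw [List.append_nil] at hP
      simp [wp]
      exact ⟨⟨by omega, hP ▸ h₄⟩, by omega⟩
    · have he : E u v := hl.sound (u, v) (by rw [← hP]; simp)
      have hu := hE.lt he
      have hv := hE.lt (hE.symm he)
      have hP' : (P ++ [(u, v)]) ++ l₁ = l := by simpa using hP
      simp only [wp_seq_iff]
      rw [wp]
      refine ⟨by omega, by omega, by omega, ?_⟩
      rw [wp_branch]
      refine ⟨fun _ => ?_, fun h => by simp at h⟩
      rw [wp_seq_iff]
      refine wp_conseq (wp_takeEdge (E := E) (P := P) ?_ ?_ ?_ ?_ ?_ ?_) ?_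
      · simp; omega
      · simp; omega
      · simpa [e0] using hE
      · simpa [e0, f1] using hd
      · simpa using he
      · simpa [e0, e1] using h₄
      rintro r₂ m₂ l₂ t₂ hf₂ ⟨q₁, q₂, ht₂⟩
      have g0 := hf₂.reg 0 rfl
      have g1 := hf₂.reg 1 rfl
      have g6 := hf₂.reg 6 rfl
      have k1 := hf₂.mem 1 rfl
      have gl := hf₂.rest rfl
      simp [e0, e1] at g0 g1 g6 q₁ q₂
      rw [f1] at k1
      rw [wp_branch]
      simp only [capacity, Expr.ev, g0, g1, hN, Expr.size]
      refine ⟨fun hb => ?_, fun hb => ?_⟩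
      · have hlt : r₂ 2 < 2 * (N + r 0) := by
          by_contra hcon
          rw [if_neg hcon] at hb
          exact hb rfl
        rw [wp_skip, gl]
        refine ⟨⟨by omega, _, hP', q₁⟩, ?_⟩
        rw [g6]
        simp only [List.length_cons]
        omega
      · have hlt : ¬ r₂ 2 < 2 * (N + r 0) := by
          intro hcon
          rw [if_pos hcon] at hb
          exact absurd hb one_ne_zero
        have hsub : (P ++ [(u, v)]).Sublist l := by
          rw [← hP']
          exact List.sublist_append_left _ _
        refine wp_conseq (wp_shrink (E := E) (by omega) (by rw [g0, g1, hN]; omega) (by rwa [g0])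
          (by rwa [g0, k1]) (hl.distinct.sublist hsub) (fun e he => hl.sound e (hsub.subset he))
          (by rwa [g0, g1])) ?_
        rintro r₃ m₃ l₃ t₃ hf₃ ⟨s₁, s₂, ht₃⟩
        rw [g0, g1] at s₁
        rw [g0, g1, hN] at s₂
        rw [g0] at ht₃
        have v6 : r₃ 6 = 1 := (hf₃.reg 6 rfl).trans g6
        have vl : l₃ = l₁ := (hf₃.rest rfl).trans gl
        rw [vl]
        refine ⟨⟨by omega, _, hP', s₁⟩, ?_⟩
        rw [v6]
        simp only [List.length_cons]
        omega
  · rintro r₁ m₁ l₁ t hf ⟨⟨h₁, h₂, h₃⟩, P, hP, h₄⟩ hc ht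
    simp at hc ht ⊢
    rw [h₃ hc, List.append_nil] at hP
    subst hP
    exact ⟨h₄, by omega, by omega⟩

end Streaming

/-! ## The algorithm -/

namespace Streaming

open Relation Finset Streaming.Expr Streaming.Cmd

/-- The contents of the memory between two passes. -/
structure Ready (n : ℕ) (E : ℕ → ℕ → Prop) (m : ℕ → ℕ → ℕ) : Prop where
  forest : Partial n E (m 0) (m 1)
  attach : Attach E (m 1) (m 2) (m 3) []
  zero : ∀ v ≥ n, m 10 v = 0 ∧ m 11 v = 0 ∧ m 16 v = 0

/-- The work done in a pass. -/
def phase : Cmd := seq readStream <| seq dfs commit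

open Classical in
theorem wp_phase {M : ℕ} {r m l} {E : ℕ → ℕ → Prop}
    (hM : 4 * (r 0 * r 1 + r 0) + 2 * r 0 + 2 ≤ M) (hn : 0 < r 0) (hk : 0 < r 1)
    (hE : IsGraph (r 0) E) (hl : Lists E l) (h : Ready (r 0) E m) :
    wp M M phase r m l fun r' m' _ t => Ready (r 0) E m' ∧
      (r' 3 = 0 ↔ ∀ v < r 0, m' 1 v ≠ 0) ∧
      (∀ v < r 0, m' 1 v = 0 → m 1 v = 0 ∧ ((range (r 0)).filter (FConn E (m' 1) v)).card + r 1 ≤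
        ((range (r 0)).filter (FConn E (m 1) v)).card) ∧
      t ≤ 110000 * (l.length + r 0 + 2) := by
  have hd := h.forest.dpt_le
  unfold phase
  rw [wp_seq_iff]
  refine wp_conseq (wp_readStream hM hn hk hE hl hd h.attach h.zero) ?_
  rintro r₁ m₁ l₁ t₁ hf₁ ⟨hR, hc, ht₁⟩
  have a0 : r₁ 0 = r 0 := hf₁.reg 0 rfl
  have a1 : r₁ 1 = r 1 := hf₁.reg 1 rfl
  have b0 : m₁ 0 = m 0 := hf₁.mem 0 rfl
  have b1 : m₁ 1 = m 1 := hf₁.mem 1 rfl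
  -- The kept edges form a sublist of the stream, so the last search is linear in `m + n`, although
  -- the store has room for more than `nk` edges.
  have hlen := hR.kept.sub.length_le
  rw [length_pairsOf] at hlen
  rw [wp_seq_iff]
  refine wp_conseq (wp_dfs (by omega) (by rw [a0]; exact hR.attach.key_le (by rwa [b1]))
    (by rw [a0]; exact hR.kept.und_lt hE hl.sound) (by rw [a0]; exact hR.zero)) ?_
  rintro r₂ m₂ l₂ t₂ hf₂ ⟨hS, -, -, ht₂⟩
  have c0 : r₂ 0 = r 0 := (hf₂.reg 0 rfl).trans a0
  have c1 : r₂ 1 = r 1 := (hf₂.reg 1 rfl).trans a1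
  have d0 : m₂ 0 = m 0 := (hf₂.mem 0 rfl).trans b0
  have d1 : m₂ 1 = m 1 := (hf₂.mem 1 rfl).trans b1
  have d2 : m₂ 2 = m₁ 2 := hf₂.mem 2 rfl
  have d3 : m₂ 3 = m₁ 3 := hf₂.mem 3 rfl
  rw [a0, a1, b1, ← d3] at hS
  have hatt := hR.attach
  rw [b1, ← d2, ← d3] at hatt
  refine wp_conseq (wp_commit (L := pairsOf (m₁ 4) (m₁ 5) (r₁ 2)) (by omega)
    (by rwa [c0, c1, d1]) (by rw [c0]; exact hatt.code_le hE)
    (by rw [d0, d1]; exact h.forest.par_zero)) ?_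
  rintro r₃ m₃ l₃ t₃ hf₃ ⟨hx, hg, hz, ht₃⟩
  rw [d0, d1] at hx
  rw [c0] at hg hz ht₃
  have hend : PassEnd (r 0) (r 1) E (m 0) (m 1) (m₂ 2) (m₂ 3) (m₂ 11) (m₂ 10) (m₂ 12) (m₂ 16)
      (m₃ 0) (m₃ 1) l (pairsOf (m₁ 4) (m₁ 5) (r₁ 2)) (ordOf (m₂ 13) (r₂ 13)) :=
    ⟨hk, hE, hl, h.forest, b1 ▸ hR.kept, hS.search, hatt, hS.deep, hx⟩
  refine ⟨⟨hend.partial_next, ?_, fun v hv => ?_⟩, hg,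
    fun v hv hv' => ⟨hend.dpt_of_dpt' v hv', hend.card_next hv hv'⟩, by omega⟩
  -- The table of neighbours need not be cleared: old forest vertices keep their levels, so its
  -- entries remain true, and for the empty list `max` claims nothing.
  · rw [show m₃ 2 = m₂ 2 from hf₃.mem 2 rfl, show m₃ 3 = m₂ 3 from hf₃.mem 3 rfl]
    refine ⟨hatt.zero, fun v t hv => ?_, fun v t ht => by simp [Und] at ht⟩
    obtain ⟨q₁, q₂, q₃⟩ := hatt.code v t hv
    rw [(hx.old t q₂).2]
    exact ⟨q₁, q₂, q₃⟩
  · rw [hf₃.mem 10 rfl, hf₃.mem 11 rfl]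
    exact ⟨(hS.zero v hv).1, (hS.zero v hv).2.1, hz v hv⟩

/-- The main loop. -/
def passes : Cmd := loop (var 3) (seq newPass phase)

/-- The streaming algorithm. -/
def streamDFS : Cmd := seq (assign 3 (const 1)) passes

open Classical in
/-- The situation between two passes: `M` bounds the space and `B` the number of steps in a pass. -/
structure Between (n k : ℕ) (E : ℕ → ℕ → Prop) (M B : ℕ) (s : State) : Prop where
  n_eq : s.reg 0 = n
  k_eq : s.reg 1 = k
  ready : Ready n E s.mem
  flag : s.reg 3 = 0 ↔ ∀ v < n, s.mem 1 v ≠ 0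
  card : ∀ v < n, s.mem 1 v = 0 →
    ((range n).filter (FConn E (s.mem 1) v)).card + s.pass * k ≤ n
  pass : ∀ p, s.pass = p + 1 → p * k < n
  clock_lt : ∀ j < s.pass, s.clock j ≤ B + 2
  clock_eq : s.clock s.pass ≤ B
  clock_gt : ∀ j, s.pass < j → s.clock j = 0
  cells : s.cells ≤ M
  word : s.word ≤ M

/-- A free vertex lies in its own component, so `Between.card` gives `pass * k < n` whenever another
pass starts; in particular the loop ends after at most `n` passes. The `2` added to `B` is the test
of the loop, which is still charged to the pass just finished. -/
theorem exec_passes {n k M B m : ℕ} {E : ℕ → ℕ → Prop} {σ : ℕ → List (ℕ × ℕ)} {s : State}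
    (hM : 4 * (n * k + n) + 2 * n + 2 ≤ M) (hn : 0 < n) (hk : 0 < k) (hE : IsGraph n E)
    (hσ : ∀ j, Lists E (σ j)) (hm : ∀ j, (σ j).length = m)
    (hB : 110000 * (m + n + 2) + 1 ≤ B) (h : Between n k E M B s) :
    ∃ s', Exec σ passes s s' ∧ Partial n E (s'.mem 0) (s'.mem 1) ∧ (∀ v < n, s'.mem 1 v ≠ 0) ∧
      (∀ p, s'.pass = p + 1 → p * k < n) ∧ (∀ j, s'.clock j ≤ B + 2) ∧ s'.cells ≤ M ∧
      s'.word ≤ M := by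
  classical
  obtain ⟨b, hb⟩ : ∃ b, n ≤ s.pass + b := ⟨n, by omega⟩
  induction b generalizing s with
  | zero =>
    have hfl : s.reg 3 = 0 := by
      rw [h.flag]
      intro v hv h0
      have h₁ := h.card v hv h0
      have h₂ : 0 < ((range n).filter (FConn E (s.mem 1) v)).card :=
        card_pos.2 ⟨v, mem_filter.2 ⟨mem_range.2 hv, ReflTransGen.refl⟩⟩
      have := Nat.le_mul_of_pos_right s.pass hk
      omega
    refine ⟨_, .loopFalse hfl, h.ready.forest, h.flag.1 hfl, h.pass, fun j => ?_, h.cells, h.word⟩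
    have h₁ := h.clock_lt j
    have h₂ := h.clock_eq
    have h₃ := h.clock_gt j
    simp only [State.tick, Function.update_apply, Expr.size]
    split_ifs <;> grind
  | succ b ih =>
    by_cases hfl : s.reg 3 = 0
    · refine ⟨_, .loopFalse hfl, h.ready.forest, h.flag.1 hfl, h.pass, fun j => ?_, h.cells, h.word⟩
      have h₁ := h.clock_lt j
      have h₂ := h.clock_eq
      have h₃ := h.clock_gt j
      simp only [State.tick, Function.update_apply, Expr.size]
      split_ifs <;> grind
    · obtain ⟨v, hv, h0⟩ : ∃ v < n, s.mem 1 v = 0 := by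
        by_contra! hcon
        exact hfl (h.flag.2 hcon)
      have hpk : s.pass * k < n := by
        have h₁ := h.card v hv h0
        have h₂ : 0 < ((range n).filter (FConn E (s.mem 1) v)).card :=
          card_pos.2 ⟨v, mem_filter.2 ⟨mem_range.2 hv, ReflTransGen.refl⟩⟩
        omega
      obtain ⟨s₁, hs₁⟩ : ∃ s₁, s₁ = ((s.tick ((var 3).size + 1)).startPass σ).tick 1 := ⟨_, rfl⟩
      have r₁ : s₁.reg = s.reg := by rw [hs₁]; rfl
      have m₁ : s₁.mem = s.mem := by rw [hs₁]; rfl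
      have l₁ : s₁.rest = σ s.pass := by rw [hs₁]; rfl
      have p₁ : s₁.pass = s.pass + 1 := by rw [hs₁]; rfl
      have c₁ : s₁.cells = s.cells := by rw [hs₁]; rfl
      have w₁ : s₁.word = s.word := by rw [hs₁]; rfl
      have k₁ : s₁.clock = Function.update (Function.update s.clock s.pass (s.clock s.pass + 2))
          (s.pass + 1) (s.clock (s.pass + 1) + 1) := by
        rw [hs₁]
        simp [State.tick, State.startPass, Expr.size]
      have hwp := wp_phase (M := M) (r := s₁.reg) (m := s₁.mem) (l := s₁.rest) (E := E)
        (by rwa [r₁, h.n_eq, h.k_eq]) (by rwa [r₁, h.n_eq]) (by rwa [r₁, h.k_eq])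
        (by rwa [r₁, h.n_eq]) (by rw [l₁]; exact hσ _) (by rw [r₁, m₁, h.n_eq]; exact h.ready)
      obtain ⟨s₂, t, hx, ⟨⟨q₁, q₂, q₃, ht⟩, hfr⟩, p₂, k₂, c₂, w₂⟩ :=
        wp_sound σ (wp_conseq (Q' := fun r m l t => _ ∧ Frame phase s₁.reg s₁.mem s₁.rest r m l) hwp
          fun _ _ _ _ hfr h => ⟨h, hfr⟩)
      rw [r₁, h.n_eq] at q₁ q₂ q₃ ht
      rw [l₁, hm] at ht
      rw [m₁, h.k_eq] at q₃
      have g0 := hfr.reg 0 rfl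
      have g1 := hfr.reg 1 rfl
      rw [r₁] at g0 g1
      have hz := h.clock_gt (s.pass + 1) (by omega)
      have hbt : Between n k E M B s₂ := by
        refine ⟨g0.trans h.n_eq, g1.trans h.k_eq, q₁, q₂, fun w hw hw0 => ?_, fun p hp => ?_,
          fun j hj => ?_, ?_, fun j hj => ?_, ?_, ?_⟩
        · obtain ⟨u₁, u₂⟩ := q₃ w hw hw0
          have u₃ := h.card w hw u₁
          rw [p₂, p₁, Nat.add_mul, Nat.one_mul]
          omega
        · obtain rfl : p = s.pass := by omega
          exact hpk
        · have h₁ := h.clock_lt j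
          have h₂ := h.clock_eq
          rw [k₂, p₁, k₁, Function.update_of_ne (by omega), Function.update_of_ne (by omega)]
          by_cases hjs : j = s.pass
          · rw [hjs, Function.update_self]
            omega
          · rw [Function.update_of_ne hjs]
            exact h₁ (by omega)
        · rw [k₂, p₂, Function.update_self, p₁, k₁, Function.update_self, hz]
          omega
        · rw [k₂, p₁, k₁, Function.update_of_ne (by omega), Function.update_of_ne (by omega),
            Function.update_of_ne (by omega)]
          exact h.clock_gt j (by omega)
        · have := h.cells
          omega
        · have := h.word
          omega
      obtain ⟨s₃, hx₃, hpost⟩ := ih hbt (by omega)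
      refine ⟨s₃, .loopTrue hfl (.seq (.newPass _) ?_) hx₃, hpost⟩
      rw [← hs₁]
      exact hx

theorem card_le_two_mul_edges {n : ℕ} {G : SimpleGraph (Fin n)} (hG : G.Connected) (hn : 2 ≤ n) :
    n ≤ 2 * G.edgeSet.ncard := by
  have h := hG.card_vert_le_card_edgeSet_add_one
  rw [Nat.card_fin, Nat.card_coe_set_eq] at h
  omega

theorem exec_streamDFS {n k : ℕ} (hn : 0 < n) (hk : 0 < k) (G : SimpleGraph (Fin n))
    (σ : ℕ → List (Fin n × Fin n)) (hσ : ∀ j, IsEdgeStream G (σ j)) :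
    ∃ s, Exec (fun j => toWords (σ j)) streamDFS (State.init n k) s ∧
      Partial n (natAdj G) (s.mem 0) (s.mem 1) ∧ (∀ v < n, s.mem 1 v ≠ 0) ∧
      (∀ p, s.pass = p + 1 → p * k < n) ∧
      (∀ j, s.clock j ≤ 400000 * (G.edgeSet.ncard + n)) ∧ s.cells ≤ 12 * (n * k) ∧
      s.word ≤ 12 * (n * k) := by
  classical
  have hnk : n ≤ n * k := Nat.le_mul_of_pos_right _ hk
  have hnk' : k ≤ n * k := Nat.le_mul_of_pos_left _ hn
  -- As `n` and `1` are at most `n * k`, the requirement `4 * (n * k + n) + 2 * n + 2` is at most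
  -- `12 * (n * k)`. The last `1` in the time bound is the step of `newPass`.
  have hbt : Between n k (natAdj G) (12 * (n * k)) (110000 * (G.edgeSet.ncard + n + 2) + 1)
      (((State.init n k).setReg 3 1).tick 2) := by
    refine ⟨rfl, rfl, ⟨Partial.empty n _, ⟨fun _ _ => rfl, ?_, ?_⟩, ?_⟩, ?_, ?_, ?_, ?_, ?_, ?_, ?_,
      ?_⟩
    · intro v t h
      exact absurd h (by simp [State.tick, State.setReg, State.init])
    · intro v t h
      simp [Und] at h
    · intro v hv
      exact ⟨rfl, rfl, rfl⟩
    · simpa [State.tick, State.setReg, State.init] using ⟨0, hn⟩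
    · intro v hv _
      simpa [State.tick, State.setReg, State.init] using
        (card_filter_le (range n) _).trans (card_range n).le
    · intro p hp
      simp [State.tick, State.setReg, State.init] at hp
    · intro j hj
      simp [State.tick, State.setReg, State.init] at hj
    · simp [State.tick, State.setReg, State.init]
      omega
    · intro j hj
      have hj' : j ≠ 0 := by
        rintro rfl
        exact absurd hj (by simp [State.tick, State.setReg, State.init])
      simp [State.tick, State.setReg, State.init, hj']
    · simp [State.tick, State.setReg, State.init]
    · simp [State.tick, State.setReg, State.init]
      omega
  obtain ⟨s, hx, h₁, h₂, h₃, h₄, h₅⟩ := exec_passes (σ := fun j => toWords (σ j)) (by omega) hn hk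
    (isGraph_natAdj G) (fun j => lists_toWords (hσ j)) (fun j => length_toWords (hσ j)) le_rfl hbt
  refine ⟨s, .seq (.assign 3 (const 1) _) hx, h₁, h₂, h₃, fun j => ?_, h₅⟩
  have := h₄ j
  omega

end Streaming

theorem theorem1 :
    ∃ (P : Cmd) (C : ℕ), ∀ (n k : ℕ), 0 < n → 0 < k →
      ∀ (G : SimpleGraph (Fin n)) (σ : ℕ → List (Fin n × Fin n)), (∀ j, IsEdgeStream G (σ j)) →
        ∃ (s : State) (par : Fin n → Option (Fin n)),
          Exec (fun j => toWords (σ j)) P (State.init n k) s ∧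
          (∀ v : Fin n, s.mem 0 v = parentCode (par v)) ∧
          IsDFSForest G par ∧
          s.pass ≤ ⌈(n : ℚ) / k⌉₊ ∧
          P.space s ≤ C * (n * k) ∧
          s.word ≤ (n + k) ^ C ∧
          ∀ j, s.clock j ≤
              C * ((G.edgeSet.ncard + n) * invAck (G.edgeSet.ncard + n) n) ∧
            (G.Connected → 2 ≤ n →
              s.clock j ≤ C * (G.edgeSet.ncard * invAck G.edgeSet.ncard n)) := by
  -- Here `13` stands for `12 * (n * k)` cells and one more per array, and `1200000` is `3 *
  -- 400000`, as `m + n ≤ 3 * m` for connected graphs with `n ≥ 2`.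
  refine ⟨streamDFS, streamDFS.width * 13 + 1200000, fun n k hn hk G σ hσ => ?_⟩
  obtain ⟨s, hx, hp, hall, hpass, hclock, hcells, hword⟩ := exec_streamDFS hn hk G σ hσ
  have hnk : 1 ≤ n * k := Nat.mul_pos hn hk
  refine ⟨s, _, hx, parentCode_decodeParent hp, hp.isDFSForest hall, ?_, ?_, ?_, fun j => ⟨?_, ?_⟩⟩
  · rcases h : s.pass with _ | p
    · exact Nat.zero_le _
    · refine Nat.succ_le_of_lt (Nat.lt_ceil.2 ?_)
      rw [lt_div_iff₀ (by exact_mod_cast hk)]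
      exact_mod_cast hpass p h
  · calc streamDFS.width * (s.cells + 1) ≤ streamDFS.width * (13 * (n * k)) :=
          Nat.mul_le_mul_left _ (by omega)
      _ = streamDFS.width * 13 * (n * k) := by ring
      _ ≤ _ := Nat.mul_le_mul_right _ (by omega)
  · calc s.word ≤ 12 * (n * k) := hword
      -- The factor `12` is absorbed by a power of `n + k`, because `n + k ≥ 2`.
      _ ≤ 2 ^ 4 * ((n + k) * (n + k)) :=
          Nat.mul_le_mul (by norm_num) (Nat.mul_le_mul (by omega) (by omega))
      _ ≤ (n + k) ^ 4 * ((n + k) * (n + k)) :=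
          Nat.mul_le_mul_right _ (Nat.pow_le_pow_left (by omega) 4)
      _ = (n + k) ^ 6 := by ring
      _ ≤ _ := Nat.pow_le_pow_right (by omega) (by omega)
  · calc s.clock j ≤ 400000 * (G.edgeSet.ncard + n) := hclock j
      _ ≤ _ := Nat.mul_le_mul (by omega)
          (Nat.le_mul_of_pos_right _ (one_le_invAck (by omega) hn))
  · intro hG hn2
    have := card_le_two_mul_edges hG hn2
    calc s.clock j ≤ 400000 * (G.edgeSet.ncard + n) := hclock j
      _ ≤ 1200000 * G.edgeSet.ncard := by omega
      _ ≤ _ := Nat.mul_le_mul (by omega)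
          (Nat.le_mul_of_pos_right _ (one_le_invAck (by omega) hn))
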